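/- **Setting.** Simple types are generated by $\sigma::=o\mid\sigma\to\sigma$, EAL-types by $A::=o\mid A\multimap A\mid\,!A$; the erasure $\overline A$ deletes all $!$ and reads $\multimap$ as $\to$. A *general EAL-type* is $\Theta::=\,!^{e}o\mid\,!^{e}(\Theta\multimap\Theta)$, where $e=n_1+\dots+n_k$ ($k\ge 0$) is a formal sum of variables ranging over $\mathbb N$; $!^{e}!^{e'}\Theta$ is identified with $!^{e+e'}\Theta$. For an assignment $X$ of natural numbers to variables, $X(\Theta)$ is the resulting EAL-type, and $X(B)$ is defined entrywise for a base $B$ (a multiset of pairs variable : general type). Terms are $\lambda$-terms $M$ with a simple type derivation $M:\sigma$, up to $\alpha$-equivalence; $FVO(M)$ is the list of free variable *occurrences* of $M$. **The algorithm.** All variables $p,n,b,c$ introduced below are fresh. Constraints are rows $\sum\pm n_i=0$ or $\sum n_i\ge 1$; rows keep their identity when they are modified. * $\mathcal P(\sigma)$ puts a new exponent $!^p$ in front of every subformula of $\sigma$. * $\mathcal U(\Theta_1,\dots,\Theta_h)$ (types of the same erasure) consists of the equations between corresponding exponents of consecutive types, the outermost exponents first. * $\mathcal C(\Theta)=\emptyset$;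 for $h\ge2$, $\mathcal C(\Theta_1,\dots,\Theta_h)$ is $\mathcal U(\Theta_1,\dots,\Theta_h)$ together with $e\ge1$, where $e$ is the outermost exponent of $\Theta_1$. * A *critical point* is a pair (row, list of variable occurrences) attached to an application subterm; a *slice* is a finite set of critical points; $cpts$ denotes a finite set of slices. $S\Cup T$ is the set of all slices in $S$, all slices in $T$, and all $s\cup t$ with $s\in S$, $t\in T$. * $\mathbb B(M,B,\Gamma,cpts,A)$ does nothing if $M$ is a variable. Otherwise, for every slice $sl\in cpts$ it takes a new variable $c$, replaces $\Gamma$ by $!^c\Gamma$, every $x_i:\Theta_i$ in $B$ whose occurrence $x_i$ is in no list of $sl$ by $x_i:\,!^c\Theta_i$, and subtracts $c$ from the left-hand side of every row in $sl$; finally it takes a new variable $b$ and puts $!^b$ in front of $\Gamma$ and of all types of $B$. The variable $c$ stands for a number of boxes drawn around the subterm $M$ with the application subterms of $sl$ left out; $b$ for boxes around the whole of $M$. * $\mathcal S(M:\sigma)=\langle\Theta,B,A,cpts\rangle$ is defined by recursion. * Variable: $\mathcal S(x:\sigma)=\langle\Theta,\{x:\Theta\},\emptyset,\emptyset\rangle$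 with $\Theta=\mathcal P(\sigma)$. * $\lambda x.M:\sigma\to\tau$: let $\mathcal S(M:\tau)=\langle\Gamma_1,B_1,A_1,cpts_1\rangle$ and $\mathbb B(M,B_1,\Gamma_1,cpts_1,A_1)=\langle B',\Gamma,A_2\rangle$. If $x$ is free in $M$, with types $\Theta_1,\dots,\Theta_h$ in $B'$, the result is $\langle\Theta_1\multimap\Gamma,\ B'\setminus x,\ A_2\cup\mathcal C(\Theta_1,\dots,\Theta_h),\ cpts\rangle$, where $cpts$ consists of the slices of $cpts_1$ with no occurrence of $x$ in any of their lists. If $x$ is not free and $M$ is an application, write $\Gamma=\,!^{e}\Gamma'$, with $e$ the whole outermost exponent, and let $r$ be the row $e-n=0$; the result is $\langle\mathcal P(\sigma)\multimap\,!^n\Gamma',\ B',\ A_2\cup\{r\},\ cpts_1\cup\{\{(r,FVO(M))\}\}\rangle$. Otherwise it is $\langle\mathcal P(\sigma)\multimap\Gamma,B',A_2,cpts_1\rangle$. * $(M\,N):\tau$: let $\mathcal S(M:\sigma\to\tau)=\langle\,!^{e}(\Theta_1\multimap\Gamma),B_1,A_1,cpts_1\rangle$, $\mathcal S(N:\sigma)=\langle\Theta_2,B_2,A_2,cpts_2\rangle$,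 $\mathbb B(N,B_2,\Theta_2,cpts_2,A_2)=\langle B_3,\Theta_3,A_3\rangle$. Let $r$ be the row $e=0$ and $A_4=\mathcal U(\Theta_3,\Theta_1)$, with first row $r'$ (outermost exponent of $\Theta_3$ minus that of $\Theta_1$ equals $0$). The result is $\langle\Gamma,\ B_1\cup B_3,\ A_1\cup A_3\cup A_4\cup\{r\},\ cpts_1'\Cup cpts_2'\rangle$, where $cpts_1'$ is $cpts_1$, plus the slice $\{(r,FVO(M))\}$ if $M$ is an application, and $cpts_2'$ is $cpts_2$, plus the slice $\{(r',FVO(N))\}$ if $N$ is an application. * Top level: let $\mathcal S(M:\sigma)=\langle\Theta_1,B_1,A',cpts\rangle$ and $\mathbb B(M,B_1,\Theta_1,cpts,A')=\langle B_2,\Theta,A''\rangle$. Then $\mathscr S(M:\sigma)=\langle\Theta,B,A\rangle$, where $B$ keeps for every variable the first of its types in $B_2$, and $A$ is $A''$ together with $\mathcal C$ of the list of types of each variable of $B_2$. **Derivations and boxes.** Elementary affine terms are $P::=x\mid\lambda x.P\mid(P\,P)\mid\,!(P)[{}^{P_1}/x_1,\dots,{}^{P_k}/x_k]\mid[P]_{Q=x,y}$.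 They are typed by natural deduction for EAL (NEAL): axiom with weakening; $\multimap$-introduction and elimination; from $\Delta_i\vdash P_i:\,!A_i$ ($i\le k$) and $x_1:A_1,\dots,x_k:A_k\vdash N:B$ infer $\Gamma,\Delta_1,\dots,\Delta_k\vdash\,!(N)[{}^{P_1}/x_1,\dots,{}^{P_k}/x_k]:\,!B$; from $\Gamma\vdash Q:\,!A$ and $\Delta,x:\,!A,y:\,!A\vdash N:B$ infer $\Gamma,\Delta\vdash[N]_{Q=x,y}:B$; the bases of different premises have disjoint domains. Terms are assumed *legal*: the parts of an application, of a substitution list, and of a contraction have disjoint free variables, and $FV(N)=\{x_1,\dots,x_k\}$ in a box. $P^*$ is the $\lambda$-term obtained by carrying out the substitutions of boxes and contractions. $P$ is a *candidate* if: no box has a box or a contraction in its substitution list, no application has a contraction as one of its parts, no contraction contracts a contraction or a box, and no $\lambda x.[N]_{Q=y,z}$ has $x\notin FV(Q)$; every contraction $[N]_{Q=x,y}$ has $Q^*$ a variable and $x,y\in FV(N)$; $P$ has as many abstractions and applications as $P^*$; and no box is of the form $!(x)[\dots]$. A *derivation with skeleton $M:\sigma$* is a derivation $\Delta\vdash_{NEAL}P:C$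 with $P$ a legal candidate, $P^*=M$, $\overline C=\sigma$, and $\Delta$ erasing to the simple types of the free variables of $M$. Each box $!(N)[\dots]$ in $P$ encloses a set of abstraction and application nodes of the syntax tree of $M=P^*$, namely those coming from $N^*$. A box variable of the algorithm likewise determines the set of nodes that its boxes enclose; boxes are identified with these sets of nodes. Two boxes are *compatible* if some derivation with skeleton $M:\sigma$ contains both. A solution $X$ *instantiates* a box if the corresponding variable $b$ or $c$, introduced by the algorithm on $M:\sigma$, satisfies $X(b)\ge1$, resp. $X(c)\ge1$. **Lemma (Superimposing of derivations).** Let $M:\sigma$ be a simply typed term, $\mathscr S(M:\sigma)=\langle\Theta,B,A\rangle$, and let $X_1$ be a solution of $A$ in natural numbers that instantiates two boxes which are not compatible. Then there is another solution $X_2\ne X_1$ of $A$ such that all the boxes instantiated by $X_2$ belong to one derivation: there is a derivation $X_2(B)\vdash_{NEAL}P:X_2(\Theta)$ with skeleton $M:\sigma$ whose boxes are exactly the boxes instantiated by $X_2$, each occurring as many times as the value of its variable under $X_2$. Moreover $X_1(\Theta)=X_2(\Theta)$ and $X_1(B)=X_2(B)$. -/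

import Mathlib

namespace EAL

/-! ### Simple types, simply typed terms, addresses -/

/-- Simple types over the base type `o`. -/
inductive Ty : Type
  | o : Ty
  | arrow : Ty → Ty → Ty
  deriving DecidableEq

/-- Directions in a syntax tree: function part, argument part, body of an abstraction. -/
inductive Dir : Type
  | fn | arg | body
  deriving DecidableEq

/-- The address of a node of a syntax tree, read from the root. -/
abbrev Path := List Dir

/-- Extension of a typing context by a new variable, which gets index `0`. -/
abbrev extend {α : Type} {n : ℕ} (a : α) (Γ : Fin n → α) : Fin (n + 1) → α :=
  Fin.cons (α := fun _ => α) a Γ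

/-- Simple type derivations `Γ ⊢ M : σ` (natural deduction), for λ-terms with de Bruijn indices
and free variables `Fin n`. -/
inductive Tm : {n : ℕ} → (Fin n → Ty) → Ty → Type
  | var {n : ℕ} {Γ : Fin n → Ty} (i : Fin n) : Tm Γ (Γ i)
  | lam {n : ℕ} {Γ : Fin n → Ty} {σ τ : Ty} (M : Tm (extend σ Γ) τ) : Tm Γ (.arrow σ τ)
  | app {n : ℕ} {Γ : Fin n → Ty} {σ τ : Ty} (M : Tm Γ (.arrow σ τ)) (N : Tm Γ σ) : Tm Γ τ

/-- Type-free λ-terms with free variables `Fin n`. -/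
inductive Lam : ℕ → Type
  | var {n : ℕ} (i : Fin n) : Lam n
  | lam {n : ℕ} (M : Lam (n + 1)) : Lam n
  | app {n : ℕ} (M N : Lam n) : Lam n

namespace Lam

def rename : {n m : ℕ} → (Fin n → Fin m) → Lam n → Lam m
  | _, _, f, var i => var (f i)
  | _, _, f, lam M => lam (M.rename (extend 0 fun i => (f i).succ))
  | _, _, f, app M N => app (M.rename f) (N.rename f)

/-- Simultaneous capture-avoiding substitution. -/
def subst : {n m : ℕ} → (Fin n → Lam m) → Lam n → Lam m
  | _, _, s, var i => s i
  | _, _, s, lam M => lam (M.subst (extend (var 0) fun i => (s i).rename Fin.succ))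
  | _, _, s, app M N => app (M.subst s) (N.subst s)

/-- Addresses of the internal nodes (abstractions and applications). -/
def nodes : {n : ℕ} → Lam n → Finset Path
  | _, var _ => ∅
  | _, lam M => insert [] (M.nodes.image (Dir.body :: ·))
  | _, app M N => insert [] (M.nodes.image (Dir.fn :: ·) ∪ N.nodes.image (Dir.arg :: ·))

/-- Addresses of the free occurrences of the variable `i`. -/
def occs : {n : ℕ} → Lam n → Fin n → List Path
  | _, var j, i => if j = i then [[]] else []
  | _, lam M, i => (M.occs i.succ).map (Dir.body :: ·)
  | _, app M N, i => (M.occs i).map (Dir.fn :: ·) ++ (N.occs i).map (Dir.arg :: ·)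

/-- The number of abstractions and applications. -/
def length : {n : ℕ} → Lam n → ℕ
  | _, var _ => 0
  | _, lam M => 1 + M.length
  | _, app M N => 1 + M.length + N.length

def IsVar {n : ℕ} (M : Lam n) : Prop := ∃ i, M = var i

end Lam

namespace Tm

/-- The underlying type-free term. -/
def toLam : {n : ℕ} → {Γ : Fin n → Ty} → {σ : Ty} → Tm Γ σ → Lam n
  | _, _, _, var i => .var i
  | _, _, _, lam M => .lam M.toLam
  | _, _, _, app M N => .app M.toLam N.toLam

def isVar {n : ℕ} {Γ : Fin n → Ty} {σ : Ty} : Tm Γ σ → Bool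
  | var _ => true
  | _ => false

def isApp {n : ℕ} {Γ : Fin n → Ty} {σ : Ty} : Tm Γ σ → Bool
  | app _ _ => true
  | _ => false

/-- The list `FVO(M)` of free variable occurrences of the term `M` rooted at address `π`;
an occurrence is recorded as the variable together with the address of the occurrence. -/
def fvo : {n : ℕ} → {Γ : Fin n → Ty} → {σ : Ty} → Tm Γ σ → Path → List (Fin n × Path)
  | _, _, _, var i, π => [(i, π)]
  | _, _, _, lam M, π => (M.fvo (π ++ [.body])).filterMap fun q =>
      Fin.cases (motive := fun _ => Option (Fin _ × Path)) none (fun i => some (i, q.2)) q.1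
  | _, _, _, app M N, π => M.fvo (π ++ [.fn]) ++ N.fvo (π ++ [.arg])

end Tm

/-! ### Variables, general EAL-types, constraints -/

/-- A box drawn on a syntax tree: it encloses the subterm at address `root`, except the subterms
at the addresses `holes`. -/
structure Box : Type where
  root : Path
  holes : List Path
  deriving DecidableEq

/-- The integer variables used by the algorithm. Fresh variables are named after the place in the
syntax tree where they are introduced:
* `typ π q`: the variable `p` introduced by type processing at the node `π`, at position `q` of
  the type (`false`: left of the arrow, `true`: right of the arrow);
* `res π`: the variable `n` introduced by the second abstraction case at the node `π`;
* `box β`: a variable `b` (no holes) or `c` (with holes) counting boxes of the shape `β`. -/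
inductive Var : Type
  | typ (π : Path) (q : List Bool) : Var
  | res (π : Path) : Var
  | box (β : Box) : Var
  deriving DecidableEq

/-- The formal sum `n₁ + ⋯ + n_k` of variables. -/
abbrev Expo := List Var

/-- The value of a formal sum under an assignment. -/
def Expo.val (X : Var → ℕ) (e : Expo) : ℕ := (e.map X).sum

/-- General EAL-types `!^{n₁+⋯+n_k} o` and `!^{n₁+⋯+n_k} (Θ ⊸ Γ)`, indexed by their erasure. -/
inductive GTy : Ty → Type
  | base (e : Expo) : GTy .o
  | arrow {σ τ : Ty} (e : Expo) (Θ : GTy σ) (Δ : GTy τ) : GTy (.arrow σ τ)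

namespace GTy

/-- The outermost exponent. -/
def expo : {σ : Ty} → GTy σ → Expo
  | _, base e => e
  | _, arrow e _ _ => e

/-- Replacement of the outermost exponent. -/
def withExpo : {σ : Ty} → Expo → GTy σ → GTy σ
  | _, e, base _ => base e
  | _, e, arrow _ Θ Δ => arrow e Θ Δ

/-- `!^v Θ`, with `!^n !^m Θ` identified with `!^{n+m} Θ`. -/
def bang {σ : Ty} (v : Var) (Θ : GTy σ) : GTy σ := Θ.withExpo (v :: Θ.expo)

def dom : {σ τ : Ty} → GTy (.arrow σ τ) → GTy σ
  | _, _, arrow _ Θ _ => Θ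

def cod : {σ τ : Ty} → GTy (.arrow σ τ) → GTy τ
  | _, _, arrow _ _ Δ => Δ

end GTy

/-- Linear constraints: `Σ pos - Σ neg = 0` or `Σ e ≥ 1`. A row of the first kind that belongs
to a critical point is labelled by the address of that point; the label is the identity of the row
while the row is being modified. -/
inductive Constraint : Type
  | eqZero (label : Option Path) (pos neg : Expo) : Constraint
  | geOne (e : Expo) : Constraint

namespace Constraint

def Holds (X : Var → ℕ) : Constraint → Prop
  | eqZero _ pos neg => (pos.val X : ℤ) - neg.val X = 0
  | geOne e => 1 ≤ e.val X

end Constraint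

/-- `X` is a solution of the set of constraints `A`. -/
def IsSolution (X : Var → ℕ) (A : List Constraint) : Prop := ∀ a ∈ A, a.Holds X

/-- A critical point: (the address that labels) its constraint, and the list of the free variable
occurrences of the application at that address. -/
structure CPoint : Type where
  row : Path
  occ : List Path

/-- A slice: a combination of critical points. -/
abbrev Slice := List CPoint

namespace Slice

/-- The variable occurrence at address `a` belongs to some list of the slice. -/
def hasOcc (sl : Slice) (a : Path) : Bool := sl.any fun c => c.occ.contains a

/-- The row with the given label belongs to the slice. -/
def hasRow (sl : Slice) (l : Option Path) : Bool := sl.any fun c => l == some c.row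

def addrs (sl : Slice) : List Path := sl.map CPoint.row

end Slice

/-- A base, i.e. a multiset of pairs (variable, general EAL-type), one pair for each
variable occurrence (recorded by its address), grouped by variables. -/
abbrev Base {n : ℕ} (Γ : Fin n → Ty) := (i : Fin n) → List (Path × GTy (Γ i))

/-! ### The algorithm -/

/-- Type processing `P(σ)`. -/
def process (π : Path) : (σ : Ty) → List Bool → GTy σ
  | .o, q => .base [.typ π q]
  | .arrow σ τ, q => .arrow [.typ π q] (process π σ (q ++ [false])) (process π τ (q ++ [true]))

/-- The rows `e₁ - e₂ = 0, …, e_{h-1} - e_h = 0`. -/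
def chain : List Expo → List Constraint
  | e₁ :: e₂ :: es => .eqZero none e₁ e₂ :: chain (e₂ :: es)
  | _ => []

/-- Unification `U(Θ₁, …, Θ_h)`. -/
def unify : (σ : Ty) → List (GTy σ) → List Constraint
  | .o, Θs => chain (Θs.map GTy.expo)
  | .arrow σ τ, Θs =>
      chain (Θs.map GTy.expo) ++ unify σ (Θs.map GTy.dom) ++ unify τ (Θs.map GTy.cod)

/-- Labels the first row of a set of constraints. -/
def labelFirst (π : Path) : List Constraint → List Constraint
  | .eqZero _ pos neg :: A => .eqZero (some π) pos neg :: A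
  | A => A

/-- Contraction `C(Θ₁, …, Θ_h)`. -/
def contract {σ : Ty} : List (GTy σ) → List Constraint
  | Θ₁ :: Θ₂ :: Θs => .geOne Θ₁.expo :: unify σ (Θ₁ :: Θ₂ :: Θs)
  | _ => []

/-- Product union of two sets of slices. -/
def prodUnion : List Slice → List Slice → List Slice
  | [], cpts => cpts
  | sl :: sls, [] => sl :: sls
  | sl :: sls, cpts => (sl :: cpts.map (sl ++ ·)) ++ prodUnion sls cpts

/-- A triple ⟨base, type, constraints⟩, with a record of the boxes introduced so far. -/
structure Triple {n : ℕ} (Γ : Fin n → Ty) (σ : Ty) : Type where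
  base : Base Γ
  ty : GTy σ
  cons : List Constraint
  boxes : List Box

/-- `A^j - c` for the rows `A^j` of the slice. -/
def Constraint.sub (sl : Slice) (c : Var) : Constraint → Constraint
  | .eqZero l pos neg => if sl.hasRow l then .eqZero l pos (c :: neg) else .eqZero l pos neg
  | .geOne e => .geOne e

/-- Boxing along the slices, for a subterm at address `π`. -/
def boxSlices {n : ℕ} {Γ : Fin n → Ty} {σ : Ty} (π : Path) :
    List Slice → Triple Γ σ → Triple Γ σ
  | [], t => t
  | sl :: cpts, t =>
      let β : Box := ⟨π, sl.addrs⟩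
      boxSlices π cpts
        { base := fun i => (t.base i).map fun q =>
            if sl.hasOcc q.1 then q else (q.1, q.2.bang (.box β))
          ty := t.ty.bang (.box β)
          cons := t.cons.map (Constraint.sub sl (.box β))
          boxes := t.boxes ++ [β] }

/-- The boxing of the subterm `M` at address `π`: nothing for a variable; otherwise boxes along
all slices, and then boxes around the whole subterm. -/
def boxing {n : ℕ} {Γ : Fin n → Ty} {σ : Ty} (M : Tm Γ σ) (π : Path) (cpts : List Slice)
    (t : Triple Γ σ) : Triple Γ σ :=
  if M.isVar then t else
    let t₁ := boxSlices π cpts t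
    let β : Box := ⟨π, []⟩
    { base := fun i => (t₁.base i).map fun q => (q.1, q.2.bang (.box β))
      ty := t₁.ty.bang (.box β)
      cons := t₁.cons
      boxes := t₁.boxes ++ [β] }

/-- The critical point at the root of the application `M` at address `π`, as a one-point slice;
no slice if `M` is not an application. -/
def newSlice {n : ℕ} {Γ : Fin n → Ty} {σ : Ty} (M : Tm Γ σ) (π : Path) : List Slice :=
  if M.isApp then [[⟨π, (M.fvo π).map Prod.snd⟩]] else []

/-- The main function of the algorithm on the subterm `M` at address `π`; it returns
⟨type, base, constraints, critical points⟩.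

The base lists the occurrences of the abstracted variable, so that the first abstraction case
(the variable is free in the body) is the case of a non-empty list. -/
def synth : {n : ℕ} → {Γ : Fin n → Ty} → {σ : Ty} → Tm Γ σ → Path → Triple Γ σ × List Slice
  | _, Γ, _, .var i, π =>
      ({ base := fun j => if j = i then [(π, process π (Γ j) [])] else []
         ty := process π (Γ i) []
         cons := []
         boxes := [] }, [])
  | _, Γ, _, .lam (σ := σ) (τ := τ) M, π =>
      let r := synth M (π ++ [.body])
      let t := boxing M (π ++ [.body]) r.2 r.1
      let xs : List (Path × GTy σ) := t.base 0
      let B : Base Γ := fun i => t.base i.succ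
      match xs with
      | (a, Θ₁) :: rest =>
          ({ base := B
             ty := .arrow [] Θ₁ t.ty
             cons := t.cons ++ contract (Θ₁ :: rest.map Prod.snd)
             boxes := t.boxes },
           r.2.filter fun sl => !(((a, Θ₁) :: rest).any fun q => sl.hasOcc q.1))
      | [] =>
          if M.isApp then
            ({ base := B
               ty := .arrow [] (process π σ []) (t.ty.withExpo [.res π])
               cons := t.cons ++ [.eqZero (some (π ++ [.body])) t.ty.expo [.res π]]
               boxes := t.boxes },
             r.2 ++ newSlice M (π ++ [.body]))
          else
            ({ base := B
               ty := .arrow [] (process π σ []) t.ty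
               cons := t.cons
               boxes := t.boxes }, r.2)
  | _, _, _, .app (σ := σ) M N, π =>
      let r₁ := synth M (π ++ [.fn])
      let r₂ := synth N (π ++ [.arg])
      let t₃ := boxing N (π ++ [.arg]) r₂.2 r₂.1
      let A₄ := if N.isApp then labelFirst (π ++ [.arg]) (unify σ [t₃.ty, r₁.1.ty.dom])
        else unify σ [r₁.1.ty.dom, t₃.ty]
      ({ base := fun i => r₁.1.base i ++ t₃.base i
         ty := r₁.1.ty.cod
         cons := r₁.1.cons ++ t₃.cons ++ A₄ ++
           [.eqZero (if M.isApp then some (π ++ [.fn]) else none) r₁.1.ty.expo []]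
         boxes := r₁.1.boxes ++ t₃.boxes },
       prodUnion (r₁.2 ++ newSlice M (π ++ [.fn])) (r₂.2 ++ newSlice N (π ++ [.arg])))

/-- The output ⟨Θ, B, A⟩ of the type synthesis algorithm, with a record of the boxes whose
variables were introduced during the run. -/
structure Output {n : ℕ} (Γ : Fin n → Ty) (σ : Ty) : Type where
  Θ : GTy σ
  B : (i : Fin n) → Option (GTy (Γ i))
  A : List Constraint
  boxes : List Box

/-- The type synthesis algorithm: the top level call. -/
def typeSynthesis {n : ℕ} {Γ : Fin n → Ty} {σ : Ty} (M : Tm Γ σ) : Output Γ σ :=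
  let r := synth M []
  let t := boxing M [] r.2 r.1
  { Θ := t.ty
    B := fun i => ((t.base i).map Prod.snd).head?
    A := t.cons ++ (List.finRange n).flatMap fun i => contract ((t.base i).map Prod.snd)
    boxes := t.boxes }

/-! ### EAL-types and instantiation -/

/-- Formulas of implicational elementary affine logic. -/
inductive ETy : Type
  | o : ETy
  | lolli : ETy → ETy → ETy
  | bang : ETy → ETy

/-- The erasure of an EAL-type. -/
def ETy.erase : ETy → Ty
  | o => .o
  | lolli A B => .arrow A.erase B.erase
  | bang A => A.erase

/-- The instantiation `X(Θ)`. -/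
def GTy.inst (X : Var → ℕ) : {σ : Ty} → GTy σ → ETy
  | _, base e => ETy.bang^[e.val X] .o
  | _, arrow e Θ Δ => ETy.bang^[e.val X] (.lolli (Θ.inst X) (Δ.inst X))

/-- The instantiation `X(B)`; variables that do not occur in the base get no type. -/
def Output.instB {n : ℕ} {Γ : Fin n → Ty} {σ : Ty} (S : Output Γ σ) (X : Var → ℕ) :
    Fin n → Option ETy :=
  fun i => (S.B i).map (GTy.inst X)

/-! ### Elementary affine terms and natural deduction for EAL -/

/-- Elementary affine terms with free variables `Fin n`. `prom N Ms` is the box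
`!(N)[M₁/x₁,…,M_k/x_k]`, where `x₁,…,x_k` are the variables of `N`; `contr M N` is the contraction
`[N]_{M=x,y}`, where `x`, `y` are the variables `0`, `1` of `N`. -/
inductive EA : ℕ → Type
  | var {n : ℕ} (i : Fin n) : EA n
  | lam {n : ℕ} (M : EA (n + 1)) : EA n
  | app {n : ℕ} (M N : EA n) : EA n
  | prom {n k : ℕ} (N : EA k) (Ms : Fin k → EA n) : EA n
  | contr {n : ℕ} (M : EA n) (N : EA (n + 2)) : EA n

namespace EA

/-- `i ∈ FV(P)`. -/
def Free : {n : ℕ} → EA n → Fin n → Prop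
  | _, var j, i => j = i
  | _, lam M, i => M.Free i.succ
  | _, app M N, i => M.Free i ∨ N.Free i
  | _, prom _ Ms, i => ∃ j, (Ms j).Free i
  | _, contr M N, i => M.Free i ∨ N.Free i.succ.succ

/-- Legal terms. -/
def Legal : {n : ℕ} → EA n → Prop
  | _, var _ => True
  | _, lam M => M.Legal
  | _, app M N => M.Legal ∧ N.Legal ∧ ∀ i, ¬ (M.Free i ∧ N.Free i)
  | _, prom N Ms => N.Legal ∧ (∀ j, (Ms j).Legal) ∧ (∀ j, N.Free j) ∧
      ∀ j j', j ≠ j' → ∀ i, ¬ ((Ms j).Free i ∧ (Ms j').Free i)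
  | _, contr M N => M.Legal ∧ N.Legal ∧ ∀ i, ¬ (M.Free i ∧ N.Free i.succ.succ)

/-- The λ-term `P*`. -/
def erase : {n : ℕ} → EA n → Lam n
  | _, var i => .var i
  | _, lam M => .lam M.erase
  | _, app M N => .app M.erase N.erase
  | _, prom N Ms => N.erase.subst fun j => (Ms j).erase
  | _, contr M N => N.erase.subst (extend M.erase (extend M.erase Lam.var))

/-- The length `L(P)`. -/
def length : {n : ℕ} → EA n → ℕ
  | _, var _ => 0
  | _, lam M => 1 + M.length
  | _, app M N => 1 + M.length + N.length
  | _, prom N Ms => N.length + ∑ j, (Ms j).length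
  | _, contr M N => N.length + M.length

def IsVar {n : ℕ} (P : EA n) : Prop := ∃ i, P = var i

def IsProm : {n : ℕ} → EA n → Prop
  | _, prom _ _ => True
  | _, _ => False

def IsContr : {n : ℕ} → EA n → Prop
  | _, contr _ _ => True
  | _, _ => False

/-- The root of the term is a redex of one of the reductions `!-!`, `@-c`, `!-c`, `c-c`, `λ-c`,
`dup`. -/
def RootRedex : {n : ℕ} → EA n → Prop
  | _, var _ => False
  | _, lam (contr M _) => ¬ M.Free 0
  | _, lam _ => False
  | _, app M N => M.IsContr ∨ N.IsContr
  | _, prom _ Ms => ∃ j, (Ms j).IsProm ∨ (Ms j).IsContr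
  | _, contr M _ => M.IsContr ∨ M.IsProm

/-- The conditions on candidate terms that concern the root of a subterm: it is not a redex; a
contraction contracts a variable into two variables that occur; the body of a box is not a
variable. -/
def RootOk : {n : ℕ} → EA n → Prop
  | _, contr M N => ¬ (contr M N).RootRedex ∧ M.erase.IsVar ∧ N.Free 0 ∧ N.Free 1
  | _, prom N Ms => ¬ (prom N Ms).RootRedex ∧ ¬ N.IsVar
  | _, P => ¬ P.RootRedex

/-- Every subterm satisfies `RootOk`. -/
def SubtermsOk : {n : ℕ} → EA n → Prop
  | _, var i => (var i).RootOk
  | _, lam M => (lam M).RootOk ∧ M.SubtermsOk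
  | _, app M N => (app M N).RootOk ∧ M.SubtermsOk ∧ N.SubtermsOk
  | _, prom N Ms => (prom N Ms).RootOk ∧ N.SubtermsOk ∧ ∀ j, (Ms j).SubtermsOk
  | _, contr M N => (contr M N).RootOk ∧ M.SubtermsOk ∧ N.SubtermsOk

/-- Candidate terms. -/
def Candidate {n : ℕ} (P : EA n) : Prop := P.SubtermsOk ∧ P.length = P.erase.length

/-- The boxes of `P`, drawn on the syntax tree of `P*`: every box is given by the set of the
internal nodes that it encloses, and boxes are counted with multiplicity. The box `!(N)[M₁/x₁,…]`
encloses the nodes of `N*`, but not those of the terms substituted for its variables. -/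
def boxes : {n : ℕ} → EA n → Multiset (Finset Path)
  | _, var _ => 0
  | _, lam M => M.boxes.map fun R => R.image (Dir.body :: ·)
  | _, app M N => (M.boxes.map fun R => R.image (Dir.fn :: ·)) +
      N.boxes.map fun R => R.image (Dir.arg :: ·)
  | _, prom N Ms => N.erase.nodes ::ₘ N.boxes +
      ∑ j, ((N.erase.occs j).map fun a => (Ms j).boxes.map fun R => R.image (a ++ ·)).sum
  | _, contr M N => N.boxes +
      ((N.erase.occs 0 ++ N.erase.occs 1).map fun a =>
        M.boxes.map fun R => R.image (a ++ ·)).sum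

end EA

/-- Natural deduction for EAL with term assignment. A basis assigns types to some of the variables.
The premises of a rule share the basis of the conclusion: as only legal terms are considered, the
parts of it that they really use are disjoint. -/
inductive NEAL : {n : ℕ} → (Fin n → Option ETy) → EA n → ETy → Prop
  | ax {n : ℕ} {Δ : Fin n → Option ETy} {i : Fin n} {A : ETy} :
      Δ i = some A → NEAL Δ (.var i) A
  | lolliI {n : ℕ} {Δ : Fin n → Option ETy} {M : EA (n + 1)} {A B : ETy} :
      NEAL (extend (some A) Δ) M B → NEAL Δ (.lam M) (.lolli A B)
  | lolliE {n : ℕ} {Δ : Fin n → Option ETy} {M N : EA n} {A B : ETy} :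
      NEAL Δ M (.lolli A B) → NEAL Δ N A → NEAL Δ (.app M N) B
  | prom {n k : ℕ} {Δ : Fin n → Option ETy} {N : EA k} {Ms : Fin k → EA n} {A : Fin k → ETy}
      {B : ETy} : (∀ j, NEAL Δ (Ms j) (.bang (A j))) → NEAL (fun j => some (A j)) N B →
      NEAL Δ (.prom N Ms) (.bang B)
  | contr {n : ℕ} {Δ : Fin n → Option ETy} {M : EA n} {N : EA (n + 2)} {A B : ETy} :
      NEAL Δ M (.bang A) → NEAL (extend (some (.bang A)) (extend (some (.bang A)) Δ)) N B →
      NEAL Δ (.contr M N) B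

/-! ### Boxes and derivations -/

/-- `P` is (the term of) an EAL-derivation of `Δ ⊢ M : A` whose skeleton is the simply typed term
`M`. -/
structure IsDerivation {n : ℕ} {Γ : Fin n → Ty} {σ : Ty} (M : Tm Γ σ)
    (Δ : Fin n → Option ETy) (P : EA n) (A : ETy) : Prop where
  legal : P.Legal
  candidate : P.Candidate
  erase_eq : P.erase = M.toLam
  typed : NEAL Δ P A
  erase_type : A.erase = σ
  erase_basis : ∀ i C, Δ i = some C → C.erase = Γ i

/-- The set of internal nodes of `M` that are enclosed by the box `β`. -/
def Box.region {n : ℕ} (M : Lam n) (β : Box) : Finset Path :=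
  M.nodes.filter fun a => β.root <+: a ∧ ∀ h ∈ β.holes, ¬ h <+: a

/-- Two boxes are compatible if they occur together in some derivation with skeleton `M`. -/
def Compatible {n : ℕ} {Γ : Fin n → Ty} {σ : Ty} (M : Tm Γ σ) (β₁ β₂ : Box) : Prop :=
  ∃ Δ P A, IsDerivation M Δ P A ∧ β₁.region M.toLam ∈ P.boxes ∧ β₂.region M.toLam ∈ P.boxes

/-- `X` instantiates the box `β`: the box is one of those introduced by the algorithm on `M`, and
its variable has a positive value. -/
def Instantiates {n : ℕ} {Γ : Fin n → Ty} {σ : Ty} (M : Tm Γ σ) (X : Var → ℕ) (β : Box) : Prop :=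
  β ∈ (typeSynthesis M).boxes ∧ 1 ≤ X (.box β)

/-- All boxes instantiated by `X`, drawn on the syntax tree of `M`, with multiplicity. -/
def instantiatedBoxes {n : ℕ} {Γ : Fin n → Ty} {σ : Ty} (M : Tm Γ σ) (X : Var → ℕ) :
    Multiset (Finset Path) :=
  ((typeSynthesis M).boxes.map fun β =>
    Multiset.replicate (X (.box β)) (β.region M.toLam)).sum

end EAL

/-! A solution of the constraints records only how many boxes are drawn along each slice. Two boxes
drawn along different slices may overlap without being nested, and then no derivation contains both.
Rows and instantiated types, however, see nothing but numbers: how many boxes are closed and how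
many are opened at each node, and how many are open at each variable occurrence. The idea is to
forget the individual boxes of the given solution, to keep only the number of open boxes (the depth)
at every node, and to redraw the boxes as a stack. A box of level `l` is opened where the depth
rises past `l` and ends at the topmost nodes below whose depth is smaller than `l`; where some boxes
are closed and others opened at the same node, as many as possible simply stay open. The redrawn
boxes are nested by construction.

Depths and types of the nodes are collected in a decoration `Path → Mark`, and `WF` states what
makes a decoration legitimate. Four facts carry the proof. The decoration read off a solution is
well formed (`wf_decoration`); this rests on `Coherent`, the bookkeeping of open boxes along the
slices of the algorithm. Every well-formed decoration comes from a derivation whose boxes are the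
stacked ones (`realizable`, `exists_derivation`): the term is built level by level, from the
innermost boxes outwards. The stacked boxes run along slices that the algorithm really produces
(`mem_levelSlice`), so that counting them gives a new assignment with the same depths
(`opened_perm`, `follows_counts`) and with these boxes (`drawn_synth`). Finally, two assignments
with equal depths that agree on the variables of type processing and on the variables `n` of vacuous
abstractions give the same types and satisfy the same rows (`transfer`).

This superimposed assignment is defined for every solution (`exists_superimposed`). If it coincided
with a solution that instantiates two incompatible boxes, both would occur in one derivation; hence
it is different. -/

namespace EAL

/-! ### Renaming and substitution -/

namespace Lam

theorem rename_rename {n m k : ℕ} (f : Fin n → Fin m) (g : Fin m → Fin k) (M : Lam n) :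
    (M.rename f).rename g = M.rename (g ∘ f) := by
  induction M generalizing m k with
  | var i => rfl
  | lam M ih =>
    simp only [rename, ih]
    congr 2
    funext i
    refine Fin.cases ?_ (fun i => ?_) i <;> simp [extend]
  | app M N ihM ihN => simp only [rename, ihM, ihN]

theorem subst_rename {n m k : ℕ} (f : Fin n → Fin m) (s : Fin m → Lam k) (M : Lam n) :
    (M.rename f).subst s = M.subst (s ∘ f) := by
  induction M generalizing m k with
  | var i => rfl
  | lam M ih =>
    simp only [rename, subst, ih]
    congr 2
    funext i
    refine Fin.cases ?_ (fun i => ?_) i <;> simp [extend]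
  | app M N ihM ihN => simp only [rename, subst, ihM, ihN]

theorem rename_subst {n m k : ℕ} (s : Fin n → Lam m) (f : Fin m → Fin k) (M : Lam n) :
    (M.subst s).rename f = M.subst fun i => (s i).rename f := by
  induction M generalizing m k with
  | var i => rfl
  | lam M ih =>
    simp only [rename, subst, ih]
    congr 2
    funext i
    refine Fin.cases ?_ (fun i => ?_) i
    · simp [extend, rename]
    · simp only [extend, Fin.cons_succ, rename_rename]
      congr 1
  | app M N ihM ihN => simp only [rename, subst, ihM, ihN]

theorem occs_rename {n m : ℕ} (f : Fin n → Fin m) (hf : Function.Injective f) (M : Lam n)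
    (i : Fin n) : (M.rename f).occs (f i) = M.occs i := by
  induction M generalizing m with
  | var j => simp [rename, occs, hf.eq_iff]
  | lam M ih =>
    simp only [rename, occs]
    have hinj : Function.Injective (extend (0 : Fin (m + 1)) fun i => (f i).succ) := by
      intro a b
      refine Fin.cases ?_ (fun a => ?_) a <;> refine Fin.cases ?_ (fun b => ?_) b <;>
        simp [extend, hf.eq_iff, Fin.succ_ne_zero, (Fin.succ_ne_zero _).symm]
    have := ih _ hinj i.succ
    simp only [extend, Fin.cons_succ] at this
    rw [this]
  | app M N ihM ihN => simp only [rename, occs, ihM f hf, ihN f hf]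

theorem length_rename {n m : ℕ} (f : Fin n → Fin m) (M : Lam n) :
    (M.rename f).length = M.length := by
  induction M generalizing m with
  | var j => rfl
  | lam M ih => simp [rename, length, ih]
  | app M N ihM ihN => simp only [rename, length, ihM f, ihN f]

def IsApp : {n : ℕ} → Lam n → Prop
  | _, app _ _ => True
  | _, _ => False

/-- The subterm at a given address (the term itself if there is none). -/
def sub : {n : ℕ} → Lam n → Path → (k : ℕ) × Lam k
  | n, M, [] => ⟨n, M⟩
  | n, M, δ :: p => match δ, M with
    | .body, lam M => M.sub p
    | .fn, app M _ => M.sub p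
    | .arg, app _ N => N.sub p
    | _, M => ⟨n, M⟩
termination_by structural _ _ p => p

@[simp] theorem sub_body {n : ℕ} (M : Lam (n + 1)) (p : Path) :
    (lam M).sub (.body :: p) = M.sub p := rfl
@[simp] theorem sub_fn {n : ℕ} (M N : Lam n) (p : Path) :
    (app M N).sub (.fn :: p) = M.sub p := rfl
@[simp] theorem sub_arg {n : ℕ} (M N : Lam n) (p : Path) :
    (app M N).sub (.arg :: p) = N.sub p := rfl

/-- An occurrence of a variable is a leaf of the syntax tree. -/
theorem sub_of_mem_occs {n : ℕ} (M : Lam n) {i : Fin n} {a : Path} (h : a ∈ M.occs i) :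
    (M.sub a).2.IsVar := by
  induction M generalizing a with
  | var j =>
    simp only [occs] at h
    split at h
    · simp only [List.mem_singleton] at h
      subst h; exact ⟨j, rfl⟩
    · simp at h
  | lam M ih =>
    simp only [occs, List.mem_map] at h
    obtain ⟨p, hp, rfl⟩ := h
    exact ih hp
  | app M N ihM ihN =>
    simp only [occs, List.mem_append, List.mem_map] at h
    rcases h with ⟨p, hp, rfl⟩ | ⟨p, hp, rfl⟩
    exacts [ihM hp, ihN hp]

/-- Different variables have different occurrences. -/
theorem occs_unique {n : ℕ} (M : Lam n) {i j : Fin n} {a : Path} (hi : a ∈ M.occs i)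
    (hj : a ∈ M.occs j) : i = j := by
  induction M generalizing a with
  | var l =>
    simp only [occs] at hi hj
    split at hi <;> split at hj <;> simp_all
  | lam M ih =>
    simp only [occs, List.mem_map] at hi hj
    obtain ⟨p, hp, rfl⟩ := hi
    obtain ⟨q, hq, h⟩ := hj
    cases h
    exact Fin.succ_injective _ (ih hp hq)
  | app M N ihM ihN =>
    simp only [occs, List.mem_append, List.mem_map] at hi hj
    rcases hi with ⟨p, hp, rfl⟩ | ⟨p, hp, rfl⟩ <;> rcases hj with ⟨q, hq, h⟩ | ⟨q, hq, h⟩ <;>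
      cases h
    exacts [ihM hp hq, ihN hp hq]

/-- Occurrences of variables are pairwise incomparable addresses. -/
theorem occs_prefix {n : ℕ} (M : Lam n) {i j : Fin n} {a b : Path} (hi : a ∈ M.occs i)
    (hj : b ∈ M.occs j) (h : a <+: b) : a = b := by
  induction M generalizing a b with
  | var l =>
    simp only [occs] at hi hj
    split at hi <;> split at hj <;> simp_all
  | lam M ih =>
    simp only [occs, List.mem_map] at hi hj
    obtain ⟨p, hp, rfl⟩ := hi
    obtain ⟨q, hq, rfl⟩ := hj
    rw [ih hp hq (by simpa [List.cons_prefix_cons] using h)]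
  | app M N ihM ihN =>
    simp only [occs, List.mem_append, List.mem_map] at hi hj
    rcases hi with ⟨p, hp, rfl⟩ | ⟨p, hp, rfl⟩ <;> rcases hj with ⟨q, hq, rfl⟩ | ⟨q, hq, rfl⟩ <;>
      simp [List.cons_prefix_cons] at h
    · rw [ihM hp hq h]
    · rw [ihN hp hq h]

end Lam

/-! ### Iterated modalities -/

namespace ETy

theorem bang_iterate_injective (m : ℕ) : Function.Injective (ETy.bang^[m]) :=
  Function.Injective.iterate (fun _ _ h => by injection h) m

theorem bang_iterate_add (m n : ℕ) (A : ETy) :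
    ETy.bang^[m + n] A = ETy.bang^[m] (ETy.bang^[n] A) := Function.iterate_add_apply _ _ _ _

/-- Neither an arrow nor the base type is of the form `!A`, so the number of modalities in front can
be read off. All passages between equations of exponents and equations of types rely on this. -/
theorem bang_iterate_lolli {m n : ℕ} {A B C D : ETy}
    (h : ETy.bang^[m] (.lolli A B) = ETy.bang^[n] (.lolli C D)) : m = n ∧ A = C ∧ B = D := by
  induction m generalizing n with
  | zero =>
    cases n with
    | zero => simpa using h
    | succ n => rw [Function.iterate_succ_apply'] at h; cases h
  | succ m ih =>
    cases n with
    | zero => rw [Function.iterate_succ_apply'] at h; cases h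
    | succ n =>
      rw [Function.iterate_succ_apply', Function.iterate_succ_apply'] at h
      injection h with h
      have := ih h
      exact ⟨by omega, this.2⟩

theorem bang_iterate_o {m n : ℕ} (h : ETy.bang^[m] .o = ETy.bang^[n] .o) : m = n := by
  induction m generalizing n with
  | zero =>
    cases n with
    | zero => rfl
    | succ n => rw [Function.iterate_succ_apply'] at h; cases h
  | succ m ih =>
    cases n with
    | zero => rw [Function.iterate_succ_apply'] at h; cases h
    | succ n =>
      rw [Function.iterate_succ_apply', Function.iterate_succ_apply'] at h
      injection h with h
      have := ih h
      omega

theorem erase_bang_iterate (m : ℕ) (A : ETy) : (ETy.bang^[m] A).erase = A.erase := by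
  induction m with
  | zero => rfl
  | succ m ih => rw [Function.iterate_succ_apply']; exact ih

end ETy

/-! ### Decorated terms -/

/-- The decoration of a node of a syntax tree: the numbers `d` and `e` of boxes that are open just
outside, resp. just inside the boxes rooted at the node, and the type `A` of the node inside of
these boxes. A leaf is regarded as lying outside of all the boxes that its binder lies outside. -/
structure Mark : Type where
  d : ℕ
  e : ℕ
  A : ETy

/-- The restriction of a function of addresses to an immediate subtree. -/
def below {α : Type} (δ : Dir) (f : Path → α) : Path → α := fun p => f (δ :: p)

/-- The restriction of a function of addresses to a subtree. -/
def shift {α : Type} (p : Path) (f : Path → α) : Path → α := fun q => f (p ++ q)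

@[simp] theorem shift_nil {α : Type} (f : Path → α) : shift [] f = f := rfl
@[simp] theorem shift_cons {α : Type} (δ : Dir) (p : Path) (f : Path → α) :
    shift (δ :: p) f = shift p (below δ f) := rfl
@[simp] theorem below_apply {α : Type} (δ : Dir) (f : Path → α) (p : Path) :
    below δ f p = f (δ :: p) := rfl

/-- The type of a node just outside of the boxes rooted at it. -/
def Mark.out (m : Mark) : ETy := ETy.bang^[m.e - m.d] m.A

/-- A node marked `m` can stand at a place where `b` boxes are open and the type `C` is
expected. -/
def Edge {k : ℕ} (b : ℕ) (M : Lam k) (m : Mark) (C : ETy) : Prop :=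
  m.d ≤ b ∧ m.out = ETy.bang^[b - m.d] C ∧ (m.d < b → M.IsVar ∨ (M.IsApp ∧ m.d = m.e))

/-- Well-formed decorations. -/
def WF : {k : ℕ} → Lam k → (Path → Mark) → Prop
  | _, .var _, f => (f []).d = (f []).e
  | _, .lam M, f => (f []).d ≤ (f []).e ∧ (∀ i, ∀ a ∈ (Lam.lam M).occs i, (f a).d ≤ (f []).d) ∧
      (∃ C B, (f []).A = .lolli C B ∧ Edge (f []).e M (f [.body]) B ∧
        (∀ a ∈ M.occs 0, (f (.body :: a)).d = (f []).e ∧ (f (.body :: a)).A = C) ∧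
        (2 ≤ (M.occs 0).length → ∃ C', C = .bang C')) ∧
      WF M (below .body f)
  | _, .app M N, f => (f []).d ≤ (f []).e ∧
      (∀ i, ∀ a ∈ (Lam.app M N).occs i, (f a).d ≤ (f []).d) ∧
      (∃ C, Edge (f []).e M (f [.fn]) (.lolli C (f []).A) ∧ Edge (f []).e N (f [.arg]) C) ∧
      WF M (below .fn f) ∧ WF N (below .arg f)

open Classical in
/-- The places where the part of `M` at depth at least `c` ends: free occurrences of variables, and
the topmost nodes at smaller depth. -/
noncomputable def slots (c : ℕ) : {k : ℕ} → Lam k → (Path → Mark) → List Path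
  | _, .var _, _ => [[]]
  | _, .lam M, f => ((if (f [.body]).d < c then [[]] else slots c M (below .body f)).filter
      (· ∉ M.occs 0)).map (.body :: ·)
  | _, .app M N, f => (if (f [.fn]).d < c then [[]] else slots c M (below .fn f)).map (.fn :: ·) ++
      (if (f [.arg]).d < c then [[]] else slots c N (below .arg f)).map (.arg :: ·)

/-- `slots`, `lin` and `innerBoxes` take for granted that the root belongs to the part at depth at
least `c`; the variants with `At` first test the outer depth of the root, as is needed for a child.
A root that fails the test is itself the only slot. The split matters for a node with boxes rooted
at it: levels between `d` and `e` belong to its inside only. -/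
noncomputable def slotsAt (c : ℕ) {k : ℕ} (M : Lam k) (f : Path → Mark) : List Path :=
  if (f []).d < c then [[]] else slots c M f

/-- The environment `θ`, extended by a new variable for the occurrences in the list `xs`. -/
noncomputable def lift {n : ℕ} (xs : List Path) (θ : Path → Lam n) (p : Path) : Lam (n + 1) :=
  open Classical in if p ∈ xs then .var 0 else (θ p).rename Fin.succ

/-- The part of `M` at depth at least `c`, with terms plugged into its slots. -/
noncomputable def lin (c : ℕ) : {k n : ℕ} → Lam k → (Path → Mark) → (Path → Lam n) → Lam n
  | _, _, .var _, _, θ => θ []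
  | _, _, .lam M, f, θ => .lam (if (f [.body]).d < c then lift (M.occs 0) (below .body θ) []
      else lin c M (below .body f) (lift (M.occs 0) (below .body θ)))
  | _, _, .app M N, f, θ =>
      .app (if (f [.fn]).d < c then θ [.fn] else lin c M (below .fn f) (below .fn θ))
        (if (f [.arg]).d < c then θ [.arg] else lin c N (below .arg f) (below .arg θ))

noncomputable def linAt (c : ℕ) {k n : ℕ} (M : Lam k) (f : Path → Mark) (θ : Path → Lam n) :
    Lam n :=
  if (f []).d < c then θ [] else lin c M f θ

/-- The internal nodes of the part of `M` at depth at least `c`. -/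
def region (c : ℕ) : {k : ℕ} → Lam k → (Path → Mark) → Finset Path
  | _, .var _, _ => ∅
  | _, .lam M, f => insert []
      ((if (f [.body]).d < c then ∅ else region c M (below .body f)).image (.body :: ·))
  | _, .app M N, f => insert []
      ((if (f [.fn]).d < c then ∅ else region c M (below .fn f)).image (.fn :: ·) ∪
        (if (f [.arg]).d < c then ∅ else region c N (below .arg f)).image (.arg :: ·))

/-- The boxes of depth at least `c + 1` rooted at the root of `M`. -/
def rootBoxes (c : ℕ) {k : ℕ} (M : Lam k) (f : Path → Mark) : Multiset (Finset Path) :=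
  (Finset.Ioc c (f []).e).val.map fun l => region l M f

/-- The boxes in the part of `M` at depth at least `c` that are not rooted at the root. -/
def innerBoxes (c : ℕ) : {k : ℕ} → Lam k → (Path → Mark) → Multiset (Finset Path)
  | _, .var _, _ => 0
  | _, .lam M, f => (if (f [.body]).d < c then 0 else
      rootBoxes (f [.body]).d M (below .body f) + innerBoxes c M (below .body f)).map
        fun R => R.image (.body :: ·)
  | _, .app M N, f => ((if (f [.fn]).d < c then 0 else
      rootBoxes (f [.fn]).d M (below .fn f) + innerBoxes c M (below .fn f)).map
        fun R => R.image (.fn :: ·)) +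
      (if (f [.arg]).d < c then 0 else
      rootBoxes (f [.arg]).d N (below .arg f) + innerBoxes c N (below .arg f)).map
        fun R => R.image (.arg :: ·)

def boxesAt (c : ℕ) {k : ℕ} (M : Lam k) (f : Path → Mark) : Multiset (Finset Path) :=
  if (f []).d < c then 0 else rootBoxes (f []).d M f + innerBoxes c M f

section unfold
variable {k n : ℕ} (c : ℕ) (f : Path → Mark) (θ : Path → Lam n)

open Classical in
theorem slots_lam (M : Lam (k + 1)) : slots c (.lam M) f =
    ((slotsAt c M (below .body f)).filter (· ∉ M.occs 0)).map (.body :: ·) := by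
  rfl

theorem slots_app (M N : Lam k) : slots c (.app M N) f =
    (slotsAt c M (below .fn f)).map (.fn :: ·) ++ (slotsAt c N (below .arg f)).map (.arg :: ·) :=
  rfl

theorem lin_lam (M : Lam (k + 1)) : lin c (.lam M) f θ =
    .lam (linAt c M (below .body f) (lift (M.occs 0) (below .body θ))) := rfl

theorem lin_app (M N : Lam k) : lin c (.app M N) f θ =
    .app (linAt c M (below .fn f) (below .fn θ)) (linAt c N (below .arg f) (below .arg θ)) := rfl

theorem innerBoxes_lam (M : Lam (k + 1)) : innerBoxes c (.lam M) f =
    (boxesAt c M (below .body f)).map fun R => R.image (.body :: ·) := rfl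

theorem innerBoxes_app (M N : Lam k) : innerBoxes c (.app M N) f =
    ((boxesAt c M (below .fn f)).map fun R => R.image (.fn :: ·)) +
      (boxesAt c N (below .arg f)).map fun R => R.image (.arg :: ·) := rfl

theorem mem_slots_lam (M : Lam (k + 1)) {p : Path} : p ∈ slots c (.lam M) f ↔
    ∃ q ∈ slotsAt c M (below .body f), q ∉ M.occs 0 ∧ p = .body :: q := by
  simp only [slots_lam, List.mem_map, List.mem_filter, decide_eq_true_eq]
  constructor
  · rintro ⟨q, ⟨h1, h2⟩, rfl⟩; exact ⟨q, h1, h2, rfl⟩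
  · rintro ⟨q, h1, h2, rfl⟩; exact ⟨q, ⟨h1, h2⟩, rfl⟩

theorem mem_slots_app (M N : Lam k) {p : Path} : p ∈ slots c (.app M N) f ↔
    (∃ q ∈ slotsAt c M (below .fn f), p = .fn :: q) ∨
      ∃ q ∈ slotsAt c N (below .arg f), p = .arg :: q := by
  simp only [slots_app, List.mem_append, List.mem_map, eq_comm]

end unfold

/-! ### Slots -/

theorem WF.d_le_e {k : ℕ} {M : Lam k} {f : Path → Mark} (h : WF M f) : (f []).d ≤ (f []).e := by
  cases M with
  | var i => exact le_of_eq h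
  | lam M => exact h.1
  | app M N => exact h.1

theorem WF.d_occ_le {k : ℕ} {M : Lam k} {f : Path → Mark} (h : WF M f) {i : Fin k} {a : Path}
    (ha : a ∈ M.occs i) : (f a).d ≤ (f []).d := by
  cases M with
  | var j =>
    simp only [Lam.occs] at ha
    split at ha
    · simp only [List.mem_singleton] at ha
      subst ha; exact le_rfl
    · simp at ha
  | lam M => exact h.2.1 i a ha
  | app M N => exact h.2.1 i a ha

theorem Lam.mem_occs_sub {k : ℕ} (M : Lam k) {p q : Path} {i : Fin k} (h : p ++ q ∈ M.occs i) :
    ∃ j, q ∈ (M.sub p).2.occs j := by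
  induction M generalizing p with
  | var j =>
    cases p with
    | nil => exact ⟨i, h⟩
    | cons δ p =>
      simp only [Lam.occs] at h
      split at h <;> simp at h
  | lam M ih =>
    cases p with
    | nil => exact ⟨i, h⟩
    | cons δ p =>
      simp only [Lam.occs, List.mem_map, List.cons_append] at h
      obtain ⟨r, hr, he⟩ := h
      cases he
      exact ih hr
  | app M N ihM ihN =>
    cases p with
    | nil => exact ⟨i, h⟩
    | cons δ p =>
      simp only [Lam.occs, List.mem_append, List.mem_map, List.cons_append] at h
      rcases h with ⟨r, hr, he⟩ | ⟨r, hr, he⟩ <;> cases he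
      exacts [ihM hr, ihN hr]

theorem mem_slotsAt {c k : ℕ} {M : Lam k} {f : Path → Mark} {p : Path} :
    p ∈ slotsAt c M f ↔ ((f []).d < c ∧ p = []) ∨ (c ≤ (f []).d ∧ p ∈ slots c M f) := by
  unfold slotsAt
  split <;> rename_i h
  · simp [h]
  · simp [h, not_lt.1 h]

/-- What is known about the node at a slot. -/
structure SlotFacts (c : ℕ) {k : ℕ} (M : Lam k) (f : Path → Mark) (p : Path) : Prop where
  wf : WF (M.sub p).2 (shift p f)
  shape : ((M.sub p).2.IsVar ∧ ∃ i, p ∈ M.occs i) ∨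
    ((M.sub p).2.IsApp ∧ (f p).d < c ∧ (f p).d = (f p).e)
  length : (M.sub p).2.length ≤ M.length
  length_lt : p ≠ [] → (M.sub p).2.length < M.length
  type : (f p).d ≤ c → ∃ S, ETy.bang^[c - (f p).d] S = (f p).out

theorem Lam.IsVar.exists_occs {k : ℕ} {M : Lam k} (h : M.IsVar) : ∃ i, [] ∈ M.occs i := by
  obtain ⟨i, rfl⟩ := h
  exact ⟨i, by simp [Lam.occs]⟩

/-- If the root itself is the slot, its edge supplies everything: a node that closes boxes is a
variable or an application opening none, and its outer type carries one modality for each closed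
box, of which those for the levels above `c` remain inside `S`. -/
theorem Edge.slotFacts {b c k : ℕ} {M : Lam k} {f : Path → Mark} {C : ETy}
    (hE : Edge b M (f []) C) (hcb : c ≤ b) (hWF : WF M f)
    (ih : c ≤ (f []).e → ∀ p ∈ slots c M f, SlotFacts c M f p) :
    ∀ p ∈ slotsAt c M f, SlotFacts c M f p := by
  intro p hp
  rcases mem_slotsAt.1 hp with ⟨hd, rfl⟩ | ⟨hd, hp⟩
  · obtain ⟨h1, h2, h3⟩ := hE
    refine ⟨hWF, ?_, le_rfl, fun h => (h rfl).elim, fun hdc => ⟨ETy.bang^[b - c] C, ?_⟩⟩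
    · rcases h3 (by omega) with h | ⟨h, h'⟩
      · exact Or.inl ⟨h, h.exists_occs⟩
      · exact Or.inr ⟨h, hd, h'⟩
    · rw [h2, ← ETy.bang_iterate_add]
      congr 2; omega
  · exact ih (hd.trans hWF.d_le_e) p hp

theorem WF.slotFacts {c k : ℕ} {M : Lam k} {f : Path → Mark} (hWF : WF M f) (hc : c ≤ (f []).e) :
    ∀ p ∈ slots c M f, SlotFacts c M f p := by
  induction M generalizing f with
  | var i =>
    intro p hp
    simp only [slots, List.mem_singleton] at hp
    subst hp
    have hde : (f []).d = (f []).e := hWF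
    refine ⟨hWF, Or.inl ⟨⟨i, rfl⟩, i, by simp [Lam.occs]⟩, le_rfl, fun h => (h rfl).elim,
      fun _ => ⟨(f []).out, ?_⟩⟩
    rw [hde, Nat.sub_eq_zero_of_le hc]
    rfl
  | lam M ih =>
    intro p hp
    obtain ⟨h1, h2, ⟨C, B, hA, hE, -, -⟩, hM⟩ := hWF
    obtain ⟨q, hq, hq0, rfl⟩ := (mem_slots_lam _ _ _).1 hp
    have hF := Edge.slotFacts (f := below .body f) hE hc hM (ih hM) q hq
    refine ⟨hF.wf, hF.shape.imp (fun h => ⟨h.1, ?_⟩) id, ?_, fun _ => ?_, hF.type⟩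
    · obtain ⟨-, i, hi⟩ := h
      have : i ≠ 0 := by rintro rfl; exact hq0 hi
      obtain ⟨j, rfl⟩ := Fin.exists_succ_eq.2 this
      exact ⟨j, by simpa [Lam.occs] using hi⟩
    all_goals
      have := hF.length
      simp only [Lam.sub_body, Lam.length]; omega
  | app M N ihM ihN =>
    intro p hp
    obtain ⟨h1, h2, ⟨C, hEM, hEN⟩, hM, hN⟩ := hWF
    rcases (mem_slots_app _ _ _ _).1 hp with ⟨q, hq, rfl⟩ | ⟨q, hq, rfl⟩
    · have hF := Edge.slotFacts (f := below .fn f) hEM hc hM (ihM hM) q hq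
      refine ⟨hF.wf, hF.shape.imp (fun ⟨h, i, hi⟩ => ⟨h, i, by simpa [Lam.occs] using hi⟩) id,
        ?_, fun _ => ?_, hF.type⟩
      all_goals
        have := hF.length
        simp only [Lam.sub_fn, Lam.length]; omega
    · have hF := Edge.slotFacts (f := below .arg f) hEN hc hN (ihN hN) q hq
      refine ⟨hF.wf, hF.shape.imp (fun ⟨h, i, hi⟩ => ⟨h, i, by simpa [Lam.occs] using hi⟩) id,
        ?_, fun _ => ?_, hF.type⟩
      all_goals
        have := hF.length
        simp only [Lam.sub_arg, Lam.length]; omega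

/-- The descent stops at the first slot it meets, so slots form an antichain. This makes the terms
plugged into different slots occupy disjoint subtrees. -/
theorem slots_prefix {c k : ℕ} (M : Lam k) (f : Path → Mark) {p q : Path} (hp : p ∈ slots c M f)
    (hq : q ∈ slots c M f) (h : p <+: q) : p = q := by
  induction M generalizing f p q with
  | var i => simp only [slots, List.mem_singleton] at hp hq; rw [hp, hq]
  | lam M ih =>
    obtain ⟨p, hp', -, rfl⟩ := (mem_slots_lam _ _ _).1 hp
    obtain ⟨q, hq', -, rfl⟩ := (mem_slots_lam _ _ _).1 hq
    rcases mem_slotsAt.1 hp' with ⟨hd, rfl⟩ | ⟨hd, hp⟩ <;>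
      rcases mem_slotsAt.1 hq' with ⟨hd', rfl⟩ | ⟨hd', hq⟩
    · rfl
    · omega
    · omega
    · rw [ih _ hp hq (by simpa [List.cons_prefix_cons] using h)]
  | app M N ihM ihN =>
    rcases (mem_slots_app _ _ _ _).1 hp with ⟨p, hp', rfl⟩ | ⟨p, hp', rfl⟩ <;>
    rcases (mem_slots_app _ _ _ _).1 hq with ⟨q, hq', rfl⟩ | ⟨q, hq', rfl⟩ <;>
    simp [List.cons_prefix_cons] at h
    all_goals
      rcases mem_slotsAt.1 hp' with ⟨hd, rfl⟩ | ⟨hd, hp⟩ <;>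
        rcases mem_slotsAt.1 hq' with ⟨hd', rfl⟩ | ⟨hd', hq⟩
      · rfl
      · omega
      · omega
    · rw [ihM _ hp hq h]
    · rw [ihN _ hp hq h]

theorem nodup_slots {c k : ℕ} (M : Lam k) (f : Path → Mark) : (slots c M f).Nodup := by
  induction M generalizing f with
  | var i => simp [slots]
  | lam M ih =>
    rw [slots_lam]
    refine (List.Nodup.filter _ ?_).map List.cons_injective
    unfold slotsAt
    split
    · simp
    · exact ih _
  | app M N ihM ihN =>
    rw [slots_app]
    refine List.Nodup.append (List.Nodup.map List.cons_injective ?_)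
      (List.Nodup.map List.cons_injective ?_) ?_
    · unfold slotsAt
      split
      · simp
      · exact ihM _
    · unfold slotsAt
      split
      · simp
      · exact ihN _
    · intro a ha hb
      simp only [List.mem_map] at ha hb
      obtain ⟨p, -, rfl⟩ := ha
      obtain ⟨q, -, hq⟩ := hb
      cases hq

/-- A slot above an occurrence of a variable is the occurrence itself, unless the variable is bound
at a depth below the level of the slots. -/
theorem WF.slot_occ {c k : ℕ} {M : Lam k} {f : Path → Mark} (hWF : WF M f)
    {p a : Path} (hp : p ∈ slotsAt c M f) {i : Fin k} (ha : a ∈ M.occs i) (h : p <+: a) :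
    p = a ∨ (f a).d < c := by
  rcases mem_slotsAt.1 hp with ⟨hd, rfl⟩ | ⟨hd, hp⟩
  · exact Or.inr ((hWF.d_occ_le ha).trans_lt hd)
  · have hF := hWF.slotFacts (hd.trans hWF.d_le_e) p hp
    rcases hF.shape with ⟨-, j, hj⟩ | ⟨-, hlt, -⟩
    · exact Or.inl (M.occs_prefix hj ha h)
    · obtain ⟨q, rfl⟩ := h
      obtain ⟨j, hj⟩ := M.mem_occs_sub ha
      have := hF.wf.d_occ_le hj
      simp only [shift, List.append_nil] at this
      exact Or.inr (by omega)

/-- On the way to a free occurrence no node has smaller depth than the occurrence, by the clause of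
`WF` on free occurrences; the descent therefore never stops above it. -/
theorem WF.occ_mem_slots {c k : ℕ} {M : Lam k} {f : Path → Mark} (hWF : WF M f) {i : Fin k}
    {a : Path} (ha : a ∈ M.occs i) (hc : c ≤ (f a).d) : a ∈ slots c M f := by
  induction M generalizing f a with
  | var j =>
    simp only [Lam.occs] at ha
    split at ha
    · simpa [slots] using ha
    · simp at ha
  | lam M ih =>
    obtain ⟨h1, h2, -, hM⟩ := hWF
    simp only [Lam.occs, List.mem_map] at ha
    obtain ⟨q, hq, rfl⟩ := ha
    refine (mem_slots_lam _ _ _).2 ⟨q, mem_slotsAt.2 (Or.inr ⟨hc.trans (hM.d_occ_le hq),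
      ih hM hq hc⟩), fun h0 => ?_, rfl⟩
    exact Fin.succ_ne_zero _ (M.occs_unique hq h0)
  | app M N ihM ihN =>
    obtain ⟨h1, h2, -, hM, hN⟩ := hWF
    simp only [Lam.occs, List.mem_append, List.mem_map] at ha
    rcases ha with ⟨q, hq, rfl⟩ | ⟨q, hq, rfl⟩
    · exact (mem_slots_app _ _ _ _).2 (Or.inl ⟨q, mem_slotsAt.2 (Or.inr
        ⟨hc.trans (hM.d_occ_le hq), ihM hM hq hc⟩), rfl⟩)
    · exact (mem_slots_app _ _ _ _).2 (Or.inr ⟨q, mem_slotsAt.2 (Or.inr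
        ⟨hc.trans (hN.d_occ_le hq), ihN hN hq hc⟩), rfl⟩)

theorem WF.occ_mem_slotsAt {c k : ℕ} {M : Lam k} {f : Path → Mark} (hWF : WF M f) {i : Fin k}
    {a : Path} (ha : a ∈ M.occs i) (hc : c ≤ (f a).d) : a ∈ slotsAt c M f :=
  mem_slotsAt.2 (Or.inr ⟨hc.trans (hWF.d_occ_le ha), hWF.occ_mem_slots ha hc⟩)

/-! ### Plugging terms into slots -/

/-- The lemmas with suffix `_of` pass from the statement for the inside of a node to the one for
`linAt` or `slotsAt`. The former is a hypothesis, so that they can be used on the children within an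
induction. -/
theorem linAt_congr_of {c k n : ℕ} {M : Lam k} {f : Path → Mark} {θ θ' : Path → Lam n}
    (ih : (∀ p ∈ slots c M f, θ p = θ' p) → lin c M f θ = lin c M f θ')
    (h : ∀ p ∈ slotsAt c M f, θ p = θ' p) : linAt c M f θ = linAt c M f θ' := by
  unfold linAt
  unfold slotsAt at h
  split <;> rename_i hd
  · exact h [] (by simp [hd])
  · exact ih (by simpa [hd] using h)

theorem lin_congr {c k n : ℕ} (M : Lam k) (f : Path → Mark) (θ θ' : Path → Lam n)
    (h : ∀ p ∈ slots c M f, θ p = θ' p) : lin c M f θ = lin c M f θ' := by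
  induction M generalizing n f with
  | var i => exact h [] (by simp [slots])
  | lam M ih =>
    rw [lin_lam, lin_lam]
    congr 1
    refine linAt_congr_of (ih _ _ _) fun p hp => ?_
    unfold lift
    split
    · rfl
    · rename_i h0
      rw [below_apply, below_apply, h _ ((mem_slots_lam _ _ _).2 ⟨p, hp, h0, rfl⟩)]
  | app M N ihM ihN =>
    rw [lin_app, lin_app]
    congr 1
    · exact linAt_congr_of (ihM _ _ _) fun p hp =>
        h _ ((mem_slots_app _ _ _ _).2 (Or.inl ⟨p, hp, rfl⟩))
    · exact linAt_congr_of (ihN _ _ _) fun p hp =>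
        h _ ((mem_slots_app _ _ _ _).2 (Or.inr ⟨p, hp, rfl⟩))

theorem linAt_congr {c k n : ℕ} (M : Lam k) (f : Path → Mark) (θ θ' : Path → Lam n)
    (h : ∀ p ∈ slotsAt c M f, θ p = θ' p) : linAt c M f θ = linAt c M f θ' :=
  linAt_congr_of (lin_congr _ _ _ _) h

theorem subst_lin {c k n m : ℕ} (M : Lam k) (f : Path → Mark) (θ : Path → Lam n)
    (s : Fin n → Lam m) : (lin c M f θ).subst s = lin c M f fun p => (θ p).subst s := by
  induction M generalizing n m f with
  | var i => rfl
  | lam M ih =>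
    rw [lin_lam, lin_lam, Lam.subst]
    congr 1
    have key : (fun p => (lift (M.occs 0) (below .body θ) p).subst
        (extend (.var 0) fun i => (s i).rename Fin.succ)) =
        lift (M.occs 0) (below .body fun p => (θ p).subst s) := by
      funext p
      unfold lift
      split
      · rfl
      · rw [Lam.subst_rename, below_apply, below_apply, Lam.rename_subst]
        congr 1
    unfold linAt
    split
    · exact congrFun key []
    · rw [ih, key]
  | app M N ihM ihN =>
    rw [lin_app, lin_app, Lam.subst]
    unfold linAt
    congr 1
    · split
      · rfl
      · exact ihM _ _ _
    · split
      · rfl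
      · exact ihN _ _ _

theorem subst_linAt {c k n m : ℕ} (M : Lam k) (f : Path → Mark) (θ : Path → Lam n)
    (s : Fin n → Lam m) : (linAt c M f θ).subst s = linAt c M f fun p => (θ p).subst s := by
  unfold linAt
  split
  · rfl
  · exact subst_lin _ _ _ _

theorem Lam.rename_eq_subst {n m : ℕ} (g : Fin n → Fin m) (M : Lam n) :
    M.rename g = M.subst fun i => .var (g i) := by
  induction M generalizing m with
  | var i => rfl
  | lam M ih =>
    simp only [Lam.rename, Lam.subst, ih]
    congr 2
    funext i
    refine Fin.cases ?_ (fun i => ?_) i <;> simp [extend]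
  | app M N ihM ihN => simp only [Lam.rename, Lam.subst, ihM, ihN]

theorem rename_linAt {c k n m : ℕ} (M : Lam k) (f : Path → Mark) (θ : Path → Lam n)
    (g : Fin n → Fin m) : (linAt c M f θ).rename g = linAt c M f fun p => (θ p).rename g := by
  simp only [Lam.rename_eq_subst, subst_linAt]

/-- The whole term is obtained at level `0`. -/
theorem lin_zero {k n : ℕ} (M : Lam k) (f : Path → Mark) (θ : Path → Lam n) (s : Fin k → Lam n)
    (h : ∀ i, ∀ a ∈ M.occs i, θ a = s i) : lin 0 M f θ = M.subst s := by
  induction M generalizing n f with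
  | var i => exact h i [] (by simp [Lam.occs])
  | lam M ih =>
    rw [lin_lam, Lam.subst]
    congr 1
    unfold linAt
    rw [if_neg (by simp)]
    apply ih
    intro i a ha
    unfold lift
    refine Fin.cases (fun ha => ?_) (fun i ha => ?_) i ha
    · rw [if_pos ha]; rfl
    · rw [if_neg fun h0 => Fin.succ_ne_zero _ (M.occs_unique ha h0), below_apply,
        h i (.body :: a) (by simpa [Lam.occs] using ha)]
      rfl
  | app M N ihM ihN =>
    rw [lin_app, Lam.subst]
    unfold linAt
    rw [if_neg (by simp), if_neg (by simp)]
    congr 1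
    · exact ihM _ _ _ fun i a ha => h i _ (by simp [Lam.occs, ha])
    · exact ihN _ _ _ fun i a ha => h i _ (by simp [Lam.occs, ha])

theorem Lam.subst_var {n : ℕ} (M : Lam n) : M.subst Lam.var = M := by
  induction M with
  | var i => rfl
  | lam M ih =>
    rw [Lam.subst]
    congr 1
    conv_rhs => rw [← ih]
    congr 1
    funext i
    refine Fin.cases ?_ (fun i => ?_) i <;> simp [extend, Lam.rename]
  | app M N ihM ihN => rw [Lam.subst, ihM, ihN]

/-! ### From one level to the next -/

/-- What hangs below a slot of level `c` cannot contain a variable bound at depth at least `c`. This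
is the condition under which a subterm may be moved out of a box into its substitution list. -/
theorem WF.not_mem_occs_of_slot {c k : ℕ} {M : Lam (k + 1)} {f : Path → Mark}
    (hM : WF M (below .body f)) (hx : ∀ a ∈ M.occs 0, c ≤ (f (.body :: a)).d)
    {q : Path} (hq : q ∈ slotsAt c M (below .body f)) (hq0 : q ∉ M.occs 0) (r : Path) :
    q ++ r ∉ M.occs 0 := by
  intro h0
  rcases hM.slot_occ hq h0 (List.prefix_append _ _) with h | h
  · exact hq0 (h ▸ h0)
  · have := hx _ h0
    simp only [below_apply] at h
    omega

theorem mem_slotsAt_expand_of {c k : ℕ} {M : Lam k} {f : Path → Mark} {p : Path}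
    (ih : c + 1 ≤ (f []).d → (p ∈ slots c M f ↔ ∃ q ∈ slots (c + 1) M f,
      ∃ r ∈ slotsAt c (M.sub q).2 (shift q f), p = q ++ r)) :
    p ∈ slotsAt c M f ↔ ∃ q ∈ slotsAt (c + 1) M f,
      ∃ r ∈ slotsAt c (M.sub q).2 (shift q f), p = q ++ r := by
  by_cases hd : (f []).d < c + 1
  · have : slotsAt (c + 1) M f = [[]] := by simp [slotsAt, hd]
    simp only [this, List.mem_singleton, exists_eq_left, List.nil_append, exists_eq_right']
    rfl
  · have h1 : slotsAt (c + 1) M f = slots (c + 1) M f := by simp [slotsAt, hd]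
    have h2 : slotsAt c M f = slots c M f := by
      unfold slotsAt; rw [if_neg (by omega)]
    rw [h1, h2]
    exact ih (by omega)

theorem mem_slots_expand {c k : ℕ} {M : Lam k} {f : Path → Mark} (hWF : WF M f)
    (hc : c + 1 ≤ (f []).e) {p : Path} : p ∈ slots c M f ↔ ∃ q ∈ slots (c + 1) M f,
      ∃ r ∈ slotsAt c (M.sub q).2 (shift q f), p = q ++ r := by
  induction M generalizing f p with
  | var i =>
    simp only [slots, List.mem_singleton, exists_eq_left, List.nil_append, exists_eq_right']
    change _ ↔ p ∈ slotsAt c (.var i) f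
    simp [slots, slotsAt]
  | lam M ih =>
    obtain ⟨h1, h2, ⟨C, B, hA, hE, hx, -⟩, hM⟩ := hWF
    have key := fun p => mem_slotsAt_expand_of (p := p) (f := below .body f)
      fun h => ih hM (h.trans hM.d_le_e)
    have hno := fun q hq hq0 r => hM.not_mem_occs_of_slot (c := c + 1) (q := q)
      (fun a ha => by rw [(hx a ha).1]; exact hc) hq hq0 r
    rw [mem_slots_lam]
    constructor
    · rintro ⟨p, hp, hp0, rfl⟩
      obtain ⟨q, hq, r, hr, rfl⟩ := (key p).1 hp
      refine ⟨.body :: q, (mem_slots_lam _ _ _).2 ⟨q, hq, fun h0 => hp0 ?_, rfl⟩, r, hr, rfl⟩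
      -- A bound occurrence is a leaf, so it has no further slot below it and `r` is empty.
      obtain ⟨i, hi⟩ := M.sub_of_mem_occs h0
      have : r = [] := by
        rw [hi] at hr
        simpa [slotsAt, slots] using hr
      subst this
      simpa using h0
    · rintro ⟨q, hq, r, hr, rfl⟩
      obtain ⟨q, hq', hq0, rfl⟩ := (mem_slots_lam _ _ _).1 hq
      exact ⟨q ++ r, (key _).2 ⟨q, hq', r, hr, rfl⟩, hno q hq' hq0 r, rfl⟩
  | app M N ihM ihN =>
    obtain ⟨h1, h2, -, hM, hN⟩ := hWF
    have keyM := fun p => mem_slotsAt_expand_of (p := p) (f := below .fn f)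
      fun h => ihM hM (h.trans hM.d_le_e)
    have keyN := fun p => mem_slotsAt_expand_of (p := p) (f := below .arg f)
      fun h => ihN hN (h.trans hN.d_le_e)
    rw [mem_slots_app]
    constructor
    · rintro (⟨p, hp, rfl⟩ | ⟨p, hp, rfl⟩)
      · obtain ⟨q, hq, r, hr, rfl⟩ := (keyM p).1 hp
        exact ⟨.fn :: q, (mem_slots_app _ _ _ _).2 (Or.inl ⟨q, hq, rfl⟩), r, hr, rfl⟩
      · obtain ⟨q, hq, r, hr, rfl⟩ := (keyN p).1 hp
        exact ⟨.arg :: q, (mem_slots_app _ _ _ _).2 (Or.inr ⟨q, hq, rfl⟩), r, hr, rfl⟩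
    · rintro ⟨q, hq, r, hr, rfl⟩
      rcases (mem_slots_app _ _ _ _).1 hq with ⟨q, hq', rfl⟩ | ⟨q, hq', rfl⟩
      · exact Or.inl ⟨q ++ r, (keyM _).2 ⟨q, hq', r, hr, rfl⟩, rfl⟩
      · exact Or.inr ⟨q ++ r, (keyN _).2 ⟨q, hq', r, hr, rfl⟩, rfl⟩

theorem linAt_expand_of {c k n : ℕ} {M : Lam k} {f : Path → Mark} {θ : Path → Lam n}
    (ih : c + 1 ≤ (f []).d → lin c M f θ =
      lin (c + 1) M f fun q => linAt c (M.sub q).2 (shift q f) (shift q θ)) :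
    linAt c M f θ = linAt (c + 1) M f fun q => linAt c (M.sub q).2 (shift q f) (shift q θ) := by
  by_cases hd : (f []).d < c + 1
  · conv_rhs => rw [linAt, if_pos hd]
    rfl
  · rw [linAt, linAt, if_neg (by omega), if_neg hd]
    exact ih (by omega)

/-- Stopping at level `c` is the same as stopping at level `c + 1` and then continuing from each of
these slots down to level `c`. This is the equation between a box and its body with the substitution
list carried out. -/
theorem lin_expand {c k n : ℕ} {M : Lam k} {f : Path → Mark} (hWF : WF M f)
    (hc : c + 1 ≤ (f []).e) (θ : Path → Lam n) : lin c M f θ =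
      lin (c + 1) M f fun q => linAt c (M.sub q).2 (shift q f) (shift q θ) := by
  induction M generalizing f n with
  | var i =>
    change θ [] = linAt c (.var i) f θ
    simp [lin, linAt]
  | lam M ih =>
    obtain ⟨h1, h2, ⟨C, B, hA, hE, hx, -⟩, hM⟩ := hWF
    rw [lin_lam, lin_lam]
    congr 1
    rw [linAt_expand_of fun h => ih hM (h.trans hM.d_le_e) _]
    apply linAt_congr
    intro q hq
    by_cases h0 : q ∈ M.occs 0
    · conv_rhs => rw [lift, if_pos h0]
      -- At a bound occurrence both sides are the variable `0`; at any other slot nothing below is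
      -- bound here, so lifting commutes with plugging.
      obtain ⟨i, hi⟩ := M.sub_of_mem_occs h0
      rw [hi]
      simp [linAt, lin, shift, lift, h0]
    · conv_rhs => rw [lift, if_neg h0, below_apply, rename_linAt]
      congr 1
      funext r
      have := hM.not_mem_occs_of_slot (c := c + 1) (q := q)
        (fun a ha => by rw [(hx a ha).1]; exact hc) hq h0 r
      simp [shift, lift, this]
  | app M N ihM ihN =>
    obtain ⟨h1, h2, -, hM, hN⟩ := hWF
    rw [lin_app, lin_app, linAt_expand_of fun h => ihM hM (h.trans hM.d_le_e) _,
      linAt_expand_of fun h => ihN hN (h.trans hN.d_le_e) _]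
    rfl

theorem boxesAt_expand_of {c k : ℕ} {M : Lam k} {f : Path → Mark}
    (ih : c + 1 ≤ (f []).d → innerBoxes c M f = innerBoxes (c + 1) M f +
      ((slots (c + 1) M f).map fun q => (boxesAt c (M.sub q).2 (shift q f)).map
        fun R => R.image (q ++ ·)).sum) :
    boxesAt c M f = boxesAt (c + 1) M f +
      ((slotsAt (c + 1) M f).map fun q => (boxesAt c (M.sub q).2 (shift q f)).map
        fun R => R.image (q ++ ·)).sum := by
  by_cases hd : (f []).d < c + 1
  · have : slotsAt (c + 1) M f = [[]] := by simp [slotsAt, hd]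
    rw [this]
    conv_rhs => rw [boxesAt, if_pos hd]
    simp only [List.map_cons, List.map_nil, List.sum_singleton, List.nil_append, zero_add,
      Finset.image_id', Multiset.map_id']
    rfl
  · have h1 : slotsAt (c + 1) M f = slots (c + 1) M f := by simp [slotsAt, hd]
    rw [h1]
    conv_lhs => rw [boxesAt, if_neg (by omega), ih (by omega)]
    conv_rhs => enter [1]; rw [boxesAt, if_neg hd]
    rw [add_assoc]

theorem boxesAt_var {c k : ℕ} {M : Lam k} (h : M.IsVar) {f : Path → Mark} (hWF : WF M f) :
    boxesAt c M f = 0 := by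
  obtain ⟨i, rfl⟩ := h
  have : (f []).d = (f []).e := hWF
  simp [boxesAt, rootBoxes, innerBoxes, this]

theorem map_image_cons_sum (δ : Dir) (L : List Path) (g : Path → Multiset (Finset Path)) :
    ((L.map fun q => (g q).map fun R => R.image (q ++ ·)).sum).map (fun R => R.image (δ :: ·)) =
      (L.map fun q => (g q).map fun R => R.image ((δ :: q) ++ ·)).sum := by
  induction L with
  | nil => simp
  | cons q L ih =>
    simp only [List.map_cons, List.sum_cons, Multiset.map_add, ih, Multiset.map_map]
    congr 1
    refine Multiset.map_congr rfl fun R _ => ?_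
    simp only [Function.comp, Finset.image_image]
    rfl

/-- The boxes of level above `c + 1` around the slots are untouched; those lying in the substituted
terms are collected slot by slot. The shape matches the clause of `EA.boxes` for a box. -/
theorem innerBoxes_expand {c k : ℕ} {M : Lam k} {f : Path → Mark} (hWF : WF M f)
    (hc : c + 1 ≤ (f []).e) : innerBoxes c M f = innerBoxes (c + 1) M f +
      ((slots (c + 1) M f).map fun q => (boxesAt c (M.sub q).2 (shift q f)).map
        fun R => R.image (q ++ ·)).sum := by
  induction M generalizing f with
  | var i =>
    have : boxesAt c ((Lam.var i).sub []).2 f = 0 := boxesAt_var ⟨i, rfl⟩ hWF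
    simp [innerBoxes, slots, this]
  | lam M ih =>
    obtain ⟨h1, h2, ⟨C, B, hA, hE, hx, -⟩, hM⟩ := hWF
    rw [innerBoxes_lam, innerBoxes_lam, boxesAt_expand_of fun h => ih hM (h.trans hM.d_le_e),
      Multiset.map_add, slots_lam, map_image_cons_sum, List.map_map]
    congr 1
    have hfacts := Edge.slotFacts (f := below .body f) hE hc hM hM.slotFacts
    generalize slotsAt (c + 1) M (below .body f) = L at hfacts
    induction L with
    | nil => rfl
    | cons q L ihL =>
      have hL := ihL fun p hp => hfacts p (List.mem_cons_of_mem _ hp)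
      have hq := hfacts q List.mem_cons_self
      -- Bound occurrences are filtered out of the slots of the abstraction; being leaves, they
      -- contribute no boxes anyway.
      by_cases h0 : q ∈ M.occs 0
      · rw [List.filter_cons_of_neg (by simpa using h0), ← hL, List.map_cons, List.sum_cons,
          boxesAt_var (M.sub_of_mem_occs h0) hq.wf]
        simp
      · rw [List.filter_cons_of_pos (by simpa using h0), List.map_cons, List.map_cons,
          List.sum_cons, List.sum_cons, hL]
        rfl
  | app M N ihM ihN =>
    obtain ⟨h1, h2, -, hM, hN⟩ := hWF
    rw [innerBoxes_app, innerBoxes_app, boxesAt_expand_of fun h => ihM hM (h.trans hM.d_le_e),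
      boxesAt_expand_of fun h => ihN hN (h.trans hN.d_le_e),
      Multiset.map_add, Multiset.map_add, slots_app, map_image_cons_sum, map_image_cons_sum,
      List.map_append, List.sum_append, List.map_map, List.map_map]
    simp only [Function.comp_def, Lam.sub_fn, Lam.sub_arg, shift_cons]
    abel

/-! ### Length, occurrences and nodes -/

/-- The constant `s` depends neither on the plugged terms nor on the number of variables. Comparing
variables in the slots with arbitrary terms there shows that the substitutions of a box duplicate
nothing, which is what the length condition on candidates demands. -/
theorem exists_length_lin (c : ℕ) {k : ℕ} (M : Lam k) (f : Path → Mark) :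
    ∃ s, ∀ (n : ℕ) (θ : Path → Lam n), (lin c M f θ).length =
      s + ((slots c M f).map fun p => (θ p).length).sum := by
  have at_of : ∀ {k : ℕ} (M : Lam k) (f : Path → Mark), (∃ s, ∀ (n : ℕ) (θ : Path → Lam n),
      (lin c M f θ).length = s + ((slots c M f).map fun p => (θ p).length).sum) →
      ∃ s, ∀ (n : ℕ) (θ : Path → Lam n),
      (linAt c M f θ).length = s + ((slotsAt c M f).map fun p => (θ p).length).sum := by
    intro k M f h
    unfold linAt slotsAt
    split
    · exact ⟨0, fun n θ => by simp⟩
    · exact h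
  induction M generalizing f with
  | var i => exact ⟨0, fun n θ => by simp [lin, slots]⟩
  | lam M ih =>
    obtain ⟨s, hs⟩ := at_of M _ (ih (below .body f))
    refine ⟨1 + s, fun n θ => ?_⟩
    rw [lin_lam, Lam.length, hs, slots_lam, add_assoc, List.map_map]
    congr 2
    generalize slotsAt c M (below .body f) = L
    induction L with
    | nil => rfl
    | cons q L ihL =>
      by_cases h0 : q ∈ M.occs 0
      · rw [List.filter_cons_of_neg (by simpa using h0), ← ihL]
        simp [lift, h0, Lam.length]
      · rw [List.filter_cons_of_pos (by simpa using h0), List.map_cons, List.map_cons,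
          List.sum_cons, List.sum_cons, ihL]
        simp [lift, h0, Lam.length_rename]
  | app M N ihM ihN =>
    obtain ⟨s, hs⟩ := at_of M _ (ihM (below .fn f))
    obtain ⟨t, ht⟩ := at_of N _ (ihN (below .arg f))
    refine ⟨1 + s + t, fun n θ => ?_⟩
    rw [lin_app, Lam.length, hs, ht, slots_app, List.map_append, List.sum_append, List.map_map,
      List.map_map]
    simp only [Function.comp_def, below_apply]
    ring

theorem occs_linAt_of {c k n : ℕ} {M : Lam k} {f : Path → Mark} {θ : Path → Lam n} {i : Fin n}
    (ih : (lin c M f θ).occs i = (slots c M f).flatMap fun p => ((θ p).occs i).map (p ++ ·)) :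
    (linAt c M f θ).occs i = (slotsAt c M f).flatMap fun p => ((θ p).occs i).map (p ++ ·) := by
  unfold linAt slotsAt
  split
  · simp
  · exact ih

theorem occs_lin {c k n : ℕ} (M : Lam k) (f : Path → Mark) (θ : Path → Lam n) (i : Fin n) :
    (lin c M f θ).occs i = (slots c M f).flatMap fun p => ((θ p).occs i).map (p ++ ·) := by
  induction M generalizing n f with
  | var j => simp [lin, slots]
  | lam M ih =>
    rw [lin_lam, Lam.occs, occs_linAt_of (ih _ _ _), slots_lam, List.flatMap_map, List.map_flatMap]
    generalize slotsAt c M (below .body f) = L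
    induction L with
    | nil => rfl
    | cons q L ihL =>
      by_cases h0 : q ∈ M.occs 0
      · rw [List.filter_cons_of_neg (by simpa using h0), ← ihL]
        simp [lift, h0, Lam.occs, (Fin.succ_ne_zero i).symm]
      · rw [List.filter_cons_of_pos (by simpa using h0), List.flatMap_cons, List.flatMap_cons, ihL]
        simp [lift, h0, Lam.occs_rename _ (Fin.succ_injective n), Function.comp_def]
  | app M N ihM ihN =>
    rw [lin_app, Lam.occs, occs_linAt_of (ihM _ _ _), occs_linAt_of (ihN _ _ _), slots_app,
      List.flatMap_append, List.flatMap_map, List.flatMap_map, List.map_flatMap, List.map_flatMap]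
    simp [Function.comp_def]

/-- Variables have no internal nodes, so filling the slots with variables leaves exactly the nodes
that a box of level `c` encloses. -/
theorem nodes_lin {c k n : ℕ} (M : Lam k) (f : Path → Mark) (θ : Path → Lam n)
    (h : ∀ p ∈ slots c M f, (θ p).IsVar) : (lin c M f θ).nodes = region c M f := by
  have at_of : ∀ {k n : ℕ} (M : Lam k) (f : Path → Mark) (θ : Path → Lam n),
      ((∀ p ∈ slots c M f, (θ p).IsVar) → (lin c M f θ).nodes = region c M f) →
      (∀ p ∈ slotsAt c M f, (θ p).IsVar) → (linAt c M f θ).nodes =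
        if (f []).d < c then ∅ else region c M f := by
    intro k n M f θ ih h
    unfold slotsAt at h
    unfold linAt
    split <;> rename_i hd
    · obtain ⟨i, hi⟩ := h [] (by simp [hd])
      rw [hi]; rfl
    · exact ih (by simpa [hd] using h)
  induction M generalizing n f with
  | var j =>
    obtain ⟨i, hi⟩ := h [] (by simp [slots])
    rw [lin, hi]; rfl
  | lam M ih =>
    rw [lin_lam, Lam.nodes, at_of _ _ _ (ih _ _)]
    · rfl
    · intro p hp
      unfold lift
      split
      · exact ⟨0, rfl⟩
      · rename_i h0
        obtain ⟨i, hi⟩ := h _ ((mem_slots_lam _ _ _).2 ⟨p, hp, h0, rfl⟩)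
        exact ⟨i.succ, by rw [below_apply, hi]; rfl⟩
  | app M N ihM ihN =>
    rw [lin_app, Lam.nodes, at_of _ _ _ (ihM _ _), at_of _ _ _ (ihN _ _)]
    · rfl
    · exact fun p hp => h _ ((mem_slots_app _ _ _ _).2 (Or.inr ⟨p, hp, rfl⟩))
    · exact fun p hp => h _ ((mem_slots_app _ _ _ _).2 (Or.inl ⟨p, hp, rfl⟩))

/-! ### Pieces of derivations -/

/-- The environment that plugs variables into slots. -/
def toVar {n : ℕ} (v : Path → ℕ) (p : Path) : Lam n :=
  if h : v p < n then .var ⟨v p, h⟩ else .lam (.var 0)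

theorem toVar_of_lt {n : ℕ} {v : Path → ℕ} {p : Path} (h : v p < n) :
    (toVar v p : Lam n) = .var ⟨v p, h⟩ := dif_pos h

/-- `Q` is a derivation of the type `C` with skeleton `E` and boxes `bx`, whose free variables `v p`
stand for the places `p` in the list `L` and may have the types prescribed by `T`. -/
structure IsPiece {n : ℕ} (L : List Path) (T : Path → ETy → Prop) (C : ETy) (E : Lam n)
    (bx : Multiset (Finset Path)) (v : Path → ℕ) (Q : EA n) : Prop where
  free : ∀ i : Fin n, Q.Free i ↔ ∃ p ∈ L, v p = i
  legal : Q.Legal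
  ok : Q.SubtermsOk
  contr : Q.IsContr → ∃ i N, Q = .contr (.var i) N ∧ ∃ p ∈ L, ∃ q ∈ L, p ≠ q ∧ v p = i ∧ v q = i
  length : Q.length = Q.erase.length
  erase : Q.erase = E
  boxes : Q.boxes = bx
  typed : ∀ Δ : Fin n → Option ETy,
    (∀ p ∈ L, ∀ i : Fin n, v p = i → ∃ S, Δ i = some S ∧ T p S) →
    (∀ p ∈ L, ∀ q ∈ L, p ≠ q → v p = v q → ∀ i : Fin n, v p = i → ∃ S, Δ i = some (.bang S)) →
    NEAL Δ Q C

/-- For every environment with different variables for the places in `L` there is a piece. -/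
def HasPieces (L : List Path) (T : Path → ETy → Prop) (C : ETy)
    (E : ∀ n : ℕ, (Path → Lam n) → Lam n) (bx : Multiset (Finset Path))
    (R : ∀ n : ℕ, EA n → Prop) : Prop :=
  ∀ (n : ℕ) (v : Path → ℕ), (∀ p ∈ L, v p < n) → Set.InjOn v {p | p ∈ L} →
    ∃ Q : EA n, IsPiece L T C (E n (toVar v)) bx v Q ∧ R n Q

/-- A contraction at the root occurs only where two places share a variable. Pieces with separate
variables may thus stand in an application or a substitution list. -/
theorem IsPiece.not_isContr {n : ℕ} {L : List Path} {T : Path → ETy → Prop} {C : ETy} {E : Lam n}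
    {bx : Multiset (Finset Path)} {v : Path → ℕ} {Q : EA n} (h : IsPiece L T C E bx v Q)
    (hv : Set.InjOn v {p | p ∈ L}) : ¬ Q.IsContr := by
  intro hc
  obtain ⟨i, N, -, p, hp, q, hq, hne, h1, h2⟩ := h.contr hc
  exact hne (hv hp hq (h1.trans h2.symm))

/-- Contractions: different places may be given the same variable. -/
theorem HasPieces.merge {L : List Path} {T : Path → ETy → Prop} {C : ETy}
    {E : ∀ n : ℕ, (Path → Lam n) → Lam n} {bx : Multiset (Finset Path)}
    {R : ∀ n : ℕ, EA n → Prop} (H : HasPieces L T C E bx R)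
    (hcongr : ∀ n θ θ', (∀ p ∈ L, θ p = θ' p) → E n θ = E n θ')
    (hsubst : ∀ n m θ (s : Fin n → Lam m), (E n θ).subst s = E m fun p => (θ p).subst s)
    (n : ℕ) (v : Path → ℕ) (hv : ∀ p ∈ L, v p < n) :
    ∃ Q : EA n, IsPiece L T C (E n (toVar v)) bx v Q := by
  classical
  -- The measure is the number of identifications made by `v`; each contraction undoes one of them.
  induction hm : L.toFinset.card - (L.toFinset.image v).card using Nat.strong_induction_on
    generalizing n v with
  | _ m ih =>
  by_cases hinj : Set.InjOn v {p | p ∈ L}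
  · obtain ⟨Q, hQ, -⟩ := H n v hv hinj
    exact ⟨Q, hQ⟩
  obtain ⟨p, hp, q, hq, hpq, hne⟩ : ∃ p ∈ L, ∃ q ∈ L, v p = v q ∧ p ≠ q := by
    simp only [Set.InjOn, Set.mem_ofPred_eq, not_forall] at hinj
    obtain ⟨p, hp, q, hq, h1, h2⟩ := hinj
    exact ⟨p, hp, q, hq, h1, h2⟩
  -- The place `p` is separated from the other places with the same variable: `0` and `1` are the
  -- two variables of the contraction, and the old variables are shifted by two.
  set w : Path → ℕ := fun r => if r = p then 0 else if v r = v p then 1 else v r + 2 with hw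
  have wp : w p = 0 := by simp [hw]
  have w1 : ∀ r, r ≠ p → v r = v p → w r = 1 := fun r h1 h2 => by simp [hw, h1, h2]
  have w2 : ∀ r, v r ≠ v p → w r = v r + 2 := fun r h => by
    have : r ≠ p := by rintro rfl; exact h rfl
    simp [hw, h, this]
  have hwn : ∀ r ∈ L, w r < n + 2 := by
    intro r hr
    have := hv r hr
    by_cases h1 : r = p
    · rw [h1, wp]; omega
    · by_cases h2 : v r = v p
      · rw [w1 r h1 h2]; omega
      · rw [w2 r h2]; omega
  have hcard : (L.toFinset.image v).card < (L.toFinset.image w).card := by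
    have : L.toFinset.image w =
        insert 0 ((L.toFinset.image v).image fun x => if x = v p then 1 else x + 2) := by
      ext x
      simp only [Finset.mem_image, List.mem_toFinset, Finset.mem_insert]
      constructor
      · rintro ⟨r, hr, rfl⟩
        by_cases h1 : r = p
        · left; rw [h1, wp]
        · right
          refine ⟨v r, ⟨r, hr, rfl⟩, ?_⟩
          by_cases h2 : v r = v p
          · rw [w1 r h1 h2, if_pos h2]
          · rw [w2 r h2, if_neg h2]
      · rintro (rfl | ⟨_, ⟨r, hr, rfl⟩, rfl⟩)
        · exact ⟨p, hp, wp⟩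
        · by_cases h2 : v r = v p
          · exact ⟨q, hq, by rw [if_pos h2, w1 q hne.symm hpq.symm]⟩
          · exact ⟨r, hr, by rw [if_neg h2, w2 r h2]⟩
    have hinj' : ((L.toFinset.image v).image fun x => if x = v p then 1 else x + 2).card =
        (L.toFinset.image v).card := by
      refine Finset.card_image_of_injective _ fun x y hxy => ?_
      split_ifs at hxy <;> omega
    rw [this, Finset.card_insert_of_notMem, hinj']
    · omega
    · simp only [Finset.mem_image, not_exists, not_and]
      intro x _
      split_ifs <;> simp
  have hle : (L.toFinset.image w).card ≤ L.toFinset.card := Finset.card_image_le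
  obtain ⟨N, hN⟩ := ih _ (by omega) (n + 2) w hwn rfl
  have hi : v p < n := hv p hp
  set i₀ : Fin n := ⟨v p, hi⟩ with hi₀
  set g : Fin (n + 2) → Fin n := extend i₀ (extend i₀ id) with hg
  have hs : (extend (.var i₀) (extend (.var i₀) Lam.var) : Fin (n + 2) → Lam n) =
      fun j => .var (g j) := by
    funext j
    refine Fin.cases rfl (fun j => ?_) j
    refine Fin.cases rfl (fun j => ?_) j
    simp [hg, extend]
  have herase : (EA.contr (.var i₀) N).erase = E n (toVar v) := by
    rw [EA.erase, hN.erase, hsubst]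
    refine hcongr _ _ _ fun r hr => ?_
    simp only [EA.erase]
    rw [hs, toVar_of_lt (hwn r hr), toVar_of_lt (hv r hr), Lam.subst]
    congr 1
    by_cases h1 : r = p
    · subst h1
      have : (⟨w r, hwn r hr⟩ : Fin (n + 2)) = 0 := Fin.ext wp
      rw [this]; rfl
    · by_cases h2 : v r = v p
      · have : (⟨w r, hwn r hr⟩ : Fin (n + 2)) = Fin.succ 0 := Fin.ext (w1 r h1 h2)
        rw [this]
        simp [hg, extend, hi₀, h2]
      · have : (⟨w r, hwn r hr⟩ : Fin (n + 2)) = Fin.succ (Fin.succ ⟨v r, hv r hr⟩) :=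
          Fin.ext (w2 r h2)
        rw [this]
        rfl
  have hsucc : ∀ i : Fin n, N.Free i.succ.succ ↔ ∃ r ∈ L, v r ≠ v p ∧ v r = i := by
    intro i
    rw [hN.free]
    constructor
    · rintro ⟨r, hr, h⟩
      simp only [Fin.val_succ] at h
      by_cases h1 : r = p
      · rw [h1, wp] at h; omega
      · by_cases h2 : v r = v p
        · rw [w1 r h1 h2] at h; omega
        · rw [w2 r h2] at h; exact ⟨r, hr, h2, by omega⟩
    · rintro ⟨r, hr, h2, h⟩
      exact ⟨r, hr, by rw [w2 r h2, Fin.val_succ, Fin.val_succ, h]⟩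
  refine ⟨.contr (.var i₀) N, ?_, ?_, ?_, ?_, ?_, herase, ?_, ?_⟩
  · intro i
    rw [EA.Free, hsucc, EA.Free]
    constructor
    · rintro (rfl | ⟨r, hr, -, h⟩)
      · exact ⟨p, hp, rfl⟩
      · exact ⟨r, hr, h⟩
    · rintro ⟨r, hr, h⟩
      by_cases h2 : v r = v p
      · exact Or.inl (Fin.ext (h2.symm.trans h))
      · exact Or.inr ⟨r, hr, h2, h⟩
  · refine ⟨trivial, hN.legal, ?_⟩
    rintro i ⟨h1, h2⟩
    obtain ⟨r, hr, h3, h4⟩ := (hsucc i).1 h2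
    simp only [EA.Free] at h1
    subst h1
    exact h3 h4
  · refine ⟨⟨?_, ⟨i₀, rfl⟩, ?_, ?_⟩, ?_, hN.ok⟩
    · simp [EA.RootRedex, EA.IsContr, EA.IsProm]
    · exact (hN.free 0).2 ⟨p, hp, wp⟩
    · exact (hN.free 1).2 ⟨q, hq, w1 q hne.symm hpq.symm⟩
    · simp [EA.SubtermsOk, EA.RootOk, EA.RootRedex]
  · exact fun _ => ⟨i₀, N, rfl, p, hp, q, hq, hne, rfl, hpq.symm⟩
  · rw [EA.erase, EA.erase, hs, ← Lam.rename_eq_subst, Lam.length_rename, EA.length, EA.length,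
      hN.length]
    rfl
  · rw [EA.boxes, hN.boxes]
    simp [EA.boxes]
  · intro Δ h1 h2
    obtain ⟨B, hB⟩ := h2 p hp q hq hne hpq i₀ rfl
    refine NEAL.contr (NEAL.ax hB) (hN.typed _ ?_ ?_)
    · intro r hr i hi
      obtain ⟨S, hS, hT⟩ := h1 r hr ⟨v r, hv r hr⟩ rfl
      refine ⟨S, ?_, hT⟩
      by_cases hr2 : v r = v p
      · have : S = B.bang := by
          have : (⟨v r, hv r hr⟩ : Fin n) = i₀ := Fin.ext hr2
          rw [this, hB] at hS
          injection hS with hS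
          exact hS.symm
        subst this
        by_cases hr1 : r = p
        · have : i = 0 := Fin.ext (by rw [← hi, hr1, wp]; rfl)
          rw [this]; rfl
        · have : i = Fin.succ 0 := Fin.ext (by rw [← hi, w1 r hr1 hr2]; rfl)
          rw [this]; rfl
      · have : i = Fin.succ (Fin.succ ⟨v r, hv r hr⟩) := Fin.ext (by rw [← hi, w2 r hr2]; rfl)
        rw [this]
        exact hS
    · intro r hr s hs' hrs hws i hi
      by_cases hr1 : r = p
      · subst hr1
        have hi0 : i = 0 := Fin.ext (by rw [← hi, wp]; rfl)
        exact ⟨B, by rw [hi0]; rfl⟩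
      · by_cases hr2 : v r = v p
        · have : i = Fin.succ 0 := Fin.ext (by rw [← hi, w1 r hr1 hr2]; rfl)
          exact ⟨B, by rw [this]; rfl⟩
        · have hs1 : v s ≠ v p := by
            intro hs2
            by_cases hs1 : s = p
            · rw [hs1, wp, w2 r hr2] at hws; omega
            · rw [w1 s hs1 hs2, w2 r hr2] at hws; omega
          rw [w2 r hr2, w2 s hs1] at hws
          obtain ⟨S, hS⟩ := h2 r hr s hs' hrs (by omega) ⟨v r, hv r hr⟩ rfl
          have : i = Fin.succ (Fin.succ ⟨v r, hv r hr⟩) := Fin.ext (by rw [← hi, w2 r hr2]; rfl)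
          exact ⟨S, by rw [this]; exact hS⟩

/-! ### Existence of pieces -/

/-- The types that a slot of level `c` may have. -/
def slotTy (c : ℕ) (f : Path → Mark) (p : Path) (S : ETy) : Prop :=
  ETy.bang^[c - (f p).d] S = (f p).out

theorem sum_map_eq_sum_get {α β : Type} [AddCommMonoid β] (L : List α) (g : α → β) :
    (L.map g).sum = ∑ j, g (L.get j) := by
  conv_lhs => rw [← List.ofFn_get L, List.map_ofFn, List.sum_ofFn]
  rfl

theorem flatMap_eq_singleton {α : Type} {L : List α} (hL : L.Nodup) {g : α → List α} {x : α}
    (hx : x ∈ L) (h1 : g x = [x]) (h2 : ∀ y ∈ L, y ≠ x → g y = []) : L.flatMap g = [x] := by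
  induction L with
  | nil => simp at hx
  | cons a L ih =>
    rw [List.nodup_cons] at hL
    rw [List.flatMap_cons]
    rcases List.mem_cons.1 hx with rfl | hx
    · have : L.flatMap g = [] := List.flatMap_eq_nil_iff.2 fun y hy =>
        h2 y (List.mem_cons_of_mem _ hy) (by rintro rfl; exact hL.1 hy)
      rw [h1, this]; rfl
    · rw [h2 a List.mem_cons_self (by rintro rfl; exact hL.1 hx),
        ih hL.2 hx fun y hy => h2 y (List.mem_cons_of_mem _ hy)]
      rfl

/-- The piece of a slot that is not entered: just the variable assigned to it. -/
theorem hasPieces_var {T : Path → ETy → Prop} {C : ETy} {R : ∀ n : ℕ, EA n → Prop}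
    (hT : ∀ S, T [] S → S = C) (hR : ∀ n i, R n (.var i)) :
    HasPieces [[]] T C (fun _ θ => θ []) 0 R := by
  intro n v hv _
  have h0 : v [] < n := hv [] (by simp)
  refine ⟨.var ⟨v [], h0⟩, ⟨?_, trivial, ?_, fun h => h.elim, rfl, ?_, rfl, ?_⟩, hR _ _⟩
  · intro i
    simp [EA.Free, Fin.ext_iff]
  · simp [EA.SubtermsOk, EA.RootOk, EA.RootRedex]
  · exact (toVar_of_lt h0).symm
  · intro Δ h1 _
    obtain ⟨S, hS, hTS⟩ := h1 [] (by simp) ⟨v [], h0⟩ rfl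
    exact NEAL.ax (by rw [hS, hT S hTS])

/-- The statement about the term `M` that is proved by induction: it has pieces at all levels that
its root belongs to. -/
def Realizable {k : ℕ} (M : Lam k) (f : Path → Mark) : Prop :=
  ∀ c, (f []).d ≤ c → c ≤ (f []).e → HasPieces (slots c M f) (slotTy c f)
    (ETy.bang^[(f []).e - c] (f []).A) (fun _ θ => lin c M f θ)
    (rootBoxes c M f + innerBoxes c M f)
    (fun _ Q => (Q.IsVar → M.IsVar) ∧ (Q.IsProm → c < (f []).e))

/-- A child of smaller depth than its parent is not entered and becomes a variable. Otherwise the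
two depths agree, and the piece includes the boxes rooted at the child. -/
theorem Realizable.edge {b k : ℕ} {M : Lam k} {f : Path → Mark} {C : ETy} (h : Realizable M f)
    (hWF : WF M f) (hE : Edge b M (f []) C) :
    HasPieces (slotsAt b M f) (slotTy b f) C (fun _ θ => linAt b M f θ) (boxesAt b M f)
      (fun _ _ => True) := by
  obtain ⟨h1, h2, -⟩ := hE
  unfold slotsAt linAt boxesAt
  by_cases hd : (f []).d < b
  · simp only [if_pos hd]
    refine hasPieces_var (fun S hS => ?_) (fun _ _ => trivial)
    exact ETy.bang_iterate_injective _ (hS.trans h2)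
  · obtain rfl : (f []).d = b := by omega
    simp only [if_neg hd]
    intro n v hv hinj
    obtain ⟨Q, hQ, -⟩ := h _ le_rfl hWF.d_le_e n v hv hinj
    refine ⟨Q, ?_, trivial⟩
    have : ETy.bang^[(f []).e - (f []).d] (f []).A = C := by
      have := h2
      rwa [Nat.sub_self] at this
    rwa [this] at hQ

/-- Different slots carry different variables, so the two parts have disjoint free variables and
neither is a contraction. -/
theorem hasPieces_app {k : ℕ} {M N : Lam k} {f : Path → Mark} (hWF : WF (.app M N) f)
    (hM : Realizable M (below .fn f)) (hN : Realizable N (below .arg f)) :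
    HasPieces (slots (f []).e (.app M N) f) (slotTy (f []).e f) (f []).A
      (fun _ θ => lin (f []).e (.app M N) f θ) (innerBoxes (f []).e (.app M N) f)
      (fun _ Q => ¬ Q.IsVar ∧ ¬ Q.IsProm) := by
  obtain ⟨-, -, ⟨C, hEM, hEN⟩, hWM, hWN⟩ := hWF
  have pM := hM.edge hWM hEM
  have pN := hN.edge hWN hEN
  intro n v hv hinj
  have mM : ∀ p ∈ slotsAt (f []).e M (below .fn f), (.fn :: p) ∈ slots (f []).e (.app M N) f :=
    fun p hp => (mem_slots_app _ _ _ _).2 (Or.inl ⟨p, hp, rfl⟩)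
  have mN : ∀ p ∈ slotsAt (f []).e N (below .arg f), (.arg :: p) ∈ slots (f []).e (.app M N) f :=
    fun p hp => (mem_slots_app _ _ _ _).2 (Or.inr ⟨p, hp, rfl⟩)
  have iM : Set.InjOn (below .fn v) {p | p ∈ slotsAt (f []).e M (below .fn f)} :=
    fun p hp q hq h => (List.cons_injective (hinj (mM p hp) (mM q hq) h))
  have iN : Set.InjOn (below .arg v) {p | p ∈ slotsAt (f []).e N (below .arg f)} :=
    fun p hp q hq h => (List.cons_injective (hinj (mN p hp) (mN q hq) h))
  obtain ⟨P, hP, -⟩ := pM n (below .fn v) (fun p hp => hv _ (mM p hp)) iM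
  obtain ⟨Q, hQ, -⟩ := pN n (below .arg v) (fun p hp => hv _ (mN p hp)) iN
  refine ⟨.app P Q, ⟨?_, ⟨hP.legal, hQ.legal, ?_⟩, ⟨?_, hP.ok, hQ.ok⟩, fun h => h.elim, ?_, ?_,
    ?_, ?_⟩, ⟨fun ⟨i, hi⟩ => (by cases hi), fun h => h.elim⟩⟩
  · intro i
    rw [EA.Free, hP.free, hQ.free]
    simp only [mem_slots_app]
    constructor
    · rintro (⟨p, hp, h⟩ | ⟨p, hp, h⟩)
      · exact ⟨_, Or.inl ⟨p, hp, rfl⟩, h⟩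
      · exact ⟨_, Or.inr ⟨p, hp, rfl⟩, h⟩
    · rintro ⟨_, ⟨p, hp, rfl⟩ | ⟨p, hp, rfl⟩, h⟩
      · exact Or.inl ⟨p, hp, h⟩
      · exact Or.inr ⟨p, hp, h⟩
  · rintro i ⟨h1, h2⟩
    obtain ⟨p, hp, h1⟩ := (hP.free i).1 h1
    obtain ⟨q, hq, h2⟩ := (hQ.free i).1 h2
    have := hinj (mM p hp) (mN q hq) (h1.trans h2.symm)
    cases this
  · intro h
    rcases h with h | h
    · exact hP.not_isContr iM h
    · exact hQ.not_isContr iN h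
  · rw [EA.length, EA.erase, Lam.length, hP.length, hQ.length]
  · rw [EA.erase, hP.erase, hQ.erase]; rfl
  · rw [EA.boxes, hP.boxes, hQ.boxes]; rfl
  · intro Δ h1 h2
    refine NEAL.lolliE (hP.typed Δ (fun p hp => h1 _ (mM p hp)) fun p hp q hq hne =>
      h2 _ (mM p hp) _ (mM q hq) fun h => hne (List.cons_injective h))
      (hQ.typed Δ (fun p hp => h1 _ (mN p hp)) fun p hp q hq hne =>
      h2 _ (mN p hp) _ (mN q hq) fun h => hne (List.cons_injective h))

/-- All occurrences of the bound variable are given the index `0`. Contractions are therefore needed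
only for them, and `HasPieces.merge` puts these directly under the abstraction. -/
theorem hasPieces_lam {k : ℕ} {M : Lam (k + 1)} {f : Path → Mark} (hWF : WF (.lam M) f)
    (hM : Realizable M (below .body f)) :
    HasPieces (slots (f []).e (.lam M) f) (slotTy (f []).e f) (f []).A
      (fun _ θ => lin (f []).e (.lam M) f θ) (innerBoxes (f []).e (.lam M) f)
      (fun _ Q => ¬ Q.IsVar ∧ ¬ Q.IsProm) := by
  classical
  obtain ⟨-, -, ⟨C, B, hA, hE, hx, hx2⟩, hWM⟩ := hWF
  have pM := (hM.edge hWM hE).merge (fun n θ θ' h => linAt_congr _ _ _ _ h)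
    (fun n m θ s => subst_linAt _ _ _ _)
  have hxs : ∀ a ∈ M.occs 0, a ∈ slotsAt (f []).e M (below .body f) :=
    fun a ha => hWM.occ_mem_slotsAt ha (hx a ha).1.ge
  intro n v hv hinj
  set w : Path → ℕ := fun p => if p ∈ M.occs 0 then 0 else v (.body :: p) + 1 with hw
  have w0 : ∀ p ∈ M.occs 0, w p = 0 := fun p hp => by simp [hw, hp]
  have w1 : ∀ p, p ∉ M.occs 0 → w p = v (.body :: p) + 1 := fun p hp => by simp [hw, hp]
  have mM : ∀ p ∈ slotsAt (f []).e M (below .body f), p ∉ M.occs 0 →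
      (.body :: p) ∈ slots (f []).e (.lam M) f :=
    fun p hp h0 => (mem_slots_lam _ _ _).2 ⟨p, hp, h0, rfl⟩
  have hwn : ∀ p ∈ slotsAt (f []).e M (below .body f), w p < n + 1 := by
    intro p hp
    by_cases h0 : p ∈ M.occs 0
    · rw [w0 p h0]; omega
    · rw [w1 p h0]
      have := hv _ (mM p hp h0)
      omega
  have hcoll : ∀ p ∈ slotsAt (f []).e M (below .body f), ∀ q ∈ slotsAt (f []).e M (below .body f),
      p ≠ q → w p = w q → p ∈ M.occs 0 ∧ q ∈ M.occs 0 := by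
    intro p hp q hq hne h
    by_cases hp0 : p ∈ M.occs 0 <;> by_cases hq0 : q ∈ M.occs 0
    · exact ⟨hp0, hq0⟩
    · rw [w0 p hp0, w1 q hq0] at h; omega
    · rw [w1 p hp0, w0 q hq0] at h; omega
    · rw [w1 p hp0, w1 q hq0] at h
      exact (hne (List.cons_injective (hinj (mM p hp hp0) (mM q hq hq0) (by omega)))).elim
  obtain ⟨Q, hQ⟩ := pM (n + 1) w hwn
  refine ⟨.lam Q, ⟨?_, hQ.legal, ⟨?_, hQ.ok⟩, fun h => h.elim, ?_, ?_,
    ?_, ?_⟩, ⟨fun ⟨i, hi⟩ => (by cases hi), fun h => h.elim⟩⟩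
  · intro i
    rw [EA.Free, hQ.free]
    constructor
    · rintro ⟨p, hp, h⟩
      by_cases h0 : p ∈ M.occs 0
      · rw [w0 p h0, Fin.val_succ] at h; omega
      · rw [w1 p h0, Fin.val_succ] at h
        exact ⟨_, mM p hp h0, by omega⟩
    · rintro ⟨_, hp, h⟩
      obtain ⟨p, hp', h0, rfl⟩ := (mem_slots_lam _ _ _).1 hp
      exact ⟨p, hp', by rw [w1 p h0, h, Fin.val_succ]⟩
  -- A contraction below the abstraction contracts the bound variable, as no other variable is
  -- shared; hence it is no redex.
  · by_cases hc : Q.IsContr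
    · obtain ⟨i, N, rfl, p, hp, q, hq, hne, h1, h2⟩ := hQ.contr hc
      have h0 := (hcoll p hp q hq hne (h1.trans h2.symm)).1
      have : i = 0 := Fin.ext (by rw [← h1, w0 p h0]; rfl)
      intro h
      exact h this
    · cases Q <;> first | exact (hc trivial).elim | exact fun h => h
  · rw [EA.length, EA.erase, Lam.length, hQ.length]
  · rw [EA.erase, hQ.erase]
    change _ = lin (f []).e (.lam M) f (toVar v)
    rw [lin_lam]
    congr 1
    refine linAt_congr _ _ _ _ fun p hp => ?_
    rw [toVar_of_lt (hwn p hp)]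
    unfold lift
    split <;> rename_i h0
    · congr 1; exact Fin.ext (w0 p h0)
    · rw [below_apply, toVar_of_lt (hv _ (mM p hp h0))]
      simp only [Lam.rename]
      congr 1; exact Fin.ext (w1 p h0)
  · rw [EA.boxes, hQ.boxes]; rfl
  · intro Δ h1 h2
    rw [hA]
    refine NEAL.lolliI (hQ.typed _ ?_ ?_)
    · intro p hp i hi
      by_cases h0 : p ∈ M.occs 0
      · have hi0 : i = 0 := Fin.ext (by rw [← hi, w0 p h0]; rfl)
        refine ⟨C, by rw [hi0]; rfl, ?_⟩
        obtain ⟨hxd, hxA⟩ := hx p h0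
        -- No box is rooted at a leaf, so the outer type of the occurrence is `C` itself.
        have hde : (f (.body :: p)).e = (f (.body :: p)).d := by
          obtain ⟨j, hj⟩ := M.sub_of_mem_occs h0
          rcases mem_slotsAt.1 hp with ⟨hd, -⟩ | ⟨hd, hp'⟩
          · have := hWM.d_occ_le h0
            simp only [below_apply] at this hd
            omega
          · have := (hWM.slotFacts (hd.trans hWM.d_le_e) p hp').wf
            rw [hj] at this
            have h' : ((shift p (below .body f)) []).d = ((shift p (below .body f)) []).e := this
            simp only [shift, List.append_nil, below_apply] at h'
            exact h'.symm
        simp only [slotTy, below_apply, Mark.out, hxd, hde, Nat.sub_self, hxA]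
      · have hlt := hv _ (mM p hp h0)
        obtain ⟨S, hS, hT⟩ := h1 _ (mM p hp h0) ⟨_, hlt⟩ rfl
        have : i = Fin.succ ⟨_, hlt⟩ := Fin.ext (by rw [← hi, w1 p h0]; rfl)
        exact ⟨S, by rw [this]; exact hS, hT⟩
    · intro p hp q hq hne hwpq i hi
      obtain ⟨hp0, hq0⟩ := hcoll p hp q hq hne hwpq
      have hi0 : i = 0 := Fin.ext (by rw [← hi, w0 p hp0]; rfl)
      obtain ⟨C', hC'⟩ := hx2 (by
        by_contra hlen
        have hlen : (M.occs 0).length ≤ 1 := by omega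
        match hL : M.occs 0 with
        | [] => simp [hL] at hp0
        | [a] => simp [hL] at hp0 hq0; exact hne (hp0.trans hq0.symm)
        | _ :: _ :: _ => simp [hL] at hlen)
      exact ⟨C', by rw [hi0, ← hC']; rfl⟩

/-! ### Drawing one more box around a piece -/

theorem rootBoxes_succ {c k : ℕ} (M : Lam k) (f : Path → Mark) (h : c < (f []).e) :
    rootBoxes c M f = region (c + 1) M f ::ₘ rootBoxes (c + 1) M f := by
  unfold rootBoxes
  have : Finset.Ioc c (f []).e = insert (c + 1) (Finset.Ioc (c + 1) (f []).e) := by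
    ext x; simp only [Finset.mem_Ioc, Finset.mem_insert]; omega
  rw [this, Finset.insert_val_of_notMem (by simp), Multiset.map_cons]

/-- The terms that fill the slots of a box of level `c + 1`. -/
theorem hasPieces_slot {c k : ℕ} {M : Lam k} {f : Path → Mark} (hWF : WF M f)
    (hd : (f []).d ≤ c) (hc : c < (f []).e)
    (ih : ∀ q ∈ slots (c + 1) M f, (M.sub q).2.IsApp → Realizable (M.sub q).2 (shift q f))
    {q : Path} (hq : q ∈ slots (c + 1) M f) :
    ∃ S, slotTy (c + 1) f q S ∧
      HasPieces (slotsAt c (M.sub q).2 (shift q f)) (slotTy c (shift q f)) (.bang S)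
        (fun _ θ => linAt c (M.sub q).2 (shift q f) θ) (boxesAt c (M.sub q).2 (shift q f))
        (fun _ Q => ¬ Q.IsProm) := by
  have hF := hWF.slotFacts hc q hq
  have hf : shift q f [] = f q := by simp [shift]
  have hle : (f q).d ≤ c := by
    rcases hF.shape with ⟨-, i, hi⟩ | ⟨-, h, -⟩
    · exact (hWF.d_occ_le hi).trans hd
    · omega
  obtain ⟨S, hS⟩ := hF.type (by omega)
  refine ⟨S, hS, ?_⟩
  have hvar : HasPieces [[]] (slotTy c (shift q f)) (.bang S) (fun _ θ => θ []) 0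
      (fun _ Q => ¬ Q.IsProm) := by
    refine hasPieces_var (fun S' hS' => ?_) (fun _ _ h => h)
    unfold slotTy at hS'
    rw [hf, ← hS, show c + 1 - (f q).d = (c - (f q).d) + 1 by omega, ETy.bang_iterate_add] at hS'
    exact ETy.bang_iterate_injective _ hS'
  -- A slot of depth below `c` also lies outside the next box, and a leaf stays a variable. In the
  -- remaining case the slot is an application of depth exactly `c` with no boxes of its own.
  by_cases hlt : (f q).d < c
  · unfold slotsAt linAt boxesAt
    simp only [hf, if_pos hlt]
    exact hvar
  · rcases hF.shape with ⟨⟨i, hi⟩, -⟩ | ⟨happ, h1, h2⟩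
    · have hb := boxesAt_var (c := c) ⟨i, hi⟩ hF.wf
      rw [hb]
      have hs : slotsAt c (M.sub q).2 (shift q f) = [[]] := by
        rw [hi]; simp [slotsAt, slots]
      have hl : (fun n (θ : Path → Lam n) => linAt c (M.sub q).2 (shift q f) θ) =
          fun n θ => θ [] := by
        funext n θ
        rw [hi]; simp [linAt, lin]
      rw [hs, hl]
      exact hvar
    · have hceq : c = (f q).d := by omega
      have hR := ih q hq happ c (by rw [hf]; omega) (by rw [hf]; omega)
      unfold slotsAt linAt boxesAt
      simp only [hf, if_neg hlt]
      rw [hf] at hR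
      have hout : ETy.bang^[(f q).e - c] (f q).A = .bang S := by
        have : (f q).out = ETy.bang S := by
          rw [← hS, show c + 1 - (f q).d = 1 by omega]; rfl
        rw [← this, Mark.out, hceq]
      rw [hout] at hR
      intro n v hv hinj
      obtain ⟨Q, hQ, -, hprom⟩ := hR n v hv hinj
      rw [← hceq]
      -- A box at the root of this piece would need `c < (f q).e`, but `(f q).e = (f q).d = c`: no
      -- box enters a substitution list.
      exact ⟨Q, hQ, fun h => by have := hprom h; omega⟩

/-- The piece of level `c + 1` becomes the body of a box whose variables are the positions in the
list of slots; each slot is filled with its piece of level `c`. The box strips one modality from the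
type of every slot and adds one to the result. -/
theorem hasPieces_prom {c k : ℕ} {M : Lam k} {f : Path → Mark} (hWF : WF M f)
    (hd : (f []).d ≤ c) (hc : c < (f []).e)
    (ih : ∀ q ∈ slots (c + 1) M f, (M.sub q).2.IsApp → Realizable (M.sub q).2 (shift q f))
    (h : HasPieces (slots (c + 1) M f) (slotTy (c + 1) f)
      (ETy.bang^[(f []).e - (c + 1)] (f []).A) (fun _ θ => lin (c + 1) M f θ)
      (rootBoxes (c + 1) M f + innerBoxes (c + 1) M f) (fun _ Q => (Q.IsVar → M.IsVar))) :
    HasPieces (slots c M f) (slotTy c f)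
      (ETy.bang^[(f []).e - c] (f []).A) (fun _ θ => lin c M f θ)
      (rootBoxes c M f + innerBoxes c M f) (fun _ Q => ¬ Q.IsVar) := by
  classical
  intro n v hv hinj
  set L := slots (c + 1) M f with hL
  have hnd : L.Nodup := nodup_slots _ _
  have hidx : ∀ p ∈ L, L.idxOf p < L.length := fun p hp => List.idxOf_lt_length_of_mem hp
  have hidxj : ∀ j : Fin L.length, L.idxOf (L.get j) = j := fun j => by
    simpa using hnd.idxOf_getElem j j.2
  obtain ⟨N, hN, hNv⟩ := h L.length (fun p => L.idxOf p) hidx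
    (fun p hp q _ hpq => (List.idxOf_inj hp).1 hpq)
  have hslot : ∀ j : Fin L.length, ∃ S, slotTy (c + 1) f (L.get j) S ∧ ∃ Q : EA n,
      IsPiece (slotsAt c (M.sub (L.get j)).2 (shift (L.get j) f)) (slotTy c (shift (L.get j) f))
        (.bang S) (linAt c (M.sub (L.get j)).2 (shift (L.get j) f) (toVar (shift (L.get j) v)))
        (boxesAt c (M.sub (L.get j)).2 (shift (L.get j) f)) (shift (L.get j) v) Q ∧
      ¬ Q.IsProm ∧ ¬ Q.IsContr := by
    intro j
    obtain ⟨S, hS, hP⟩ := hasPieces_slot hWF hd hc ih (L.get_mem j)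
    have hmem : ∀ r ∈ slotsAt c (M.sub (L.get j)).2 (shift (L.get j) f),
        L.get j ++ r ∈ slots c M f :=
      fun r hr => (mem_slots_expand hWF hc).2 ⟨_, L.get_mem j, r, hr, rfl⟩
    have hi : Set.InjOn (shift (L.get j) v)
        {r | r ∈ slotsAt c (M.sub (L.get j)).2 (shift (L.get j) f)} :=
      fun r hr s hs hrs => List.append_cancel_left (hinj (hmem r hr) (hmem s hs) hrs)
    obtain ⟨Q, hQ, hQp⟩ := hP n (shift (L.get j) v) (fun r hr => hv _ (hmem r hr)) hi
    exact ⟨S, hS, Q, hQ, hQp, hQ.not_isContr hi⟩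
  choose S hS Ms hMs hMp hMc using hslot
  have hfree : ∀ i : Fin n, (EA.prom N Ms).Free i ↔ ∃ p ∈ slots c M f, v p = i := by
    intro i
    rw [EA.Free]
    constructor
    · rintro ⟨j, hj⟩
      obtain ⟨r, hr, h⟩ := ((hMs j).free i).1 hj
      exact ⟨_, (mem_slots_expand hWF hc).2 ⟨_, L.get_mem j, r, hr, rfl⟩, h⟩
    · rintro ⟨p, hp, h⟩
      obtain ⟨q, hq, r, hr, rfl⟩ := (mem_slots_expand hWF hc).1 hp
      obtain ⟨j, rfl⟩ := List.get_of_mem hq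
      exact ⟨j, ((hMs j).free i).2 ⟨r, hr, h⟩⟩
  have herase : (EA.prom N Ms).erase = lin (c + 1) M f
      fun q => (toVar (fun p => L.idxOf p) q : Lam L.length).subst fun j => (Ms j).erase := by
    rw [EA.erase, hN.erase, subst_lin]
  have hθ : ∀ j : Fin L.length, (toVar (fun p => L.idxOf p) (L.get j) : Lam L.length) = .var j := by
    intro j
    have := hidxj j
    rw [toVar_of_lt (by rw [this]; exact j.2)]
    congr 1
    exact Fin.ext this
  refine ⟨.prom N Ms, ⟨hfree, ⟨hN.legal, fun j => (hMs j).legal, ?_, ?_⟩, ⟨⟨?_, ?_⟩, hN.ok,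
    fun j => (hMs j).ok⟩, fun h => h.elim, ?_, ?_, ?_, ?_⟩, fun ⟨i, hi⟩ => by cases hi⟩
  · exact fun j => (hN.free j).2 ⟨_, L.get_mem j, hidxj j⟩
  -- A common variable would be a common place below two slots; slots are incomparable addresses, so
  -- the slots coincide.
  · rintro j j' hne i ⟨h1, h2⟩
    obtain ⟨r, hr, h1⟩ := ((hMs j).free i).1 h1
    obtain ⟨s, hs, h2⟩ := ((hMs j').free i).1 h2
    have := hinj ((mem_slots_expand hWF hc).2 ⟨_, L.get_mem j, r, hr, rfl⟩)
      ((mem_slots_expand hWF hc).2 ⟨_, L.get_mem j', s, hs, rfl⟩) (h1.trans h2.symm)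
    apply hne
    apply hnd.injective_get
    rcases List.prefix_or_prefix_of_prefix (List.prefix_append (L.get j) r)
      (this ▸ List.prefix_append (L.get j') s) with h | h
    · exact slots_prefix _ _ (L.get_mem j) (L.get_mem j') h
    · exact (slots_prefix _ _ (L.get_mem j') (L.get_mem j) h).symm
  · rintro ⟨j, h | h⟩
    · exact hMp j h
    · exact hMc j h
  -- A variable as body could come only from a leaf, at which no box is rooted.
  · intro hNvar
    obtain ⟨i, rfl⟩ := hNv hNvar
    have : (f []).d = (f []).e := hWF
    omega
  · obtain ⟨s, hs⟩ := exists_length_lin (c + 1) M f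
    have e1 : N.length = s := by
      rw [hN.length, hN.erase, hs]
      have : ((slots (c + 1) M f).map fun p =>
          (toVar (fun p => L.idxOf p) p : Lam L.length).length) =
          (slots (c + 1) M f).map fun _ => 0 := by
        refine List.map_congr_left fun p hp => ?_
        obtain ⟨j, rfl⟩ := List.get_of_mem hp
        rw [hθ]; rfl
      rw [this]; simp
    rw [herase, hs, EA.length, e1]
    congr 1
    rw [← hL]
    rw [sum_map_eq_sum_get]
    refine Finset.sum_congr rfl fun j _ => ?_
    rw [hθ, (hMs j).length]; rfl
  · rw [herase]
    change _ = lin c M f (toVar v)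
    rw [lin_expand hWF hc]
    refine lin_congr _ _ _ _ fun q hq => ?_
    obtain ⟨j, rfl⟩ := List.get_of_mem hq
    rw [hθ, Lam.subst, (hMs j).erase]
    rfl
  · have hnodes : N.erase.nodes = region (c + 1) M f := by
      rw [hN.erase]
      refine nodes_lin _ _ _ fun p hp => ?_
      obtain ⟨j, rfl⟩ := List.get_of_mem hp
      exact ⟨j, hθ j⟩
    -- Each variable of the box occurs exactly once in its body, at its own slot.
    have hoccs : ∀ j, N.erase.occs j = [L.get j] := by
      intro j
      rw [hN.erase, occs_lin, ← hL]
      refine flatMap_eq_singleton hnd (L.get_mem j) ?_ fun q hq hne => ?_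
      · rw [hθ]; simp [Lam.occs]
      · obtain ⟨i, rfl⟩ := List.get_of_mem hq
        have : i ≠ j := by rintro rfl; exact hne rfl
        rw [hθ]; simp [Lam.occs, this]
    rw [EA.boxes, hnodes, hN.boxes, rootBoxes_succ M f hc, innerBoxes_expand hWF hc, ← hL]
    have : (∑ j, ((N.erase.occs j).map fun a => (Ms j).boxes.map fun R => R.image (a ++ ·)).sum) =
        (L.map fun q => (boxesAt c (M.sub q).2 (shift q f)).map fun R => R.image (q ++ ·)).sum := by
      rw [sum_map_eq_sum_get]
      refine Finset.sum_congr rfl fun j _ => ?_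
      rw [hoccs]
      simp only [List.map_cons, List.map_nil, List.sum_singleton]
      rw [(hMs j).boxes]
    rw [this, Multiset.cons_add, Multiset.cons_add, add_assoc]
  · intro Δ h1 h2
    have : (f []).e - c = (f []).e - (c + 1) + 1 := by omega
    rw [this, Function.iterate_succ_apply']
    refine NEAL.prom (A := S) (fun j => ?_) (hN.typed _ ?_ ?_)
    · refine (hMs j).typed Δ (fun r hr i hi => ?_) (fun r hr s hs hne hrs i hi => ?_)
      · exact h1 _ ((mem_slots_expand hWF hc).2 ⟨_, L.get_mem j, r, hr, rfl⟩) i hi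
      · exact h2 _ ((mem_slots_expand hWF hc).2 ⟨_, L.get_mem j, r, hr, rfl⟩) _
          ((mem_slots_expand hWF hc).2 ⟨_, L.get_mem j, s, hs, rfl⟩)
          (fun h => hne (List.append_cancel_left h)) hrs i hi
    · intro p hp i hi
      obtain ⟨j, rfl⟩ := List.get_of_mem hp
      have : i = j := Fin.ext (hi.symm.trans (hidxj j))
      subst this
      exact ⟨_, rfl, hS _⟩
    · intro p hp q hq hne hpq
      exact (hne ((List.idxOf_inj hp).1 hpq)).elim

/-- The outer induction is on the size of the term and supplies the children and the subterms at the
slots. Inside it, the level descends from `(f []).e`, where the root constructor is applied, to `c`,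
one box per step. -/
theorem realizable {k : ℕ} (M : Lam k) (f : Path → Mark) (hWF : WF M f) : Realizable M f := by
  induction hm : M.length using Nat.strong_induction_on generalizing k M f with
  | _ m ih =>
  have hsub : ∀ c ≤ (f []).e, ¬ M.IsVar → ∀ q ∈ slots c M f,
      Realizable (M.sub q).2 (shift q f) := by
    intro c hc hv q hq
    have hF := hWF.slotFacts hc q hq
    have hne : q ≠ [] := by
      rintro rfl
      cases M with
      | var i => exact hv ⟨i, rfl⟩
      | lam M => obtain ⟨_, _, _, h⟩ := (mem_slots_lam _ _ _).1 hq; cases h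
      | app M N => rcases (mem_slots_app _ _ _ _).1 hq with ⟨_, _, h⟩ | ⟨_, _, h⟩ <;> cases h
    exact ih _ (hm ▸ hF.length_lt hne) _ _ hF.wf rfl
  have base : ¬ M.IsVar → HasPieces (slots (f []).e M f) (slotTy (f []).e f) (f []).A
      (fun _ θ => lin (f []).e M f θ) (innerBoxes (f []).e M f)
      (fun _ Q => ¬ Q.IsVar ∧ ¬ Q.IsProm) := by
    intro hv
    cases M with
    | var i => exact (hv ⟨i, rfl⟩).elim
    | lam M =>
      exact hasPieces_lam hWF (ih M.length (by rw [← hm, Lam.length]; omega) _ _ hWF.2.2.2 rfl)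
    | app M N =>
      exact hasPieces_app hWF
        (ih M.length (by rw [← hm, Lam.length]; omega) _ _ hWF.2.2.2.1 rfl)
        (ih N.length (by rw [← hm, Lam.length]; omega) _ _ hWF.2.2.2.2 rfl)
  by_cases hv : M.IsVar
  · obtain ⟨i, rfl⟩ := hv
    intro c h1 h2
    have hde : (f []).d = (f []).e := hWF
    have hce : (f []).e - c = 0 := by omega
    have hr : rootBoxes c (.var i) f + innerBoxes c (.var i) f = 0 := by
      have : c = (f []).e := by omega
      simp [rootBoxes, innerBoxes, this]
    rw [hr, hce]
    refine hasPieces_var (fun S hS => ?_) (fun n j => ⟨fun _ => ⟨i, rfl⟩, fun h => h.elim⟩)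
    have : c - (f []).d = 0 := by omega
    simpa [slotTy, this, Mark.out, ← hde] using hS
  · intro c h1 h2
    suffices H : ∀ j c, (f []).d ≤ c → c ≤ (f []).e → (f []).e - c = j →
        HasPieces (slots c M f) (slotTy c f)
          (ETy.bang^[(f []).e - c] (f []).A) (fun _ θ => lin c M f θ)
          (rootBoxes c M f + innerBoxes c M f)
          (fun _ Q => ¬ Q.IsVar ∧ (Q.IsProm → c < (f []).e)) by
      intro n v hb hi
      obtain ⟨Q, hQ, hQv, hQp⟩ := H _ c h1 h2 rfl n v hb hi
      exact ⟨Q, hQ, fun h => (hQv h).elim, hQp⟩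
    intro j
    induction j with
    | zero =>
      intro c h1 h2 h3
      obtain rfl : c = (f []).e := by omega
      have hr : rootBoxes (f []).e M f = 0 := by simp [rootBoxes]
      rw [hr, Nat.sub_self, zero_add]
      intro n v hb hi
      obtain ⟨Q, hQ, hQv, hQp⟩ := base hv n v hb hi
      exact ⟨Q, hQ, hQv, fun h => (hQp h).elim⟩
    | succ j ihj =>
      intro c h1 h2 h3
      have hlt : c < (f []).e := by omega
      have hP := hasPieces_prom hWF h1 hlt (fun q hq _ => hsub (c + 1) hlt hv q hq) (by
        intro n v hb hi
        obtain ⟨Q, hQ, hQv, -⟩ := ihj (c + 1) (by omega) (by omega) (by omega) n v hb hi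
        exact ⟨Q, hQ, fun h => (hQv h).elim⟩)
      intro n v hb hi
      obtain ⟨Q, hQ, hQv⟩ := hP n v hb hi
      exact ⟨Q, hQ, hQv, fun _ => hlt⟩

/-- Every well-formed decoration of a term is realized by a derivation. -/
theorem exists_derivation {k : ℕ} (M : Lam k) (f : Path → Mark) (hWF : WF M f)
    (hd : (f []).d = 0) (Δ : Fin k → Option ETy)
    (hΔ : ∀ i, ∀ a ∈ M.occs i, Δ i = some (f a).A)
    (hΔ2 : ∀ i, 2 ≤ (M.occs i).length → ∃ B, Δ i = some (.bang B)) :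
    ∃ P : EA k, P.Legal ∧ P.Candidate ∧ P.erase = M ∧
      NEAL Δ P (ETy.bang^[(f []).e] (f []).A) ∧ P.boxes = boxesAt 0 M f := by
  classical
  have hP := (realizable M f hWF 0 hd.le (Nat.zero_le _)).merge
    (fun n θ θ' h => lin_congr _ _ _ _ h) (fun n m θ s => subst_lin _ _ _ _)
  have hocc : ∀ p ∈ slots 0 M f, ∃ i, p ∈ M.occs i := fun p hp => by
    rcases (hWF.slotFacts (Nat.zero_le _) p hp).shape with ⟨-, h⟩ | ⟨-, h, -⟩
    · exact h
    · omega
  -- At level `0` every slot is a free occurrence and is assigned its own variable; the default `0`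
  -- is never used.
  set v : Path → ℕ := fun p => if h : ∃ i, p ∈ M.occs i then (h.choose : ℕ) else 0 with hv
  have hvi : ∀ i : Fin k, ∀ p ∈ M.occs i, v p = i := fun i p hp => by
    have h : ∃ i, p ∈ M.occs i := ⟨i, hp⟩
    simp only [hv, dif_pos h, M.occs_unique h.choose_spec hp]
  have hvn : ∀ p ∈ slots 0 M f, v p < k := fun p hp => by
    obtain ⟨i, hi⟩ := hocc p hp
    rw [hvi i p hi]; exact i.2
  obtain ⟨P, hP⟩ := hP k v hvn
  refine ⟨P, hP.legal, ⟨hP.ok, hP.length⟩, ?_, hP.typed Δ ?_ ?_, ?_⟩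
  · rw [hP.erase]
    refine (lin_zero M f _ Lam.var fun i a ha => ?_).trans M.subst_var
    have := hvi i a ha
    rw [toVar_of_lt (by rw [this]; exact i.2)]
    congr 1
    exact Fin.ext this
  · intro p hp i hi
    obtain ⟨j, hj⟩ := hocc p hp
    have : i = j := Fin.ext (hi.symm.trans (hvi j p hj))
    subst this
    refine ⟨_, hΔ i p hj, ?_⟩
    obtain ⟨l, hl⟩ := M.sub_of_mem_occs hj
    have hwf := (hWF.slotFacts (Nat.zero_le _) p hp).wf
    rw [hl] at hwf
    have hde : (f p).d = (f p).e := by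
      have : ((shift p f) []).d = ((shift p f) []).e := hwf
      simpa [shift] using this
    simp [slotTy, Mark.out, hde]
  · intro p hp q hq hne hpq i hi
    obtain ⟨j, hj⟩ := hocc p hp
    obtain ⟨l, hl⟩ := hocc q hq
    have h1 : i = j := Fin.ext (hi.symm.trans (hvi j p hj))
    have h2 : i = l := Fin.ext ((hi.symm.trans hpq).trans (hvi l q hl))
    subst h1 h2
    apply hΔ2 i
    by_contra hlen
    have hlen : (M.occs i).length ≤ 1 := by omega
    match hL : M.occs i with
    | [] => simp [hL] at hj
    | [a] => simp [hL] at hj hl; exact hne (hj.trans hl.symm)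
    | _ :: _ :: _ => simp [hL] at hlen
  · rw [hP.boxes, boxesAt, if_neg (by simp), hd]

/-! ### Instantiation of general types -/

namespace GTy

theorem inst_arrow (X : Var → ℕ) {σ τ : Ty} (Θ : GTy (.arrow σ τ)) :
    Θ.inst X = ETy.bang^[Θ.expo.val X] (.lolli (Θ.dom.inst X) (Θ.cod.inst X)) := by
  cases Θ; rfl

theorem inst_o (X : Var → ℕ) (Θ : GTy .o) : Θ.inst X = ETy.bang^[Θ.expo.val X] .o := by
  cases Θ; rfl

theorem inst_bang (X : Var → ℕ) {σ : Ty} (v : Var) (Θ : GTy σ) :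
    (Θ.bang v).inst X = ETy.bang^[X v] (Θ.inst X) := by
  cases Θ <;> simp [bang, withExpo, expo, inst, Expo.val, ETy.bang_iterate_add]

theorem erase_inst (X : Var → ℕ) {σ : Ty} (Θ : GTy σ) : (Θ.inst X).erase = σ := by
  induction Θ with
  | base e => rw [inst, ETy.erase_bang_iterate]; rfl
  | arrow e Θ Δ ihΘ ihΔ => rw [inst, ETy.erase_bang_iterate, ETy.erase, ihΘ, ihΔ]

/-- An instance as its outermost exponent applied to a type without exponent. -/
theorem inst_withExpo (X : Var → ℕ) {σ : Ty} (e : Expo) (Θ : GTy σ) :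
    (Θ.withExpo e).inst X = ETy.bang^[e.val X] ((Θ.withExpo []).inst X) := by
  cases Θ <;> simp [withExpo, inst, Expo.val]

theorem inst_eq (X : Var → ℕ) {σ : Ty} (Θ : GTy σ) :
    Θ.inst X = ETy.bang^[Θ.expo.val X] ((Θ.withExpo []).inst X) := by
  rw [← inst_withExpo]; cases Θ <;> rfl

theorem inst_withExpo_nil_ne (X : Var → ℕ) {σ : Ty} (Θ : GTy σ) (A : ETy) :
    (Θ.withExpo []).inst X ≠ .bang A := by
  cases Θ <;> simp [withExpo, inst, Expo.val]

theorem isBang_iff (X : Var → ℕ) {σ : Ty} (Θ : GTy σ) :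
    (∃ A, Θ.inst X = .bang A) ↔ 1 ≤ Θ.expo.val X := by
  rw [inst_eq]
  constructor
  · rintro ⟨A, hA⟩
    by_contra h
    have : Θ.expo.val X = 0 := by omega
    rw [this] at hA
    exact inst_withExpo_nil_ne X Θ A hA
  · intro h
    obtain ⟨m, hm⟩ := Nat.exists_eq_add_of_le' h
    rw [hm]
    exact ⟨_, Function.iterate_succ_apply' _ _ _⟩

/-- A type without outermost exponent is not a modality, so the equation of a vacuous abstraction,
which concerns only the outermost exponent, can be stated as an equation of types. -/
theorem bang_inst_eq_iff (X : Var → ℕ) {σ : Ty} (Θ : GTy σ) (a b : ℕ) :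
    ETy.bang^[a] ((Θ.withExpo []).inst X) = ETy.bang^[b] ((Θ.withExpo []).inst X) ↔ a = b := by
  refine ⟨fun h => ?_, fun h => by rw [h]⟩
  cases Θ with
  | base e => exact ETy.bang_iterate_o h
  | arrow e Θ Δ => exact (ETy.bang_iterate_lolli h).1

end GTy

/-! ### Constraints with pending boxes -/

/-- The constraint holds after subtraction of the numbers of boxes that are still to be drawn. -/
def Constraint.HoldsWith (X : Var → ℕ) (pend : Path → ℕ) : Constraint → Prop
  | .eqZero l pos neg => pos.val X = neg.val X + l.elim 0 pend
  | .geOne e => 1 ≤ e.val X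

/-- With no box pending this is the plain meaning of the row. While the algorithm works on a
subterm, boxes drawn later around larger terms will still be subtracted from its rows; `pend`
anticipates them. -/
theorem Constraint.holdsWith_zero (X : Var → ℕ) (r : Constraint) :
    r.HoldsWith X (fun _ => 0) ↔ r.Holds X := by
  cases r with
  | eqZero l pos neg =>
    have : l.elim 0 (fun _ => 0) = 0 := by cases l <;> rfl
    simp only [HoldsWith, Holds, this]; omega
  | geOne e => rfl

def RowsHold (X : Var → ℕ) (pend : Path → ℕ) (A : List Constraint) : Prop :=
  ∀ r ∈ A, r.HoldsWith X pend

theorem rowsHold_append {X : Var → ℕ} {pend : Path → ℕ} {A B : List Constraint} :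
    RowsHold X pend (A ++ B) ↔ RowsHold X pend A ∧ RowsHold X pend B := by
  simp [RowsHold, or_imp, forall_and]

theorem rowsHold_cons {X : Var → ℕ} {pend : Path → ℕ} {r : Constraint} {A : List Constraint} :
    RowsHold X pend (r :: A) ↔ r.HoldsWith X pend ∧ RowsHold X pend A := by
  simp [RowsHold]

theorem rowsHold_nil {X : Var → ℕ} {pend : Path → ℕ} : RowsHold X pend [] := by
  simp [RowsHold]

theorem rowsHold_chain {X : Var → ℕ} {pend : Path → ℕ} (es : List Expo) :
    RowsHold X pend (chain es) ↔ ∀ e ∈ es, ∀ e' ∈ es, e.val X = e'.val X := by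
  induction es with
  | nil => simp [chain, RowsHold]
  | cons e₁ es ih =>
    cases es with
    | nil => simp [chain, RowsHold]
    | cons e₂ es =>
      rw [chain, rowsHold_cons, ih]
      simp only [Constraint.HoldsWith, Option.elim_none, add_zero]
      constructor
      · rintro ⟨h1, h2⟩
        have h3 : ∀ e ∈ e₁ :: e₂ :: es, e.val X = e₂.val X := by
          intro e he
          rcases List.mem_cons.1 he with rfl | he
          · exact h1
          · exact h2 e he e₂ (by simp)
        exact fun e he e' he' => (h3 e he).trans (h3 e' he').symm
      · intro h
        exact ⟨h _ (by simp) _ (by simp), fun e he e' he' =>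
          h e (List.mem_cons_of_mem _ he) e' (List.mem_cons_of_mem _ he')⟩

/-- The rows compare exponents at corresponding positions of the types; since arrows and modalities
are injective, equality at all positions is equality of the instances. -/
theorem rowsHold_unify {X : Var → ℕ} {pend : Path → ℕ} {σ : Ty} (Θs : List (GTy σ)) :
    RowsHold X pend (unify σ Θs) ↔ ∀ Θ ∈ Θs, ∀ Θ' ∈ Θs, Θ.inst X = Θ'.inst X := by
  induction σ with
  | o =>
    rw [unify, rowsHold_chain]
    simp only [List.mem_map, forall_exists_index, and_imp, forall_apply_eq_imp_iff₂, GTy.inst_o]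
    exact ⟨fun h Θ hΘ Θ' hΘ' => by rw [h Θ hΘ Θ' hΘ'],
      fun h Θ hΘ Θ' hΘ' => ETy.bang_iterate_o (h Θ hΘ Θ' hΘ')⟩
  | arrow σ τ ihσ ihτ =>
    rw [unify, rowsHold_append, rowsHold_append, rowsHold_chain, ihσ, ihτ]
    simp only [List.mem_map, forall_exists_index, and_imp, forall_apply_eq_imp_iff₂, GTy.inst_arrow]
    constructor
    · rintro ⟨⟨h1, h2⟩, h3⟩ Θ hΘ Θ' hΘ'
      rw [h1 Θ hΘ Θ' hΘ', h2 Θ hΘ Θ' hΘ', h3 Θ hΘ Θ' hΘ']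
    · intro h
      have := fun Θ hΘ Θ' hΘ' => ETy.bang_iterate_lolli (h Θ hΘ Θ' hΘ')
      exact ⟨⟨fun Θ hΘ Θ' hΘ' => (this Θ hΘ Θ' hΘ').1, fun Θ hΘ Θ' hΘ' => (this Θ hΘ Θ' hΘ').2.1⟩,
        fun Θ hΘ Θ' hΘ' => (this Θ hΘ Θ' hΘ').2.2⟩

theorem rowsHold_unify_pair {X : Var → ℕ} {pend : Path → ℕ} {σ : Ty} (Θ Θ' : GTy σ) :
    RowsHold X pend (unify σ [Θ, Θ']) ↔ Θ.inst X = Θ'.inst X := by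
  rw [rowsHold_unify]
  constructor
  · exact fun h => h _ (by simp) _ (by simp)
  · intro h
    simp [h]

/-- Only the row of the outermost exponents belongs to the critical point, so the pending boxes
appear as modalities in front of one side. -/
theorem rowsHold_labelFirst {X : Var → ℕ} {pend : Path → ℕ} {σ : Ty} (ρ : Path) (Θ Θ' : GTy σ) :
    RowsHold X pend (labelFirst ρ (unify σ [Θ, Θ'])) ↔
      Θ.inst X = ETy.bang^[pend ρ] (Θ'.inst X) := by
  cases σ with
  | o =>
    simp only [unify, List.map_cons, List.map_nil, chain, labelFirst, rowsHold_cons, rowsHold_nil,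
      and_true, Constraint.HoldsWith, Option.elim_some, GTy.inst_o, ← ETy.bang_iterate_add]
    exact ⟨fun h => by rw [h, add_comm], fun h => by rw [ETy.bang_iterate_o h, add_comm]⟩
  | arrow σ τ =>
    simp only [unify, List.map_cons, List.map_nil, chain, labelFirst, rowsHold_cons,
      Constraint.HoldsWith, Option.elim_some, GTy.inst_arrow X Θ, GTy.inst_arrow X Θ',
      ← ETy.bang_iterate_add, List.cons_append, List.nil_append, rowsHold_append,
      rowsHold_unify_pair]
    constructor
    · rintro ⟨h1, h2, h3⟩
      rw [h1, h2, h3, add_comm]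
    · intro h
      obtain ⟨h1, h2, h3⟩ := ETy.bang_iterate_lolli h
      exact ⟨by omega, h2, h3⟩

theorem rowsHold_contract {X : Var → ℕ} {pend : Path → ℕ} {σ : Ty} (Θs : List (GTy σ)) :
    RowsHold X pend (contract Θs) ↔ (∀ Θ ∈ Θs, ∀ Θ' ∈ Θs, Θ.inst X = Θ'.inst X) ∧
      (2 ≤ Θs.length → ∀ Θ ∈ Θs, ∃ A, Θ.inst X = .bang A) := by
  match Θs with
  | [] => simp [contract, rowsHold_nil]
  | [Θ] => simp [contract, rowsHold_nil]
  | Θ₁ :: Θ₂ :: Θs =>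
    rw [contract, rowsHold_cons, rowsHold_unify, Constraint.HoldsWith, ← GTy.isBang_iff, and_comm]
    refine and_congr_right fun h => ⟨fun ⟨A, hA⟩ _ Θ hΘ => ⟨A, ?_⟩, fun hA => hA (by simp) _ (by simp)⟩
    rw [h Θ hΘ Θ₁ (by simp), hA]

/-! ### Boxing -/

/-- The boxes opened at the root of the subterm `M` at address `ρ` under the assignment `X`, each
represented by its slice. -/
def openedWith {n : ℕ} {Γ : Fin n → Ty} {σ : Ty} (X : Var → ℕ) (M : Tm Γ σ) (ρ : Path)
    (cpts : List Slice) : List Slice :=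
  if M.isVar then [] else
    cpts.flatMap (fun sl => List.replicate (X (.box ⟨ρ, sl.addrs⟩)) sl) ++
      List.replicate (X (.box ⟨ρ, []⟩)) []

/-- The number of slices to which the row `l` belongs. -/
def closing (W : List Slice) (l : Path) : ℕ := W.countP fun sl => sl.hasRow (some l)

/-- The number of slices to which the variable occurrence `a` does not belong. -/
def passing (W : List Slice) (a : Path) : ℕ := W.countP fun sl => !sl.hasOcc a

theorem closing_append (W W' : List Slice) (l : Path) :
    closing (W ++ W') l = closing W l + closing W' l := List.countP_append

theorem passing_append (W W' : List Slice) (l : Path) :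
    passing (W ++ W') l = passing W l + passing W' l := List.countP_append

/-- The effect of boxing along slices on the type of a variable occurrence. -/
def sliceTy (ρ : Path) {σ : Ty} (a : Path) : List Slice → GTy σ → GTy σ
  | [], Θ => Θ
  | sl :: cpts, Θ => sliceTy ρ a cpts (if sl.hasOcc a then Θ else Θ.bang (.box ⟨ρ, sl.addrs⟩))

/-- The effect of boxing on the type of a variable occurrence. -/
def boxTy {n : ℕ} {Γ : Fin n → Ty} {σ τ : Ty} (M : Tm Γ σ) (ρ : Path) (cpts : List Slice)
    (a : Path) (Θ : GTy τ) : GTy τ :=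
  if M.isVar then Θ else (sliceTy ρ a cpts Θ).bang (.box ⟨ρ, []⟩)

theorem boxSlices_base {n : ℕ} {Γ : Fin n → Ty} {σ : Ty} (ρ : Path) (cpts : List Slice)
    (t : Triple Γ σ) (i : Fin n) : (boxSlices ρ cpts t).base i =
      (t.base i).map fun q => (q.1, sliceTy ρ q.1 cpts q.2) := by
  induction cpts generalizing t with
  | nil => simp [boxSlices, sliceTy]
  | cons sl cpts ih =>
    rw [boxSlices, ih, List.map_map]
    refine List.map_congr_left fun q _ => ?_
    simp only [Function.comp, sliceTy]
    split <;> rfl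

theorem boxing_base {n : ℕ} {Γ : Fin n → Ty} {σ : Ty} (M : Tm Γ σ) (ρ : Path) (cpts : List Slice)
    (t : Triple Γ σ) (i : Fin n) : (boxing M ρ cpts t).base i =
      (t.base i).map fun q => (q.1, boxTy M ρ cpts q.1 q.2) := by
  unfold boxing boxTy
  split
  · simp
  · simp [boxSlices_base]

/-- Each box puts one modality on the occurrences that it does not leave out. -/
theorem inst_sliceTy (X : Var → ℕ) (ρ : Path) {σ : Ty} (a : Path) (cpts : List Slice) (Θ : GTy σ) :
    (sliceTy ρ a cpts Θ).inst X = ETy.bang^[passing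
      (cpts.flatMap fun sl => List.replicate (X (.box ⟨ρ, sl.addrs⟩)) sl) a] (Θ.inst X) := by
  induction cpts generalizing Θ with
  | nil => rfl
  | cons sl cpts ih =>
    rw [sliceTy, ih, List.flatMap_cons, passing_append, add_comm, ETy.bang_iterate_add]
    congr 1
    split <;> rename_i h
    · simp [passing, List.countP_replicate, h]
    · simp [passing, List.countP_replicate, h, GTy.inst_bang]

theorem inst_boxTy {n : ℕ} {Γ : Fin n → Ty} {σ τ : Ty} (X : Var → ℕ) (M : Tm Γ σ) (ρ : Path)
    (cpts : List Slice) (a : Path) (Θ : GTy τ) : (boxTy M ρ cpts a Θ).inst X =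
      ETy.bang^[passing (openedWith X M ρ cpts) a] (Θ.inst X) := by
  unfold boxTy openedWith
  split
  · rfl
  · rw [passing_append, add_comm, ETy.bang_iterate_add, GTy.inst_bang, inst_sliceTy]
    simp [passing, List.countP_replicate, Slice.hasOcc]

theorem inst_boxSlices_ty {n : ℕ} {Γ : Fin n → Ty} {σ : Ty} (X : Var → ℕ) (ρ : Path)
    (cpts : List Slice) (t : Triple Γ σ) : (boxSlices ρ cpts t).ty.inst X = ETy.bang^[
      (cpts.flatMap fun sl => List.replicate (X (.box ⟨ρ, sl.addrs⟩)) sl).length]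
        (t.ty.inst X) := by
  induction cpts generalizing t with
  | nil => rfl
  | cons sl cpts ih =>
    rw [boxSlices, ih, List.flatMap_cons, List.length_append, add_comm, ETy.bang_iterate_add,
      GTy.inst_bang, List.length_replicate]

theorem inst_boxing_ty {n : ℕ} {Γ : Fin n → Ty} {σ : Ty} (X : Var → ℕ) (M : Tm Γ σ) (ρ : Path)
    (cpts : List Slice) (t : Triple Γ σ) : (boxing M ρ cpts t).ty.inst X =
      ETy.bang^[(openedWith X M ρ cpts).length] (t.ty.inst X) := by
  unfold boxing openedWith
  split
  · rfl
  · rw [List.length_append, add_comm, ETy.bang_iterate_add, GTy.inst_bang, inst_boxSlices_ty,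
      List.length_replicate]

/-- Subtracting the variable of a slice means that its boxes are now drawn. For the unmodified row
they count as pending, once for each instance of the slice. -/
theorem Constraint.holdsWith_sub (X : Var → ℕ) (pend : Path → ℕ) (sl : Slice) (c : Var)
    (r : Constraint) : (r.sub sl c).HoldsWith X pend ↔ r.HoldsWith X
      fun l => pend l + closing (List.replicate (X c) sl) l := by
  cases r with
  | geOne e => rfl
  | eqZero l pos neg =>
    cases l with
    | none =>
      have : sl.hasRow none = false := by simp [Slice.hasRow]
      simp [Constraint.sub, this, HoldsWith]
    | some l =>
      by_cases h : sl.hasRow (some l)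
      · simp only [Constraint.sub, h, if_true, HoldsWith, Option.elim_some, closing,
          List.countP_replicate, Expo.val, List.map_cons, List.sum_cons]
        omega
      · simp [Constraint.sub, h, HoldsWith, closing, List.countP_replicate]

theorem rowsHold_boxSlices {n : ℕ} {Γ : Fin n → Ty} {σ : Ty} (X : Var → ℕ) (pend : Path → ℕ)
    (ρ : Path) (cpts : List Slice) (t : Triple Γ σ) :
    RowsHold X pend (boxSlices ρ cpts t).cons ↔ RowsHold X (fun l => pend l + closing
      (cpts.flatMap fun sl => List.replicate (X (.box ⟨ρ, sl.addrs⟩)) sl) l) t.cons := by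
  induction cpts generalizing t pend with
  | nil => rfl
  | cons sl cpts ih =>
    rw [boxSlices, ih]
    unfold RowsHold
    simp only [List.mem_map, forall_exists_index, and_imp, forall_apply_eq_imp_iff₂,
      Constraint.holdsWith_sub]
    have : (fun l => pend l + closing
        (cpts.flatMap fun sl => List.replicate (X (.box ⟨ρ, sl.addrs⟩)) sl) l +
          closing (List.replicate (X (.box ⟨ρ, sl.addrs⟩)) sl) l) = fun l => pend l + closing
        ((sl :: cpts).flatMap fun sl => List.replicate (X (.box ⟨ρ, sl.addrs⟩)) sl) l := by
      funext l
      rw [List.flatMap_cons, closing_append]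
      omega
    rw [this]

theorem rowsHold_boxing {n : ℕ} {Γ : Fin n → Ty} {σ : Ty} (X : Var → ℕ) (pend : Path → ℕ)
    (M : Tm Γ σ) (ρ : Path) (cpts : List Slice) (t : Triple Γ σ) :
    RowsHold X pend (boxing M ρ cpts t).cons ↔
      RowsHold X (fun l => pend l + closing (openedWith X M ρ cpts) l) t.cons := by
  unfold boxing openedWith
  split
  · rfl
  · rw [rowsHold_boxSlices]
    simp [closing, List.countP_replicate, Slice.hasRow]

theorem boxSlices_boxes {n : ℕ} {Γ : Fin n → Ty} {σ : Ty} (ρ : Path) (cpts : List Slice)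
    (t : Triple Γ σ) : (boxSlices ρ cpts t).boxes =
      t.boxes ++ cpts.map fun sl => ⟨ρ, sl.addrs⟩ := by
  induction cpts generalizing t with
  | nil => simp [boxSlices]
  | cons sl cpts ih => rw [boxSlices, ih]; simp

theorem boxing_boxes {n : ℕ} {Γ : Fin n → Ty} {σ : Ty} (M : Tm Γ σ) (ρ : Path)
    (cpts : List Slice) (t : Triple Γ σ) : (boxing M ρ cpts t).boxes = t.boxes ++
      if M.isVar then [] else (cpts.map fun sl => ⟨ρ, sl.addrs⟩) ++ [⟨ρ, []⟩] := by
  unfold boxing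
  split
  · simp
  · simp [boxSlices_boxes]

/-! ### Equations for the main function -/

section synth
variable {n : ℕ} {Γ : Fin n → Ty}

/-- The result of the main function, followed by boxing. -/
def boxed {σ : Ty} (M : Tm Γ σ) (ρ : Path) : Triple Γ σ :=
  boxing M ρ (synth M ρ).2 (synth M ρ).1

/-- The boxes opened at the root of `M`. -/
def opened (X : Var → ℕ) {σ : Ty} (M : Tm Γ σ) (ρ : Path) : List Slice :=
  openedWith X M ρ (synth M ρ).2

theorem synth_app {σ τ : Ty} (M : Tm Γ (.arrow σ τ)) (N : Tm Γ σ) (π : Path) :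
    synth (.app M N) π =
      ({ base := fun i => (synth M (π ++ [.fn])).1.base i ++ (boxed N (π ++ [.arg])).base i
         ty := (synth M (π ++ [.fn])).1.ty.cod
         cons := (synth M (π ++ [.fn])).1.cons ++ (boxed N (π ++ [.arg])).cons ++
           (if N.isApp then labelFirst (π ++ [.arg])
              (unify σ [(boxed N (π ++ [.arg])).ty, (synth M (π ++ [.fn])).1.ty.dom])
            else unify σ [(synth M (π ++ [.fn])).1.ty.dom, (boxed N (π ++ [.arg])).ty]) ++
           [.eqZero (if M.isApp then some (π ++ [.fn]) else none)
              (synth M (π ++ [.fn])).1.ty.expo []]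
         boxes := (synth M (π ++ [.fn])).1.boxes ++ (boxed N (π ++ [.arg])).boxes },
       prodUnion ((synth M (π ++ [.fn])).2 ++ newSlice M (π ++ [.fn]))
         ((synth N (π ++ [.arg])).2 ++ newSlice N (π ++ [.arg]))) := by
  rw [synth]; rfl

/-- The case distinction of the main function at an abstraction. -/
def lamCase {σ τ : Ty} (M : Tm (extend σ Γ) τ) (π : Path) (t : Triple (extend σ Γ) τ)
    (cpts : List Slice) : List (Path × GTy σ) → Triple Γ (.arrow σ τ) × List Slice
  | (a, Θ) :: rest =>
      ({ base := fun i => t.base i.succ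
         ty := .arrow [] Θ t.ty
         cons := t.cons ++ contract (Θ :: rest.map Prod.snd)
         boxes := t.boxes },
       cpts.filter fun sl => !(((a, Θ) :: rest).any fun q => sl.hasOcc q.1))
  | [] =>
      if M.isApp then
        ({ base := fun i => t.base i.succ
           ty := .arrow [] (process π σ []) (t.ty.withExpo [.res π])
           cons := t.cons ++ [.eqZero (some (π ++ [.body])) t.ty.expo [.res π]]
           boxes := t.boxes },
         cpts ++ newSlice M (π ++ [.body]))
      else
        ({ base := fun i => t.base i.succ
           ty := .arrow [] (process π σ []) t.ty
           cons := t.cons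
           boxes := t.boxes }, cpts)

theorem synth_lam {σ τ : Ty} (M : Tm (extend σ Γ) τ) (π : Path) : synth (.lam M) π =
    lamCase M π (boxed M (π ++ [.body])) (synth M (π ++ [.body])).2
      ((boxed M (π ++ [.body])).base 0) := by
  rw [synth]; rfl

theorem synth_lam_cons {σ τ : Ty} (M : Tm (extend σ Γ) τ) (π : Path) {a : Path} {Θ : GTy σ}
    {rest : List (Path × GTy σ)} (h : (boxed M (π ++ [.body])).base 0 = (a, Θ) :: rest) :
    synth (.lam M) π =
      ({ base := fun i => (boxed M (π ++ [.body])).base i.succ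
         ty := .arrow [] Θ (boxed M (π ++ [.body])).ty
         cons := (boxed M (π ++ [.body])).cons ++ contract (Θ :: rest.map Prod.snd)
         boxes := (boxed M (π ++ [.body])).boxes },
       (synth M (π ++ [.body])).2.filter fun sl => !(((a, Θ) :: rest).any fun q => sl.hasOcc q.1)) := by
  exact (synth_lam M π).trans (congrArg _ h)

theorem synth_lam_app {σ τ : Ty} (M : Tm (extend σ Γ) τ) (π : Path)
    (h : (boxed M (π ++ [.body])).base 0 = []) (hM : M.isApp = true) :
    synth (.lam M) π =
      ({ base := fun i => (boxed M (π ++ [.body])).base i.succ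
         ty := .arrow [] (process π σ []) ((boxed M (π ++ [.body])).ty.withExpo [.res π])
         cons := (boxed M (π ++ [.body])).cons ++
           [.eqZero (some (π ++ [.body])) (boxed M (π ++ [.body])).ty.expo [.res π]]
         boxes := (boxed M (π ++ [.body])).boxes },
       (synth M (π ++ [.body])).2 ++ newSlice M (π ++ [.body])) := by
  refine (synth_lam M π).trans ((congrArg (lamCase M π _ _) h).trans ?_)
  exact if_pos hM

theorem synth_lam_nil {σ τ : Ty} (M : Tm (extend σ Γ) τ) (π : Path)
    (h : (boxed M (π ++ [.body])).base 0 = []) (hM : M.isApp = false) :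
    synth (.lam M) π =
      ({ base := fun i => (boxed M (π ++ [.body])).base i.succ
         ty := .arrow [] (process π σ []) (boxed M (π ++ [.body])).ty
         cons := (boxed M (π ++ [.body])).cons
         boxes := (boxed M (π ++ [.body])).boxes },
       (synth M (π ++ [.body])).2) := by
  refine (synth_lam M π).trans ((congrArg (lamCase M π _ _) h).trans ?_)
  exact if_neg (by simp [hM])

theorem synth_lam_base {σ τ : Ty} (M : Tm (extend σ Γ) τ) (π : Path) (i : Fin n) :
    (synth (.lam M) π).1.base i = (boxed M (π ++ [.body])).base i.succ := by
  match h : (boxed M (π ++ [.body])).base 0 with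
  | (a, Θ) :: rest => rw [synth_lam_cons M π h]
  | [] =>
    cases hM : M.isApp
    · rw [synth_lam_nil M π h hM]
    · rw [synth_lam_app M π h hM]

theorem synth_lam_boxes {σ τ : Ty} (M : Tm (extend σ Γ) τ) (π : Path) :
    (synth (.lam M) π).1.boxes = (boxed M (π ++ [.body])).boxes := by
  match h : (boxed M (π ++ [.body])).base 0 with
  | (a, Θ) :: rest => rw [synth_lam_cons M π h]
  | [] =>
    cases hM : M.isApp
    · rw [synth_lam_nil M π h hM]
    · rw [synth_lam_app M π h hM]

theorem boxed_base {σ : Ty} (M : Tm Γ σ) (ρ : Path) (i : Fin n) : (boxed M ρ).base i =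
    ((synth M ρ).1.base i).map fun q => (q.1, boxTy M ρ (synth M ρ).2 q.1 q.2) :=
  boxing_base _ _ _ _ _

theorem inst_boxTy_opened (X : Var → ℕ) {σ τ : Ty} (M : Tm Γ σ) (ρ a : Path) (Θ : GTy τ) :
    (boxTy M ρ (synth M ρ).2 a Θ).inst X = ETy.bang^[passing (opened X M ρ) a] (Θ.inst X) :=
  inst_boxTy _ _ _ _ _ _

theorem inst_boxed_ty (X : Var → ℕ) {σ : Ty} (M : Tm Γ σ) (ρ : Path) :
    (boxed M ρ).ty.inst X = ETy.bang^[(opened X M ρ).length] ((synth M ρ).1.ty.inst X) :=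
  inst_boxing_ty _ _ _ _ _

theorem rowsHold_boxed (X : Var → ℕ) (pend : Path → ℕ) {σ : Ty} (M : Tm Γ σ) (ρ : Path) :
    RowsHold X pend (boxed M ρ).cons ↔
      RowsHold X (fun l => pend l + closing (opened X M ρ) l) (synth M ρ).1.cons :=
  rowsHold_boxing _ _ _ _ _ _

/-- The base lists the occurrences of every variable. -/
theorem synth_base_addr {σ : Ty} (M : Tm Γ σ) (π : Path) (i : Fin n) :
    ((synth M π).1.base i).map Prod.fst = (M.toLam.occs i).map (π ++ ·) := by
  induction M generalizing π with
  | var j =>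
    simp only [synth, Tm.toLam, Lam.occs]
    by_cases h : i = j
    · subst h; simp
    · simp [h, Ne.symm h]
  | lam M ih =>
    have h1 : ((boxed M (π ++ [.body])).base i.succ).map Prod.fst =
        (M.toLam.occs i.succ).map ((π ++ [.body]) ++ ·) := by
      rw [boxed_base, List.map_map]
      exact ih (π ++ [.body]) i.succ
    refine (congrArg (List.map Prod.fst) (synth_lam_base M π i)).trans (Eq.trans h1 ?_)
    simp [Tm.toLam, Lam.occs, Function.comp_def]
  | app M N ihM ihN =>
    rw [synth_app]
    simp only [boxed_base, List.map_append, List.map_map, Tm.toLam, Lam.occs]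
    have h1 := ihM (π ++ [.fn]) i
    have h2 := ihN (π ++ [.arg]) i
    congr 1
    · rw [h1]; simp [Function.comp_def]
    · refine Eq.trans ?_ (h2.trans ?_)
      · rfl
      · simp [Function.comp_def]

theorem boxed_base_addr {σ : Ty} (M : Tm Γ σ) (π : Path) (i : Fin n) :
    ((boxed M π).base i).map Prod.fst = (M.toLam.occs i).map (π ++ ·) := by
  rw [← synth_base_addr, boxed_base, List.map_map]; rfl

theorem boxed_base_eq_nil {σ : Ty} (M : Tm Γ σ) (π : Path) (i : Fin n) :
    (boxed M π).base i = [] ↔ M.toLam.occs i = [] := by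
  rw [← List.map_eq_nil_iff (f := Prod.fst), boxed_base_addr, List.map_eq_nil_iff]

theorem mem_fvo {σ : Ty} (M : Tm Γ σ) (π a : Path) :
    a ∈ (M.fvo π).map Prod.snd ↔ ∃ i, ∃ b ∈ M.toLam.occs i, a = π ++ b := by
  have key : ∀ (i : Fin n), (i, a) ∈ M.fvo π ↔ ∃ b ∈ M.toLam.occs i, a = π ++ b := by
    induction M generalizing π with
    | var j =>
      intro i
      simp only [Tm.fvo, Tm.toLam, Lam.occs, List.mem_singleton, Prod.mk.injEq]
      by_cases h : j = i
      · subst h; simp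
      · simp [h, Ne.symm h]
    | lam M ih =>
      intro i
      simp only [Tm.fvo, Tm.toLam, Lam.occs, List.mem_filterMap, List.mem_map]
      constructor
      · rintro ⟨⟨j, b⟩, hj, h⟩
        revert hj h
        refine Fin.cases (fun _ h => by simp at h) (fun j hj h => ?_) j
        simp only [Fin.cases_succ, Option.some.injEq, Prod.mk.injEq] at h
        obtain ⟨rfl, rfl⟩ := h
        obtain ⟨c, hc, rfl⟩ := (ih (π ++ [.body]) j.succ).1 hj
        exact ⟨_, ⟨c, hc, rfl⟩, by simp⟩
      · rintro ⟨_, ⟨c, hc, rfl⟩, rfl⟩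
        exact ⟨(i.succ, _), (ih (π ++ [.body]) i.succ).2 ⟨c, hc, by simp⟩, by simp⟩
    | app M N ihM ihN =>
      intro i
      simp only [Tm.fvo, Tm.toLam, Lam.occs, List.mem_append, List.mem_map, ihM, ihN]
      constructor
      · rintro (⟨b, hb, rfl⟩ | ⟨b, hb, rfl⟩)
        · exact ⟨_, Or.inl ⟨b, hb, rfl⟩, by simp⟩
        · exact ⟨_, Or.inr ⟨b, hb, rfl⟩, by simp⟩
      · rintro ⟨_, ⟨b, hb, rfl⟩ | ⟨b, hb, rfl⟩, rfl⟩
        · exact Or.inl ⟨b, hb, by simp⟩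
        · exact Or.inr ⟨b, hb, by simp⟩
  simp only [List.mem_map, Prod.exists, exists_eq_right, key]

/-! ### Solutions, node by node -/

/-- The rows of an application, read as equations of types. The function part may close boxes but is
not boxed itself; the argument may do both, whence the modalities on both sides of its equation. -/
theorem rowsHold_app (X : Var → ℕ) (pend : Path → ℕ) {σ τ : Ty} (M : Tm Γ (.arrow σ τ))
    (N : Tm Γ σ) (π : Path) : RowsHold X pend (synth (.app M N) π).1.cons ↔
      RowsHold X pend (synth M (π ++ [.fn])).1.cons ∧
      RowsHold X (fun l => pend l + closing (opened X N (π ++ [.arg])) l)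
        (synth N (π ++ [.arg])).1.cons ∧
      (synth M (π ++ [.fn])).1.ty.inst X = ETy.bang^[if M.isApp then pend (π ++ [.fn]) else 0]
        (.lolli ((synth M (π ++ [.fn])).1.ty.dom.inst X)
          ((synth M (π ++ [.fn])).1.ty.cod.inst X)) ∧
      ETy.bang^[(opened X N (π ++ [.arg])).length] ((synth N (π ++ [.arg])).1.ty.inst X) =
        ETy.bang^[if N.isApp then pend (π ++ [.arg]) else 0]
          ((synth M (π ++ [.fn])).1.ty.dom.inst X) := by
  rw [synth_app]
  simp only [rowsHold_append, rowsHold_boxed, rowsHold_cons, rowsHold_nil, and_true]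
  have h1 : RowsHold X pend (if N.isApp then labelFirst (π ++ [.arg])
      (unify σ [(boxed N (π ++ [.arg])).ty, (synth M (π ++ [.fn])).1.ty.dom])
      else unify σ [(synth M (π ++ [.fn])).1.ty.dom, (boxed N (π ++ [.arg])).ty]) ↔
      ETy.bang^[(opened X N (π ++ [.arg])).length] ((synth N (π ++ [.arg])).1.ty.inst X) =
        ETy.bang^[if N.isApp then pend (π ++ [.arg]) else 0]
          ((synth M (π ++ [.fn])).1.ty.dom.inst X) := by
    split
    · rw [rowsHold_labelFirst, inst_boxed_ty]
    · rw [rowsHold_unify_pair, inst_boxed_ty]; exact eq_comm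
  have h2 : Constraint.HoldsWith X pend (.eqZero (if M.isApp then some (π ++ [.fn]) else none)
      (synth M (π ++ [.fn])).1.ty.expo []) ↔ (synth M (π ++ [.fn])).1.ty.inst X =
        ETy.bang^[if M.isApp then pend (π ++ [.fn]) else 0]
        (.lolli ((synth M (π ++ [.fn])).1.ty.dom.inst X)
          ((synth M (π ++ [.fn])).1.ty.cod.inst X)) := by
    rw [GTy.inst_arrow, Constraint.HoldsWith]
    have : (if M.isApp then some (π ++ [.fn]) else none : Option Path).elim 0 pend =
        if M.isApp then pend (π ++ [.fn]) else 0 := by split <;> rfl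
    rw [this]
    simp only [Expo.val, List.map_nil, List.sum_nil, zero_add]
    exact ⟨fun h => by rw [h], fun h => (ETy.bang_iterate_lolli h).1⟩
  rw [h1, h2]
  tauto

theorem rowsHold_lam_cons (X : Var → ℕ) (pend : Path → ℕ) {σ τ : Ty} (M : Tm (extend σ Γ) τ)
    (π : Path) {a : Path} {Θ : GTy σ} {rest : List (Path × GTy σ)}
    (h : (boxed M (π ++ [.body])).base 0 = (a, Θ) :: rest) :
    RowsHold X pend (synth (.lam M) π).1.cons ↔
      RowsHold X (fun l => pend l + closing (opened X M (π ++ [.body])) l)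
        (synth M (π ++ [.body])).1.cons ∧
      (∀ q ∈ (boxed M (π ++ [.body])).base 0, q.2.inst X = Θ.inst X) ∧
      (2 ≤ (M.toLam.occs 0).length → ∃ A, Θ.inst X = .bang A) := by
  have hlen : (M.toLam.occs 0).length = (Θ :: rest.map Prod.snd).length := by
    have h1 := congrArg List.length (boxed_base_addr M (π ++ [.body]) 0)
    have h2 := congrArg List.length h
    rw [List.length_map, List.length_map] at h1
    rw [List.length_cons, List.length_map, ← h1, h2]
    rfl
  rw [synth_lam_cons M π h, rowsHold_append, rowsHold_boxed, rowsHold_contract, hlen]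
  refine and_congr_right fun _ => ?_
  have hmap : Θ :: rest.map Prod.snd = ((boxed M (π ++ [.body])).base 0).map Prod.snd := by
    rw [h]; rfl
  constructor
  · rintro ⟨h1, h2⟩
    refine ⟨fun q hq => h1 _ ?_ _ (by simp), fun h3 => h2 h3 _ (by simp)⟩
    rw [hmap]
    exact List.mem_map_of_mem hq
  · rintro ⟨h1, h2⟩
    have h3 : ∀ Θ' ∈ Θ :: rest.map Prod.snd, Θ'.inst X = Θ.inst X := by
      rw [hmap]
      intro Θ' hΘ'
      obtain ⟨q, hq, rfl⟩ := List.mem_map.1 hΘ'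
      exact h1 q hq
    exact ⟨fun Θ' h' Θ'' h'' => (h3 _ h').trans (h3 _ h'').symm,
      fun h4 Θ' h' => by rw [h3 _ h']; exact h2 h4⟩

theorem rowsHold_lam_app (X : Var → ℕ) (pend : Path → ℕ) {σ τ : Ty} (M : Tm (extend σ Γ) τ)
    (π : Path) (h : (boxed M (π ++ [.body])).base 0 = []) (hM : M.isApp = true) :
    RowsHold X pend (synth (.lam M) π).1.cons ↔
      RowsHold X (fun l => pend l + closing (opened X M (π ++ [.body])) l)
        (synth M (π ++ [.body])).1.cons ∧
      ETy.bang^[(opened X M (π ++ [.body])).length] ((synth M (π ++ [.body])).1.ty.inst X) =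
        ETy.bang^[pend (π ++ [.body])]
          (((boxed M (π ++ [.body])).ty.withExpo [.res π]).inst X) := by
  rw [synth_lam_app M π h hM, rowsHold_append, rowsHold_boxed, rowsHold_cons, ← inst_boxed_ty,
    GTy.inst_withExpo, GTy.inst_eq X (boxed M _).ty, ← ETy.bang_iterate_add, GTy.bang_inst_eq_iff]
  simp only [rowsHold_nil, and_true, Constraint.HoldsWith, Option.elim_some]
  refine and_congr_right fun _ => ?_
  rw [add_comm (Expo.val X [Var.res π])]

theorem rowsHold_lam_nil (X : Var → ℕ) (pend : Path → ℕ) {σ τ : Ty} (M : Tm (extend σ Γ) τ)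
    (π : Path) (h : (boxed M (π ++ [.body])).base 0 = []) (hM : M.isApp = false) :
    RowsHold X pend (synth (.lam M) π).1.cons ↔
      RowsHold X (fun l => pend l + closing (opened X M (π ++ [.body])) l)
        (synth M (π ++ [.body])).1.cons := by
  rw [synth_lam_nil M π h hM, rowsHold_boxed]

end synth

/-! ### Slices -/

section slices
variable {n : ℕ} {Γ : Fin n → Ty}

theorem prodUnion_eq (S T : List Slice) :
    prodUnion S T = S.flatMap (fun s => s :: T.map (s ++ ·)) ++ T := by
  induction S with
  | nil => simp [prodUnion]
  | cons s S ih =>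
    cases T with
    | nil => simp [prodUnion]
    | cons t T => rw [prodUnion, ih]; simp; simp

/-- With the empty slice adjoined everywhere, the product union becomes the set of all
concatenations. The empty slice also stands for the boxes around the whole subterm. -/
theorem mem_prodUnion {S T : List Slice} {sl : Slice} :
    sl ∈ prodUnion S T ++ [[]] ↔ ∃ s ∈ S ++ [[]], ∃ t ∈ T ++ [[]], sl = s ++ t := by
  rw [prodUnion_eq]
  simp only [List.mem_append, List.mem_flatMap, List.mem_cons, List.mem_map, List.not_mem_nil,
    or_false]
  constructor
  · rintro ((⟨s, hs, rfl | ⟨t, ht, rfl⟩⟩ | h) | rfl)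
    · exact ⟨sl, Or.inl hs, [], Or.inr rfl, by simp⟩
    · exact ⟨s, Or.inl hs, t, Or.inl ht, rfl⟩
    · exact ⟨[], Or.inr rfl, sl, Or.inl h, rfl⟩
    · exact ⟨[], Or.inr rfl, [], Or.inr rfl, rfl⟩
  · rintro ⟨s, hs | rfl, t, ht | rfl, rfl⟩
    · exact Or.inl (Or.inl ⟨s, hs, Or.inr ⟨t, ht, rfl⟩⟩)
    · exact Or.inl (Or.inl ⟨s, hs, Or.inl (by simp)⟩)
    · exact Or.inl (Or.inr ht)
    · exact Or.inr rfl

/-- The slices of the subterm `M` at `ρ`, as seen from its parent. -/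
def outerSlices {σ : Ty} (M : Tm Γ σ) (ρ : Path) : List Slice :=
  (synth M ρ).2 ++ newSlice M ρ

theorem synth_app_slices {σ τ : Ty} (M : Tm Γ (.arrow σ τ)) (N : Tm Γ σ) (π : Path) :
    (synth (.app M N) π).2 = prodUnion (outerSlices M (π ++ [.fn])) (outerSlices N (π ++ [.arg])) := by
  rw [synth_app]; rfl

/-- The bound variable occurs in no slice of an abstraction. -/
theorem mem_synth_lam {σ τ : Ty} (M : Tm (extend σ Γ) τ) (π : Path) {sl : Slice} :
    sl ∈ (synth (.lam M) π).2 ↔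
      sl ∈ outerSlices M (π ++ [.body]) ∧
        ∀ a ∈ M.toLam.occs 0, sl.hasOcc (π ++ [.body] ++ a) = false := by
  obtain ⟨xs, h⟩ : ∃ xs : List (Path × GTy σ), (boxed M (π ++ [.body])).base 0 = xs := ⟨_, rfl⟩
  match xs, h with
  | (a, Θ) :: rest, h =>
    have h1 : ((a, Θ) :: rest).map Prod.fst = (M.toLam.occs 0).map (π ++ [.body] ++ ·) := by
      have hb := boxed_base_addr M (π ++ [.body]) 0
      exact Eq.trans (congrArg (List.map Prod.fst) h.symm) hb
    have h2 : (((a, Θ) :: rest).any fun q => sl.hasOcc q.1) =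
        (M.toLam.occs 0).any fun b => sl.hasOcc (π ++ [.body] ++ b) := by
      have h3 := congrArg (fun l : List Path => l.any sl.hasOcc) h1
      rw [List.any_map, List.any_map] at h3
      exact h3
    rw [synth_lam_cons M π h, List.mem_filter, h2]
    simp only [Bool.not_eq_true', List.any_eq_false, Bool.not_eq_true, outerSlices,
      List.mem_append]
    refine ⟨fun h => ⟨Or.inl h.1, h.2⟩, fun h' => ⟨h'.1.resolve_right fun h3 => ?_, h'.2⟩⟩
    -- The new slice lists all free occurrences of the body, in particular this one of the bound
    -- variable; it is thus excluded by the second condition.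
    obtain ⟨b, hb⟩ : ∃ b, b ∈ M.toLam.occs 0 := by
      refine List.exists_mem_of_ne_nil _ fun h0 => ?_
      rw [h0] at h1
      cases h1
    have h4 := h'.2 b hb
    unfold newSlice at h3
    split at h3
    · rw [List.mem_singleton] at h3
      subst h3
      have h5 := (mem_fvo M (π ++ [.body]) (π ++ [.body] ++ b)).2 ⟨0, b, hb, rfl⟩
      simp only [Slice.hasOcc, List.any_cons, List.any_nil, Bool.or_false,
        List.contains_eq_mem, decide_eq_false_iff_not] at h4
      exact h4 h5
    · simp at h3
  | [], h =>
    have h0 := (boxed_base_eq_nil M (π ++ [.body]) 0).1 h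
    cases hM : M.isApp
    · rw [synth_lam_nil M π h hM]
      simp [outerSlices, newSlice, hM, h0]
    · rw [synth_lam_app M π h hM]
      simp [outerSlices, h0]

theorem synth_lam_slices_sublist {σ τ : Ty} (M : Tm (extend σ Γ) τ) (π : Path) :
    (synth (.lam M) π).2.Sublist (outerSlices M (π ++ [.body])) := by
  match h : (boxed M (π ++ [.body])).base 0 with
  | (a, Θ) :: rest =>
    rw [synth_lam_cons M π h]
    exact List.filter_sublist.trans (List.sublist_append_left _ _)
  | [] =>
    cases hM : M.isApp
    · rw [synth_lam_nil M π h hM]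
      exact List.sublist_append_left _ _
    · rw [synth_lam_app M π h hM]
      exact List.Sublist.refl _

/-- A slice of a subterm refers to addresses in this subterm. -/
def Slice.Under (ρ : Path) (sl : Slice) : Prop :=
  ∀ c ∈ sl, ρ <+: c.row ∧ ∀ a ∈ c.occ, ρ <+: a

theorem newSlice_under {σ : Ty} (M : Tm Γ σ) (ρ : Path) {sl : Slice} (h : sl ∈ newSlice M ρ) :
    sl.Under ρ := by
  unfold newSlice at h
  split at h
  · rw [List.mem_singleton] at h
    subst h
    intro c hc
    rw [List.mem_singleton] at hc
    subst hc
    refine ⟨List.prefix_rfl, fun a ha => ?_⟩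
    obtain ⟨i, b, -, rfl⟩ := (mem_fvo M ρ a).1 ha
    exact List.prefix_append _ _
  · simp at h

theorem Slice.Under.mono {ρ ρ' : Path} {sl : Slice} (h : sl.Under ρ) (hρ : ρ' <+: ρ) :
    sl.Under ρ' := fun c hc =>
  ⟨hρ.trans (h c hc).1, fun a ha => hρ.trans ((h c hc).2 a ha)⟩

theorem outerSlices_under_of {σ : Ty} {M : Tm Γ σ} {ρ : Path}
    (ih : ∀ sl ∈ (synth M ρ).2, sl.Under ρ ∧ sl ≠ [] ∧ ∀ c ∈ sl, c.row ≠ ρ) {sl : Slice}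
    (h : sl ∈ outerSlices M ρ) : sl.Under ρ ∧ sl ≠ [] := by
  rcases List.mem_append.1 h with h | h
  · exact ⟨(ih sl h).1, (ih sl h).2.1⟩
  · refine ⟨newSlice_under M ρ h, ?_⟩
    unfold newSlice at h
    split at h
    · rw [List.mem_singleton] at h
      subst h
      simp
    · simp at h

theorem Slice.Under.row_ne {π : Path} {δ : Dir} {sl : Slice} (h : sl.Under (π ++ [δ])) :
    ∀ c ∈ sl, c.row ≠ π := by
  intro c hc he
  have := (h c hc).1.length_le
  rw [he] at this
  simp at this

theorem synth_slices_under {σ : Ty} (M : Tm Γ σ) (π : Path) :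
    ∀ sl ∈ (synth M π).2, sl.Under π ∧ sl ≠ [] ∧ ∀ c ∈ sl, c.row ≠ π := by
  induction M generalizing π with
  | var i => simp [synth]
  | lam M ih =>
    intro sl hsl
    obtain ⟨h1, h2⟩ := outerSlices_under_of (ih (π ++ [.body])) ((mem_synth_lam M π).1 hsl).1
    exact ⟨h1.mono (List.prefix_append _ _), h2, h1.row_ne⟩
  | app M N ihM ihN =>
    intro sl hsl
    rw [synth_app_slices, prodUnion_eq] at hsl
    simp only [List.mem_append, List.mem_flatMap, List.mem_cons, List.mem_map] at hsl
    have hM := fun s => outerSlices_under_of (sl := s) (ihM (π ++ [.fn]))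
    have hN := fun s => outerSlices_under_of (sl := s) (ihN (π ++ [.arg]))
    have p1 : π <+: π ++ [Dir.fn] := List.prefix_append _ _
    have p2 : π <+: π ++ [Dir.arg] := List.prefix_append _ _
    rcases hsl with ⟨s, hs, rfl | ⟨t, ht, rfl⟩⟩ | h
    · exact ⟨(hM sl hs).1.mono p1, (hM sl hs).2, (hM sl hs).1.row_ne⟩
    · refine ⟨fun c hc => ?_, by simp [(hM s hs).2], fun c hc => ?_⟩
      · rcases List.mem_append.1 hc with hc | hc
        · exact (hM s hs).1.mono p1 c hc
        · exact (hN t ht).1.mono p2 c hc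
      · rcases List.mem_append.1 hc with hc | hc
        · exact (hM s hs).1.row_ne c hc
        · exact (hN t ht).1.row_ne c hc
    · exact ⟨(hN sl h).1.mono p2, (hN sl h).2, (hN sl h).1.row_ne⟩

theorem outerSlices_under {σ : Ty} (M : Tm Γ σ) (ρ : Path) {sl : Slice}
    (h : sl ∈ outerSlices M ρ) : sl.Under ρ ∧ sl ≠ [] :=
  outerSlices_under_of (synth_slices_under M ρ) h

theorem outerSlices_under' {σ : Ty} (M : Tm Γ σ) (ρ : Path) {sl : Slice}
    (h : sl ∈ outerSlices M ρ ++ [[]]) : sl.Under ρ := by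
  rcases List.mem_append.1 h with h | h
  · exact (outerSlices_under M ρ h).1
  · rw [List.mem_singleton] at h
    subst h
    simp [Slice.Under]

theorem not_prefix_fn_arg (π q r : Path) : π ++ [Dir.fn] ++ q ≠ π ++ [Dir.arg] ++ r := by
  simp

/-- The predicate `p` tells the letters of `S` from those of `T`. Filtering by `p` recovers the
first component of a concatenation, and no component is empty. -/
theorem nodup_prod {α : Type} (p : α → Bool) (S T : List (List α))
    (hS : ∀ s ∈ S, s ≠ [] ∧ ∀ x ∈ s, p x = true) (hT : ∀ t ∈ T, t ≠ [] ∧ ∀ x ∈ t, p x = false)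
    (nS : S.Nodup) (nT : T.Nodup) :
    (S.flatMap (fun s => s :: T.map (s ++ ·)) ++ T).Nodup := by
  have fT : ∀ t ∈ T, t.filter p = [] := fun t ht =>
    List.filter_eq_nil_iff.2 fun x hx => by simp [(hT t ht).2 x hx]
  have fS : ∀ s ∈ S, s.filter p = s := fun s hs => List.filter_eq_self.2 (hS s hs).2
  induction S with
  | nil => simpa using nT
  | cons s S ih =>
    rw [List.nodup_cons] at nS
    have hs := fS s (by simp)
    have hne := (hS s (by simp)).1
    rw [List.flatMap_cons, List.append_assoc, List.nodup_append]
    refine ⟨?_, ih (fun s hs => hS s (List.mem_cons_of_mem _ hs)) nS.2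
      (fun s hs => fS s (List.mem_cons_of_mem _ hs)), ?_⟩
    · rw [List.nodup_cons]
      refine ⟨fun h => ?_, nT.map fun _ _ => List.append_cancel_left⟩
      obtain ⟨t, ht, h⟩ := List.mem_map.1 h
      exact (hT t ht).1 (List.append_right_eq_self.1 h)
    · intro x hx y hy hxy
      have h1 : x.filter p = s := by
        rcases List.mem_cons.1 hx with rfl | hx
        · exact hs
        · obtain ⟨t, ht, rfl⟩ := List.mem_map.1 hx
          rw [List.filter_append, hs, fT t ht, List.append_nil]
      rcases List.mem_append.1 hy with hy | hy
      · obtain ⟨s', hs', hy⟩ := List.mem_flatMap.1 hy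
        have h2 : y.filter p = s' := by
          rcases List.mem_cons.1 hy with rfl | hy
          · exact fS _ (List.mem_cons_of_mem _ hs')
          · obtain ⟨t, ht, rfl⟩ := List.mem_map.1 hy
            rw [List.filter_append, fS _ (List.mem_cons_of_mem _ hs'), fT t ht, List.append_nil]
        rw [hxy, h2] at h1
        exact nS.1 (h1 ▸ hs')
      · rw [hxy, fT y hy] at h1
        exact hne h1.symm

/-- The slices of a subterm are determined by the addresses of their critical points. -/
theorem nodup_addrs {σ : Ty} (M : Tm Γ σ) (π : Path) :
    ((synth M π).2.map Slice.addrs).Nodup := by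
  have outer : ∀ {m : ℕ} {Γ : Fin m → Ty} {σ : Ty} (M : Tm Γ σ) (ρ : Path),
      ((synth M ρ).2.map Slice.addrs).Nodup → ((outerSlices M ρ).map Slice.addrs).Nodup := by
    intro m Γ σ M ρ h
    unfold outerSlices newSlice
    split
    · rw [List.map_append, List.nodup_append]
      refine ⟨h, by simp, ?_⟩
      intro x hx y hy
      simp only [List.map_cons, List.map_nil, List.mem_singleton] at hy
      obtain ⟨sl, hsl, rfl⟩ := List.mem_map.1 hx
      rintro rfl
      have h1 : ρ ∈ sl.addrs := by rw [hy]; simp [Slice.addrs]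
      obtain ⟨c, hc, he⟩ := List.mem_map.1 h1
      exact (synth_slices_under M ρ sl hsl).2.2 c hc he
    · simpa using h
  induction M generalizing π with
  | var i => simp [synth]
  | lam M ih =>
    exact ((synth_lam_slices_sublist M π).map _).nodup (outer M _ (ih _))
  | app M N ihM ihN =>
    have hM := outer M _ (ihM (π ++ [.fn]))
    have hN := outer N _ (ihN (π ++ [.arg]))
    have uM := fun s => outerSlices_under (sl := s) M (π ++ [.fn])
    have uN := fun s => outerSlices_under (sl := s) N (π ++ [.arg])
    rw [synth_app_slices, prodUnion_eq]
    have := nodup_prod (fun x => decide (π ++ [Dir.fn] <+: x)) _ _ ?_ ?_ hM hN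
    · convert this using 1
      simp [List.map_flatMap, List.flatMap_map, Slice.addrs, Function.comp_def]
    · intro s hs
      obtain ⟨s, hs', rfl⟩ := List.mem_map.1 hs
      refine ⟨by simpa [Slice.addrs] using (uM s hs').2, fun x hx => ?_⟩
      obtain ⟨c, hc, rfl⟩ := List.mem_map.1 hx
      exact decide_eq_true ((uM s hs').1 c hc).1
    · intro s hs
      obtain ⟨s, hs', rfl⟩ := List.mem_map.1 hs
      refine ⟨by simpa [Slice.addrs] using (uN s hs').2, fun x hx => ?_⟩
      obtain ⟨c, hc, rfl⟩ := List.mem_map.1 hx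
      refine decide_eq_false fun h => ?_
      obtain ⟨q, hq⟩ := h
      obtain ⟨r, hr⟩ := ((uN s hs').1 c hc).1
      exact not_prefix_fn_arg π q r (hq.trans hr.symm)

end slices

/-! ### Open boxes on the way through a term -/

/-- There are `w` boxes open at the root of the subterm `M` at `π`; of these, `pend ρ` are closed
at the node `ρ` and `out i a` are still open at the occurrence `a` of the variable `i`. Only
applications can be left out of a box, and only if no variable that is bound inside the box is
free in them. -/
def Coherent : {n : ℕ} → {Γ : Fin n → Ty} → {σ : Ty} → Tm Γ σ → Path → ℕ → (Path → ℕ) →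
    (Fin n → Path → ℕ) → Prop
  | _, _Γ, _, .var i, π, w, _, out => out i π = w
  | _, _, _, .lam M, π, w, pend, out =>
      (pend (π ++ [.body]) ≠ 0 → M.isApp = true ∧ M.toLam.occs 0 = []) ∧
      ∃ w', w = w' + pend (π ++ [.body]) ∧
        Coherent M (π ++ [.body]) w' pend (extend (fun _ => w) out)
  | _, _, _, .app M N, π, w, pend, out =>
      ((pend (π ++ [.fn]) ≠ 0 → M.isApp = true) ∧
        ∃ w', w = w' + pend (π ++ [.fn]) ∧ Coherent M (π ++ [.fn]) w' pend out) ∧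
      (pend (π ++ [.arg]) ≠ 0 → N.isApp = true) ∧
        ∃ w', w = w' + pend (π ++ [.arg]) ∧ Coherent N (π ++ [.arg]) w' pend out

section coherent
variable {n : ℕ} {Γ : Fin n → Ty}

/-- Only nodes strictly below `π` and actual occurrences matter: boxes closed at `π` itself are
accounted for by the parent. -/
theorem Coherent.congr {σ : Ty} {M : Tm Γ σ} {π : Path} {w : ℕ} {pend pend' : Path → ℕ}
    {out out' : Fin n → Path → ℕ} (h : Coherent M π w pend out)
    (hp : ∀ q, q ≠ [] → pend (π ++ q) = pend' (π ++ q))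
    (ho : ∀ i, ∀ a ∈ M.toLam.occs i, out i (π ++ a) = out' i (π ++ a)) :
    Coherent M π w pend' out' := by
  induction M generalizing π w with
  | var i =>
    have := ho i [] (by simp [Tm.toLam, Lam.occs])
    rw [List.append_nil] at this
    exact this.symm.trans h
  | lam M ih =>
    obtain ⟨h1, w', h2, h3⟩ := h
    have hb := hp [.body] (by simp)
    rw [hb] at h1 h2
    refine ⟨h1, w', h2, ih h3 (fun q _ => ?_) fun i => ?_⟩
    · rw [List.append_assoc]; exact hp _ (by simp)
    · refine Fin.cases (fun _ _ => rfl) (fun i a ha => ?_) i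
      have := ho i (.body :: a) (List.mem_map_of_mem ha)
      simpa using this
  | app M N ihM ihN =>
    obtain ⟨⟨h1, w', h2, h3⟩, h1', w'', h2', h3'⟩ := h
    rw [hp [.fn] (by simp)] at h1 h2
    rw [hp [.arg] (by simp)] at h1' h2'
    refine ⟨⟨h1, w', h2, ihM h3 (fun q _ => ?_) fun i a ha => ?_⟩,
      h1', w'', h2', ihN h3' (fun q _ => ?_) fun i a ha => ?_⟩
    · rw [List.append_assoc]; exact hp _ (by simp)
    · have := ho i (.fn :: a) (List.mem_append_left _ (List.mem_map_of_mem ha))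
      simpa using this
    · rw [List.append_assoc]; exact hp _ (by simp)
    · have := ho i (.arg :: a) (List.mem_append_right _ (List.mem_map_of_mem ha))
      simpa using this

/-- All conditions are additive in the numbers of boxes. It therefore suffices to follow one box
along one slice. -/
theorem Coherent.add {σ : Ty} {M : Tm Γ σ} {π : Path} {w₁ w₂ : ℕ} {pend₁ pend₂ : Path → ℕ}
    {out₁ out₂ : Fin n → Path → ℕ} (h₁ : Coherent M π w₁ pend₁ out₁)
    (h₂ : Coherent M π w₂ pend₂ out₂) :
    Coherent M π (w₁ + w₂) (fun l => pend₁ l + pend₂ l) fun i a => out₁ i a + out₂ i a := by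
  induction M generalizing π w₁ w₂ with
  | var i =>
    simp only [Coherent] at *
    omega
  | lam M ih =>
    obtain ⟨h1, w', h2, h3⟩ := h₁
    obtain ⟨h1', w'', h2', h3'⟩ := h₂
    refine ⟨fun h => ?_, w' + w'', by beta_reduce; omega, ?_⟩
    · by_cases h0 : pend₁ (π ++ [.body]) = 0
      · exact h1' fun h0' => h (by simp [h0, h0'])
      · exact h1 h0
    · convert ih h3 h3' using 1
      funext i
      exact Fin.cases rfl (fun _ => rfl) i
  | app M N ihM ihN =>
    obtain ⟨⟨h1, w', h2, h3⟩, k1, v', k2, k3⟩ := h₁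
    obtain ⟨⟨h1', w'', h2', h3'⟩, k1', v'', k2', k3'⟩ := h₂
    refine ⟨⟨fun h => ?_, w' + w'', by beta_reduce; omega, ihM h3 h3'⟩, fun h => ?_, v' + v'', by beta_reduce; omega,
      ihN k3 k3'⟩
    · by_cases h0 : pend₁ (π ++ [.fn]) = 0
      · exact h1' fun h0' => h (by simp [h0, h0'])
      · exact h1 h0
    · by_cases h0 : pend₁ (π ++ [.arg]) = 0
      · exact k1' fun h0' => h (by simp [h0, h0'])
      · exact k1 h0

/-- Boxes that are never closed. -/
theorem Coherent.const {σ : Ty} (M : Tm Γ σ) (π : Path) (w : ℕ) :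
    Coherent M π w (fun _ => 0) fun _ _ => w := by
  induction M generalizing π with
  | var i => rfl
  | lam M ih =>
    refine ⟨fun h => absurd rfl h, w, rfl, (ih _).congr (fun _ _ => rfl) fun i a _ => ?_⟩
    exact Fin.cases rfl (fun _ => rfl) i
  | app M N ihM ihN =>
    exact ⟨⟨fun h => absurd rfl h, w, rfl, ihM _⟩, fun h => absurd rfl h, w, rfl, ihN _⟩

theorem Coherent.out_le {σ : Ty} {M : Tm Γ σ} {π : Path} {w : ℕ} {pend : Path → ℕ}
    {out : Fin n → Path → ℕ} (h : Coherent M π w pend out) (i : Fin n) {a : Path}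
    (ha : a ∈ M.toLam.occs i) : out i (π ++ a) ≤ w := by
  induction M generalizing π w a with
  | var j =>
    simp only [Tm.toLam, Lam.occs] at ha
    split at ha
    · rename_i hj
      subst hj
      rw [List.mem_singleton] at ha
      subst ha
      rw [List.append_nil]
      exact le_of_eq h
    · simp at ha
  | lam M ih =>
    obtain ⟨h1, w', h2, h3⟩ := h
    obtain ⟨a, ha', rfl⟩ := List.mem_map.1 ha
    have := ih h3 i.succ ha'
    simp only [List.append_assoc, extend, Fin.cons_succ, List.cons_append, List.nil_append] at this
    omega
  | app M N ihM ihN =>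
    obtain ⟨⟨h1, w', h2, h3⟩, h1', w'', h2', h3'⟩ := h
    rcases List.mem_append.1 ha with ha | ha <;> obtain ⟨a, ha', rfl⟩ := List.mem_map.1 ha
    · have := ihM h3 i ha'
      simp only [List.append_assoc, List.cons_append, List.nil_append] at this
      omega
    · have := ihN h3' i ha'
      simp only [List.append_assoc, List.cons_append, List.nil_append] at this
      omega

theorem Slice.Under.hasRow_eq_false {ρ ρ' : Path} {sl : Slice} (h : sl.Under ρ)
    (hρ : ¬ ρ <+: ρ') : sl.hasRow (some ρ') = false := by
  rw [Slice.hasRow, List.any_eq_false]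
  intro c hc h1
  have h1 : ρ' = c.row := by simpa using h1
  exact hρ (h1 ▸ (h c hc).1)

theorem Slice.Under.hasOcc_eq_false {ρ a : Path} {sl : Slice} (h : sl.Under ρ)
    (hρ : ¬ ρ <+: a) : sl.hasOcc a = false := by
  rw [Slice.hasOcc, List.any_eq_false]
  intro c hc h1
  have h1 : a ∈ c.occ := by simpa using h1
  exact hρ ((h c hc).2 a h1)

theorem Slice.hasRow_append (s t : Slice) (l : Option Path) :
    Slice.hasRow (s ++ t) l = (s.hasRow l || t.hasRow l) := List.any_append

theorem Slice.hasOcc_append (s t : Slice) (a : Path) :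
    Slice.hasOcc (s ++ t) a = (s.hasOcc a || t.hasOcc a) := List.any_append

/-- One box, drawn along a slice. -/
def SliceCoherent {σ : Ty} (M : Tm Γ σ) (π : Path) (w : ℕ) (sl : Slice) : Prop :=
  Coherent M π w (fun l => if sl.hasRow (some l) then 1 else 0)
    fun _ a => if sl.hasOcc a then 0 else 1

theorem sliceCoherent_nil {σ : Ty} (M : Tm Γ σ) (π : Path) : SliceCoherent M π 1 [] :=
  Coherent.const M π 1

/-- A box along the new slice is closed at `ρ` at once and leaves out all of its occurrences; along
an older slice it passes through `ρ`. -/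
theorem outer_coherent {σ : Ty} {M : Tm Γ σ} {ρ : Path}
    (ih : ∀ sl ∈ (synth M ρ).2, SliceCoherent M ρ 1 sl) {sl : Slice}
    (h : sl ∈ outerSlices M ρ ++ [[]]) : ((if sl.hasRow (some ρ) then 1 else 0) ≠ 0 → M.isApp = true) ∧
      ∃ w', 1 = w' + (if sl.hasRow (some ρ) then 1 else 0) ∧ SliceCoherent M ρ w' sl := by
  have key : SliceCoherent M ρ 1 sl → sl.hasRow (some ρ) = false →
      ((if sl.hasRow (some ρ) then 1 else 0) ≠ 0 → M.isApp = true) ∧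
      ∃ w', 1 = w' + (if sl.hasRow (some ρ) then 1 else 0) ∧ SliceCoherent M ρ w' sl := by
    intro h1 h2
    simp only [h2]
    exact ⟨fun h => absurd rfl h, 1, rfl, h1⟩
  rcases List.mem_append.1 h with h | h
  · rcases List.mem_append.1 h with h | h
    · refine key (ih sl h) ?_
      rw [Slice.hasRow, List.any_eq_false]
      intro c hc h1
      exact (synth_slices_under M ρ sl h).2.2 c hc (by simpa using Eq.symm (by simpa using h1))
    · unfold newSlice at h
      split at h
      · rename_i hM
        rw [List.mem_singleton] at h
        subst h
        have h1 : Slice.hasRow [⟨ρ, (M.fvo ρ).map Prod.snd⟩] (some ρ) = true := by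
          simp [Slice.hasRow]
        simp only [h1]
        refine ⟨fun _ => hM, 0, rfl, (Coherent.const M ρ 0).congr (fun q hq => ?_) fun i a ha => ?_⟩
        · have : Slice.hasRow [⟨ρ, (M.fvo ρ).map Prod.snd⟩] (some (ρ ++ q)) = false := by
            simp [Slice.hasRow, hq]
          rw [this]; rfl
        · have : Slice.hasOcc [⟨ρ, (M.fvo ρ).map Prod.snd⟩] (ρ ++ a) = true := by
            simp only [Slice.hasOcc, List.any_cons, List.any_nil, Bool.or_false,
              List.contains_eq_mem, decide_eq_true_eq]
            exact (mem_fvo M ρ _).2 ⟨i, a, ha, rfl⟩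
          rw [this]; rfl
      · simp at h
  · rw [List.mem_singleton] at h
    subst h
    exact key (sliceCoherent_nil M ρ) rfl

theorem slice_coherent {σ : Ty} (M : Tm Γ σ) (π : Path) :
    ∀ sl ∈ (synth M π).2, SliceCoherent M π 1 sl := by
  induction M generalizing π with
  | var i => simp [synth]
  | lam M ih =>
    intro sl hsl
    obtain ⟨h1, h2⟩ := (mem_synth_lam M π).1 hsl
    obtain ⟨h3, w', h4, h5⟩ := outer_coherent (ih (π ++ [.body])) (List.mem_append_left _ h1)
    refine ⟨fun h => ⟨h3 h, ?_⟩, w', h4, h5.congr (fun _ _ => rfl) fun i => ?_⟩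
    -- If the box is closed at the body, no box is open there. But an occurrence of the bound
    -- variable, which is in no list of the slice, would still have this box open.
    · by_contra h0
      obtain ⟨b, hb⟩ := List.exists_mem_of_ne_nil _ h0
      have h6 := h5.out_le 0 hb
      rw [h2 b hb] at h6
      have : (if sl.hasRow (some (π ++ [.body])) then 1 else 0) ≤ 1 := by split <;> simp
      simp at h6
      beta_reduce at h
      omega
    · refine Fin.cases (fun a ha => ?_) (fun i a ha => rfl) i
      rw [h2 a ha]; rfl
  | app M N ihM ihN =>
    intro sl hsl
    rw [synth_app_slices] at hsl
    obtain ⟨s, hs, t, ht, rfl⟩ := mem_prodUnion.1 (List.mem_append_left [[]] hsl)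
    have us := outerSlices_under' M _ hs
    have ut := outerSlices_under' N _ ht
    have e1 : ∀ q, t.hasRow (some (π ++ [.fn] ++ q)) = false := fun q =>
      ut.hasRow_eq_false fun ⟨r, hr⟩ => not_prefix_fn_arg π q r hr.symm
    have e2 : ∀ q, t.hasOcc (π ++ [.fn] ++ q) = false := fun q =>
      ut.hasOcc_eq_false fun ⟨r, hr⟩ => not_prefix_fn_arg π q r hr.symm
    have e3 : ∀ q, s.hasRow (some (π ++ [.arg] ++ q)) = false := fun q =>
      us.hasRow_eq_false fun ⟨r, hr⟩ => not_prefix_fn_arg π r q hr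
    have e4 : ∀ q, s.hasOcc (π ++ [.arg] ++ q) = false := fun q =>
      us.hasOcc_eq_false fun ⟨r, hr⟩ => not_prefix_fn_arg π r q hr
    have e1' := e1 []
    have e3' := e3 []
    rw [List.append_nil] at e1' e3'
    have a1 := outer_coherent (ihM (π ++ [.fn])) hs
    have a2 := outer_coherent (ihN (π ++ [.arg])) ht
    unfold SliceCoherent at a1 a2 ⊢
    rw [Coherent]
    simp only [Slice.hasRow_append, e1', e3', Bool.or_false, Bool.false_or]
    obtain ⟨h1, w', h2, h3⟩ := a1
    obtain ⟨h1', w'', h2', h3'⟩ := a2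
    refine ⟨⟨h1, w', h2, h3.congr (fun q _ => ?_) fun i a ha => ?_⟩,
      h1', w'', h2', h3'.congr (fun q _ => ?_) fun i a ha => ?_⟩
    · simp only [e1, Bool.or_false]
    · simp only [Slice.hasOcc_append, e2, Bool.or_false]
    · simp only [e3, Bool.false_or]
    · simp only [Slice.hasOcc_append, e4, Bool.false_or]

theorem coherent_of_slices {σ : Ty} (M : Tm Γ σ) (π : Path) (W : List Slice)
    (h : ∀ sl ∈ W, sl ∈ (synth M π).2 ++ [[]]) :
    Coherent M π W.length (closing W) fun _ a => passing W a := by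
  induction W with
  | nil => exact Coherent.const M π 0
  | cons sl W ih =>
    have h1 := ih fun s hs => h s (List.mem_cons_of_mem _ hs)
    have h2 : SliceCoherent M π 1 sl := by
      rcases List.mem_append.1 (h sl (by simp)) with h | h
      · exact slice_coherent M π sl h
      · rw [List.mem_singleton] at h
        subst h
        exact sliceCoherent_nil M π
    refine Coherent.congr (h1.add h2) (fun q _ => ?_) fun _ a _ => ?_
    · simp only [closing, List.countP_cons]
    · simp only [passing, List.countP_cons]
      cases sl.hasOcc (π ++ a) <;> simp

theorem mem_opened (X : Var → ℕ) {σ : Ty} (M : Tm Γ σ) (π : Path) :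
    ∀ sl ∈ opened X M π, sl ∈ (synth M π).2 ++ [[]] := by
  intro sl hsl
  unfold opened openedWith at hsl
  split at hsl
  · simp at hsl
  · rcases List.mem_append.1 hsl with h | h
    · obtain ⟨s, hs, h⟩ := List.mem_flatMap.1 h
      rw [(List.mem_replicate.1 h).2]
      exact List.mem_append_left _ hs
    · rw [(List.mem_replicate.1 h).2]
      simp

theorem coherent_opened (X : Var → ℕ) {σ : Ty} (M : Tm Γ σ) (π : Path) :
    Coherent M π (opened X M π).length (closing (opened X M π))
      fun _ a => passing (opened X M π) a :=
  coherent_of_slices M π _ (mem_opened X M π)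

theorem opened_of_isVar (X : Var → ℕ) {σ : Ty} {M : Tm Γ σ} (π : Path) (h : M.isVar = true) :
    opened X M π = [] := by
  rw [opened, openedWith, if_pos h]

end coherent

/-! ### The rows of an abstraction, uniformly for the three cases -/

section lam
variable {n : ℕ} {Γ : Fin n → Ty}

theorem Tm.toLam_isApp {σ : Ty} {M : Tm Γ σ} (h : M.isApp = true) : M.toLam.IsApp := by
  cases M with
  | var i => cases h
  | lam M => cases h
  | app M N => trivial

theorem Tm.toLam_isVar {σ : Ty} {M : Tm Γ σ} : M.toLam.IsVar ↔ M.isVar = true := by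
  cases M with
  | var i => exact ⟨fun _ => rfl, fun _ => ⟨_, rfl⟩⟩
  | lam M => simp [Tm.toLam, Lam.IsVar, Tm.isVar]
  | app M N => simp [Tm.toLam, Lam.IsVar, Tm.isVar]

theorem Tm.isApp_of_isVar {σ : Ty} {M : Tm Γ σ} (h : M.isVar = true) : M.isApp = false := by
  cases M with
  | var i => rfl
  | lam M => rfl
  | app M N => cases h

/-- The first type of a bound variable is the type of its argument. -/
theorem synth_lam_dom_cons (X : Var → ℕ) {σ τ : Ty} (M : Tm (extend σ Γ) τ) (π : Path)
    {q : Path × GTy (extend σ Γ 0)} {rest : List (Path × GTy (extend σ Γ 0))}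
    (h : (synth M (π ++ [.body])).1.base 0 = q :: rest) :
    (synth (.lam M) π).1.ty.dom.inst X =
      ETy.bang^[passing (opened X M (π ++ [.body])) q.1] (q.2.inst X) := by
  have h1 := boxed_base M (π ++ [.body]) 0
  rw [h, List.map_cons] at h1
  rw [synth_lam_cons (Γ := Γ) M π h1]
  exact inst_boxTy_opened _ _ _ _ _

theorem boxed_base_nil_of {σ : Ty} {M : Tm Γ σ} {ρ : Path} {i : Fin n}
    (h : (synth M ρ).1.base i = []) : (boxed M ρ).base i = [] := by
  rw [boxed_base, h]; rfl

theorem synth_lam_dom_nil {σ τ : Ty} (M : Tm (extend σ Γ) τ) (π : Path)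
    (h : (synth M (π ++ [.body])).1.base 0 = []) :
    (synth (.lam M) π).1.ty.dom = process π σ [] := by
  cases hM : M.isApp
  · rw [synth_lam_nil M π (boxed_base_nil_of h) hM]; rfl
  · rw [synth_lam_app M π (boxed_base_nil_of h) hM]; rfl

theorem synth_lam_cod_app {σ τ : Ty} (M : Tm (extend σ Γ) τ) (π : Path)
    (h : M.toLam.occs 0 = []) (hM : M.isApp = true) :
    (synth (.lam M) π).1.ty.cod = (boxed M (π ++ [.body])).ty.withExpo [.res π] := by
  rw [synth_lam_app M π ((boxed_base_eq_nil _ _ _).2 h) hM]; rfl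

theorem synth_lam_cod {σ τ : Ty} (M : Tm (extend σ Γ) τ) (π : Path)
    (h : ¬ (M.toLam.occs 0 = [] ∧ M.isApp = true)) :
    (synth (.lam M) π).1.ty.cod = (boxed M (π ++ [.body])).ty := by
  obtain ⟨xs, h'⟩ : ∃ xs : List (Path × GTy σ), (boxed M (π ++ [.body])).base 0 = xs := ⟨_, rfl⟩
  match xs, h' with
  | (a, Θ) :: rest, h' => rw [synth_lam_cons M π h']; rfl
  | [], h' =>
    have h0 := (boxed_base_eq_nil _ _ _).1 h'
    rw [synth_lam_nil M π h' (by simpa [h0] using h)]; rfl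

theorem synth_lam_inst (X : Var → ℕ) {σ τ : Ty} (M : Tm (extend σ Γ) τ) (π : Path) :
    (synth (.lam M) π).1.ty.inst X = .lolli ((synth (.lam M) π).1.ty.dom.inst X)
      ((synth (.lam M) π).1.ty.cod.inst X) := by
  obtain ⟨xs, h'⟩ : ∃ xs : List (Path × GTy σ), (boxed M (π ++ [.body])).base 0 = xs := ⟨_, rfl⟩
  match xs, h' with
  | (a, Θ) :: rest, h' => rw [synth_lam_cons M π h']; rfl
  | [], h' =>
    cases hM : M.isApp
    · rw [synth_lam_nil M π h' hM]; rfl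
    · rw [synth_lam_app M π h' hM]; rfl

/-- Boxes can be closed at the body only for a vacuous abstraction over an application, where the
fresh exponent makes the second equation a condition. In the other cases the codomain is the boxed
type itself and the equation holds trivially. -/
theorem rowsHold_lam (X : Var → ℕ) (pend : Path → ℕ) {σ τ : Ty} (M : Tm (extend σ Γ) τ)
    (π : Path) (hp : pend (π ++ [.body]) ≠ 0 → M.isApp = true ∧ M.toLam.occs 0 = []) :
    RowsHold X pend (synth (.lam M) π).1.cons ↔
      RowsHold X (fun l => pend l + closing (opened X M (π ++ [.body])) l)
        (synth M (π ++ [.body])).1.cons ∧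
      ETy.bang^[(opened X M (π ++ [.body])).length] ((synth M (π ++ [.body])).1.ty.inst X) =
        ETy.bang^[pend (π ++ [.body])] ((synth (.lam M) π).1.ty.cod.inst X) ∧
      (∀ q ∈ (synth M (π ++ [.body])).1.base 0,
        ETy.bang^[passing (opened X M (π ++ [.body])) q.1] (q.2.inst X) =
          (synth (.lam M) π).1.ty.dom.inst X) ∧
      (2 ≤ (M.toLam.occs 0).length → ∃ A, (synth (.lam M) π).1.ty.dom.inst X = .bang A) := by
  have triv : ¬ (M.toLam.occs 0 = [] ∧ M.isApp = true) →
      (ETy.bang^[(opened X M (π ++ [.body])).length] ((synth M (π ++ [.body])).1.ty.inst X) =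
        ETy.bang^[pend (π ++ [.body])] ((synth (.lam M) π).1.ty.cod.inst X)) := by
    intro h
    have h0 : pend (π ++ [.body]) = 0 := by
      by_contra h1
      exact h ⟨(hp h1).2, (hp h1).1⟩
    rw [h0, synth_lam_cod M π h, inst_boxed_ty]; rfl
  match h : (synth M (π ++ [.body])).1.base 0 with
  | q :: rest =>
    have hb := boxed_base M (π ++ [.body]) 0
    have h1 := hb
    rw [h, List.map_cons] at h1
    have hne : ¬ (M.toLam.occs 0 = [] ∧ M.isApp = true) := by
      rintro ⟨h2, -⟩
      have h3 := (boxed_base_eq_nil M (π ++ [.body]) 0).2 h2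
      cases h1.symm.trans h3
    have e1 : ∀ D, (boxTy M (π ++ [.body]) (synth M (π ++ [.body])).2 q.1 q.2).inst X = D →
        (RowsHold X pend (synth (.lam M) π).1.cons ↔
        RowsHold X (fun l => pend l + closing (opened X M (π ++ [.body])) l)
          (synth M (π ++ [.body])).1.cons ∧
        (∀ q ∈ (boxed M (π ++ [.body])).base 0, q.2.inst X = D) ∧
        (2 ≤ (M.toLam.occs 0).length → ∃ A, D = .bang A)) := by
      rintro _ rfl
      exact rowsHold_lam_cons (Γ := Γ) X pend M π h1
    have e2 : (boxTy M (π ++ [.body]) (synth M (π ++ [.body])).2 q.1 q.2).inst X =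
        (synth (.lam M) π).1.ty.dom.inst X := by
      rw [synth_lam_dom_cons X M π h]; exact inst_boxTy_opened _ _ _ _ _
    rw [e1 _ e2, hb, h]
    simp only [triv hne, true_and, List.mem_map, forall_exists_index, and_imp,
      forall_apply_eq_imp_iff₂, inst_boxTy_opened]
  | [] =>
    have hb := boxed_base_nil_of h
    have h0 := (boxed_base_eq_nil _ _ _).1 hb
    simp only [h0, List.length_nil]
    cases hM : M.isApp
    · rw [rowsHold_lam_nil X pend M π hb hM]
      simp [triv (by simp [hM]), h]
    · rw [rowsHold_lam_app X pend M π hb hM, synth_lam_cod_app M π h0 hM]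
      simp [h]

end lam

/-! ### The decoration that belongs to a solution -/

/-- The boxes to be closed, after the boxes rooted at `M` have been opened. -/
def pendIn {n : ℕ} {Γ : Fin n → Ty} {σ : Ty} (X : Var → ℕ) (M : Tm Γ σ) (ρ : Path)
    (pend : Path → ℕ) : Path → ℕ := fun l => pend l + closing (opened X M ρ) l

/-- The boxes open at the variable occurrences, after the boxes rooted at `M` have been opened. -/
def outIn {n : ℕ} {Γ : Fin n → Ty} {σ : Ty} (X : Var → ℕ) (M : Tm Γ σ) (ρ : Path)
    (out : Fin n → Path → ℕ) : Fin n → Path → ℕ := fun i a => out i a + passing (opened X M ρ) a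

/-- The number of boxes open in `M`, if `w` boxes are open at its parent. -/
def depthIn {n : ℕ} {Γ : Fin n → Ty} {σ : Ty} (X : Var → ℕ) (M : Tm Γ σ) (ρ : Path)
    (w : ℕ) (pend : Path → ℕ) : ℕ := w - pend ρ + (opened X M ρ).length

/-- The assignment `X` opens and closes boxes as prescribed by the decoration `f`. -/
def Follows (X : Var → ℕ) : {n : ℕ} → {Γ : Fin n → Ty} → {σ : Ty} → Tm Γ σ → Path → ℕ →
    (Path → ℕ) → (Path → Mark) → Prop
  | _, _Γ, _, .var _, _, _, _, _ => True
  | _, _, _, .lam M, π, w, pend, f =>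
      (M.isVar = false → depthIn X M (π ++ [.body]) w pend = (f [.body]).e) ∧
      Follows X M (π ++ [.body]) (depthIn X M (π ++ [.body]) w pend)
        (pendIn X M (π ++ [.body]) pend) (below .body f)
  | _, _, _, .app M N, π, w, pend, f =>
      ((M.isVar = false → w - pend (π ++ [.fn]) = (f [.fn]).e) ∧
        Follows X M (π ++ [.fn]) (w - pend (π ++ [.fn])) pend (below .fn f)) ∧
      (N.isVar = false → depthIn X N (π ++ [.arg]) w pend = (f [.arg]).e) ∧
      Follows X N (π ++ [.arg]) (depthIn X N (π ++ [.arg]) w pend)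
        (pendIn X N (π ++ [.arg]) pend) (below .arg f)

/-- The decoration of the subterm `M` at `π` that belongs to the assignment `X`; `b` and `w` boxes
are open at its parent and at its root. The variable `i` has the type `tx i`, and is bound at a node
where `lv i` boxes are open. Boxes are closed before new ones are opened. -/
def decoration (X : Var → ℕ) : {n : ℕ} → {Γ : Fin n → Ty} → {σ : Ty} → Tm Γ σ → Path → ℕ → ℕ →
    (Path → ℕ) → (Fin n → ℕ) → (Fin n → ETy) → Path → Mark
  | _, _Γ, _, .var i, _, _, _, _, lv, tx, _ => ⟨lv i, lv i, tx i⟩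
  | _, _, _, .lam M, π, b, w, pend, lv, tx, q =>
      match q with
      | .body :: q => decoration X M (π ++ [.body]) w (depthIn X M (π ++ [.body]) w pend)
          (pendIn X M (π ++ [.body]) pend) (extend w lv)
          (extend ((synth (.lam M) π).1.ty.dom.inst X) tx) q
      | _ => ⟨min b w, w, (synth (.lam M) π).1.ty.inst X⟩
  | _, _, _, .app M N, π, b, w, pend, lv, tx, q =>
      match q with
      | .fn :: q => decoration X M (π ++ [.fn]) w (w - pend (π ++ [.fn])) pend lv tx q
      | .arg :: q => decoration X N (π ++ [.arg]) w (depthIn X N (π ++ [.arg]) w pend)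
          (pendIn X N (π ++ [.arg]) pend) lv tx q
      | _ => ⟨min b w, w, (synth (.app M N) π).1.ty.inst X⟩

section decoration
variable {n : ℕ} {Γ : Fin n → Ty} (X : Var → ℕ)

theorem decoration_root {σ : Ty} (M : Tm Γ σ) (π : Path) (b w : ℕ) (pend : Path → ℕ)
    (lv : Fin n → ℕ) (tx : Fin n → ETy) (h : M.isVar = false) :
    decoration X M π b w pend lv tx [] = ⟨min b w, w, (synth M π).1.ty.inst X⟩ := by
  cases M with
  | var i => cases h
  | lam M => rfl
  | app M N => rfl

/-- A leaf is marked by the data of its binder rather than by the boxes around it: the boxes in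
between reach the variable through their substitution lists. -/
theorem decoration_occ {σ : Ty} (M : Tm Γ σ) (π : Path) (b w : ℕ) (pend : Path → ℕ)
    (lv : Fin n → ℕ) (tx : Fin n → ETy) {i : Fin n} {a : Path} (ha : a ∈ M.toLam.occs i) :
    decoration X M π b w pend lv tx a = ⟨lv i, lv i, tx i⟩ := by
  induction M generalizing π b w pend a with
  | var j =>
    simp only [Tm.toLam, Lam.occs] at ha
    split at ha
    · rename_i h; subst h; rfl
    · simp at ha
  | lam M ih =>
    obtain ⟨a, ha', rfl⟩ := List.mem_map.1 ha
    exact ih _ _ _ _ (extend w lv) (extend ((synth (.lam M) π).1.ty.dom.inst X) tx) ha'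
  | app M N ihM ihN =>
    rcases List.mem_append.1 ha with ha | ha <;> obtain ⟨a, ha', rfl⟩ := List.mem_map.1 ha
    · exact ihM _ _ _ _ lv tx ha'
    · exact ihN _ _ _ _ lv tx ha'

theorem Coherent.opened {σ : Ty} {M : Tm Γ σ} {ρ : Path} {w w' : ℕ} {pend : Path → ℕ}
    {out : Fin n → Path → ℕ} (h : Coherent M ρ w' pend out) (hw : w = w' + pend ρ) :
    Coherent M ρ (depthIn X M ρ w pend) (pendIn X M ρ pend) (outIn X M ρ out) := by
  have : depthIn X M ρ w pend = w' + (EAL.opened X M ρ).length := by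
    unfold depthIn; omega
  rw [this]
  exact h.add (coherent_opened X M ρ)

end decoration

/-- This is where boxes are superimposed. Of the `p` boxes closed and the `m` boxes opened at the
node, `min p m` pairs cancel: each such box stays open. Either only opened boxes are left, or only
closed ones, and in the latter case the node has to be an application. The type equation survives
because modalities can be cancelled on both sides. -/
theorem edge_of_ne_var {k : ℕ} {M : Lam k} {w w' p m : ℕ} {A C : ETy} (h : w' + p = w + m)
    (hp : p ≠ 0 → M.IsApp) (hA : ETy.bang^[m] A = ETy.bang^[p] C) :
    Edge w M ⟨min w w', w', A⟩ C := by
  rcases le_total w w' with hw | hw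
  · rw [min_eq_left hw]
    refine ⟨le_rfl, ?_, fun h => absurd h (lt_irrefl _)⟩
    have hm : m = p + (w' - w) := by omega
    rw [hm, ETy.bang_iterate_add] at hA
    simpa [Mark.out] using ETy.bang_iterate_injective p hA
  · rw [min_eq_right hw]
    refine ⟨hw, ?_, fun h' => Or.inr ⟨hp (by simp only at h'; omega), rfl⟩⟩
    have hm : p = m + (w - w') := by omega
    rw [hm, ETy.bang_iterate_add] at hA
    simpa [Mark.out] using ETy.bang_iterate_injective m hA

theorem edge_of_var {k : ℕ} {M : Lam k} {w l : ℕ} {A C : ETy} (hM : M.IsVar) (hl : l ≤ w)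
    (h : ETy.bang^[l] A = ETy.bang^[w] C) : Edge w M ⟨l, l, A⟩ C := by
  refine ⟨hl, ?_, fun _ => Or.inl hM⟩
  have hw : w = l + (w - l) := by omega
  rw [hw, ETy.bang_iterate_add] at h
  simpa [Mark.out] using ETy.bang_iterate_injective l h

section decoration
variable {n : ℕ} {Γ : Fin n → Ty} (X : Var → ℕ)

/-- The state of the variables in the subterm `M` at `π`: `lv i` boxes are open at the binder of
`i`, and its type there is `tx i`. -/
def VarsOk {σ : Ty} (M : Tm Γ σ) (π : Path) (out : Fin n → Path → ℕ) (lv : Fin n → ℕ)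
    (tx : Fin n → ETy) : Prop :=
  ∀ i, ∀ q ∈ (synth M π).1.base i, lv i ≤ out i q.1 ∧
    ETy.bang^[lv i] (tx i) = ETy.bang^[out i q.1] (q.2.inst X)

variable {X}

theorem VarsOk.le_out {σ : Ty} {M : Tm Γ σ} {π : Path} {out : Fin n → Path → ℕ} {lv : Fin n → ℕ}
    {tx : Fin n → ETy} (h : VarsOk X M π out lv tx) {i : Fin n} {a : Path}
    (ha : a ∈ M.toLam.occs i) : lv i ≤ out i (π ++ a) := by
  have h1 : π ++ a ∈ ((synth M π).1.base i).map Prod.fst := by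
    rw [synth_base_addr]; exact List.mem_map_of_mem ha
  obtain ⟨q, hq, h2⟩ := List.mem_map.1 h1
  rw [← h2]
  exact (h i q hq).1

/-- For a variable nothing is opened or closed, and coherence says that the `w` boxes open here are
those counted at its occurrence; the type then comes from `VarsOk`. -/
theorem edge_decoration {σ : Ty} {M : Tm Γ σ} {ρ : Path} {w w' m : ℕ} {pend pend' : Path → ℕ}
    {out : Fin n → Path → ℕ} {lv : Fin n → ℕ} {tx : Fin n → ETy} {C : ETy}
    (hw : w' + pend ρ = w + m) (hp : pend ρ ≠ 0 → M.isApp = true) (hm : M.isVar = true → m = 0)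
    (hv : VarsOk X M ρ out lv tx) (hc : Coherent M ρ w' pend' out)
    (hC : ETy.bang^[m] ((synth M ρ).1.ty.inst X) = ETy.bang^[pend ρ] C) :
    Edge w M.toLam (decoration X M ρ w w' pend' lv tx []) C := by
  cases hM : M.isVar
  · rw [decoration_root _ _ _ _ _ _ _ _ hM]
    exact edge_of_ne_var hw (fun h => Tm.toLam_isApp (hp h)) hC
  · cases M with
    | lam M => cases hM
    | app M N => cases hM
    | var i =>
      have hm := hm rfl
      have hp : pend ρ = 0 := by
        by_contra h
        cases hp h
      rw [hm, hp] at hC hw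
      obtain ⟨h1, h2⟩ := hv i (ρ, process ρ (Γ i) []) (by simp [synth])
      have h3 : out i ρ = w := hc.trans (by omega)
      rw [h3] at h1 h2
      refine edge_of_var (Tm.toLam_isVar (M := .var i) |>.2 rfl) h1 (h2.trans ?_)
      exact congrArg _ hC

theorem d_decoration_le {σ : Ty} {M : Tm Γ σ} {π : Path} {b w : ℕ} {pend : Path → ℕ}
    {out : Fin n → Path → ℕ} {lv : Fin n → ℕ} {tx : Fin n → ETy}
    (hc : Coherent M π w pend out) (hv : VarsOk X M π out lv tx)
    (hb : ∀ i, M.toLam.occs i ≠ [] → lv i ≤ b) (i : Fin n) (a : Path) (ha : a ∈ M.toLam.occs i) :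
    (decoration X M π b w pend lv tx a).d ≤ min b w := by
  rw [decoration_occ X M π b w pend lv tx ha]
  exact le_min (hb i (List.ne_nil_of_mem ha)) ((hv.le_out ha).trans (hc.out_le i ha))

/-- Boxes opened at the body add equally many modalities to the type of an occurrence and to its
count of open boxes, so the invariant survives. The bound variable starts with `w` boxes open at its
binder. -/
theorem VarsOk.body {σ τ : Ty} {M : Tm (extend σ Γ) τ} {π : Path} {w : ℕ}
    {out : Fin n → Path → ℕ} {lv : Fin n → ℕ} {tx : Fin n → ETy} {C : ETy}
    (hv : VarsOk X (.lam M) π out lv tx)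
    (hC : ∀ q ∈ (synth M (π ++ [.body])).1.base 0,
      ETy.bang^[passing (opened X M (π ++ [.body])) q.1] (q.2.inst X) = C) :
    VarsOk X M (π ++ [.body]) (outIn X M (π ++ [.body]) (extend (fun _ => w) out)) (extend w lv)
      (extend C tx) := by
  intro i
  refine Fin.cases (fun q hq => ?_) (fun i q hq => ?_) i
  · refine ⟨Nat.le_add_right _ _, ?_⟩
    have : outIn X M (π ++ [.body]) (extend (fun _ => w) out) 0 q.1 =
      w + passing (opened X M (π ++ [.body])) q.1 := rfl
    rw [this, ETy.bang_iterate_add, hC q hq]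
    rfl
  · have h1 : (q.1, boxTy M (π ++ [.body]) (synth M (π ++ [.body])).2 q.1 q.2) ∈
        (boxed M (π ++ [.body])).base i.succ := by
      rw [boxed_base]
      exact List.mem_map.2 ⟨q, hq, rfl⟩
    obtain ⟨h2, h3⟩ := hv i _ (synth_lam_base M π i ▸ h1)
    have h4 : (boxTy M (π ++ [.body]) (synth M (π ++ [.body])).2 q.1 q.2).inst X =
      ETy.bang^[passing (opened X M (π ++ [.body])) q.1] (q.2.inst X) := inst_boxTy_opened _ _ _ _ _
    have : outIn X M (π ++ [.body]) (extend (fun _ => w) out) i.succ q.1 =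
      out i q.1 + passing (opened X M (π ++ [.body])) q.1 := rfl
    refine ⟨h2.trans (Nat.le_add_right _ _), ?_⟩
    rw [this, ETy.bang_iterate_add, ← h4]
    exact h3

theorem VarsOk.fn {σ τ : Ty} {M : Tm Γ (.arrow σ τ)} {N : Tm Γ σ} {π : Path}
    {out : Fin n → Path → ℕ} {lv : Fin n → ℕ} {tx : Fin n → ETy}
    (hv : VarsOk X (.app M N) π out lv tx) : VarsOk X M (π ++ [.fn]) out lv tx := by
  intro i q hq
  refine hv i q ?_
  rw [synth_app]
  exact List.mem_append_left _ hq

theorem VarsOk.arg {σ τ : Ty} {M : Tm Γ (.arrow σ τ)} {N : Tm Γ σ} {π : Path}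
    {out : Fin n → Path → ℕ} {lv : Fin n → ℕ} {tx : Fin n → ETy}
    (hv : VarsOk X (.app M N) π out lv tx) :
    VarsOk X N (π ++ [.arg]) (outIn X N (π ++ [.arg]) out) lv tx := by
  intro i q hq
  have h1 : (q.1, boxTy N (π ++ [.arg]) (synth N (π ++ [.arg])).2 q.1 q.2) ∈
      (boxed N (π ++ [.arg])).base i := by
    rw [boxed_base]
    exact List.mem_map.2 ⟨q, hq, rfl⟩
  obtain ⟨h2, h3⟩ := hv i (q.1, boxTy N (π ++ [.arg]) (synth N (π ++ [.arg])).2 q.1 q.2) (by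
    rw [synth_app]
    exact List.mem_append_right _ h1)
  refine ⟨h2.trans (Nat.le_add_right _ _), ?_⟩
  rw [outIn, ETy.bang_iterate_add, ← inst_boxTy_opened]
  exact h3

theorem ite_eq_of_imp {p : ℕ} {b : Bool} (h : p ≠ 0 → b = true) :
    (if b = true then p else 0) = p := by
  by_cases hp : p = 0
  · simp [hp]
  · rw [if_pos (h hp)]

theorem depthIn_add {σ : Ty} (X : Var → ℕ) (M : Tm Γ σ) {ρ : Path} {w w' : ℕ} {pend : Path → ℕ}
    (h : w = w' + pend ρ) : depthIn X M ρ w pend + pend ρ = w + (opened X M ρ).length := by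
  unfold depthIn; omega

/-- Both halves are proved together since they use the same descent: coherence gives the depths, the
rows give the types. `Follows` records that `X` has the depths of its own decoration, for later
comparison with the stacked assignment. -/
theorem wf_decoration {σ : Ty} (M : Tm Γ σ) (π : Path) {b w : ℕ} {pend : Path → ℕ}
    {out : Fin n → Path → ℕ} {lv : Fin n → ℕ} {tx : Fin n → ETy}
    (hc : Coherent M π w pend out) (hr : RowsHold X pend (synth M π).1.cons)
    (hv : VarsOk X M π out lv tx) (hb : ∀ i, M.toLam.occs i ≠ [] → lv i ≤ b) :
    WF M.toLam (decoration X M π b w pend lv tx) ∧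
      Follows X M π w pend (decoration X M π b w pend lv tx) := by
  induction M generalizing π b w pend with
  | var i => exact ⟨rfl, trivial⟩
  | lam M ih =>
    have hd := d_decoration_le (b := b) hc hv hb
    have hlv : ∀ i, M.toLam.occs i.succ ≠ [] → lv i ≤ w := by
      intro i hi
      obtain ⟨a, ha⟩ := List.exists_mem_of_ne_nil _ hi
      have ha' : Dir.body :: a ∈ (Tm.lam M).toLam.occs i := List.mem_map_of_mem ha
      exact (hv.le_out ha').trans (hc.out_le i ha')
    obtain ⟨h1, w', h2, h3⟩ := hc
    obtain ⟨r1, r2, r3, r4⟩ := (rowsHold_lam X pend M π h1).1 hr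
    have hc' := h3.opened X h2
    have hv' := hv.body (w := w) r3
    obtain ⟨i1, i2⟩ := ih (π ++ [.body]) hc' r1 hv' (b := w) fun i =>
      Fin.cases (motive := fun i => M.toLam.occs i ≠ [] → (extend w lv) i ≤ w)
        (fun _ => le_rfl) hlv i
    have hE := edge_decoration (depthIn_add X M h2) (fun h => (h1 h).1)
      (fun h => by rw [opened_of_isVar X _ h]; rfl) hv' hc' r2
    refine ⟨⟨min_le_right _ _, hd, ⟨_, _, synth_lam_inst X M π, hE, fun a ha => ?_, r4⟩, i1⟩,
      fun hM => ?_, i2⟩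
    · have := decoration_occ X M (π ++ [.body]) w (depthIn X M (π ++ [.body]) w pend)
        (pendIn X M (π ++ [.body]) pend) (extend w lv)
        (extend ((synth (.lam M) π).1.ty.dom.inst X) tx) ha
      exact ⟨congrArg Mark.d this, congrArg Mark.A this⟩
    · exact (congrArg Mark.e (decoration_root X M (π ++ [.body]) w _ _ _ _ hM)).symm
  | app M N ihM ihN =>
    have hd := d_decoration_le (b := b) hc hv hb
    have hlv : ∀ i, (Tm.app M N).toLam.occs i ≠ [] → lv i ≤ w := by
      intro i hi
      obtain ⟨a, ha⟩ := List.exists_mem_of_ne_nil _ hi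
      exact (hv.le_out ha).trans (hc.out_le i ha)
    obtain ⟨⟨h1, w', h2, h3⟩, k1, v', k2, k3⟩ := hc
    obtain ⟨r1, r2, r3, r4⟩ := (rowsHold_app X pend M N π).1 hr
    rw [ite_eq_of_imp h1] at r3
    rw [ite_eq_of_imp k1] at r4
    have hc' := k3.opened X k2
    have h2' : w - pend (π ++ [.fn]) = w' := by omega
    obtain ⟨i1, i2⟩ := ihM (π ++ [.fn]) (b := w) h3 r1 hv.fn fun i hi =>
      hlv i (by simp [Tm.toLam, Lam.occs, hi])
    obtain ⟨j1, j2⟩ := ihN (π ++ [.arg]) (b := w) hc' r2 hv.arg fun i hi =>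
      hlv i (by simp [Tm.toLam, Lam.occs, hi])
    rw [← h2'] at i1 i2 h3
    have hE := edge_decoration (m := 0) (w := w) (pend := pend) (by omega) h1 (fun _ => rfl) hv.fn h3 r3
    have hE' := edge_decoration (depthIn_add X N k2) k1
      (fun h => by rw [opened_of_isVar X _ h]; rfl) hv.arg hc' r4
    refine ⟨⟨min_le_right _ _, hd, ⟨_, ?_, hE'⟩, i1, j1⟩, ⟨fun hM => ?_, i2⟩, fun hN => ?_, j2⟩
    · have : ((synth (.app M N) π).1.ty) = (synth M (π ++ [.fn])).1.ty.cod := by rw [synth_app]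
      change Edge w M.toLam _ (.lolli _ ((synth (.app M N) π).1.ty.inst X))
      rw [this]
      exact hE
    · exact (congrArg Mark.e (decoration_root X M (π ++ [.fn]) w _ _ _ _ hM)).symm
    · exact (congrArg Mark.e (decoration_root X N (π ++ [.arg]) w _ _ _ _ hN)).symm

end decoration

/-! ### Comparison of two assignments with the same depths -/

section transfer
variable {n : ℕ} {Γ : Fin n → Ty} {X Y : Var → ℕ}

theorem inst_process_congr (h : ∀ π q, X (.typ π q) = Y (.typ π q)) (π : Path) (σ : Ty)
    (q : List Bool) : (process π σ q).inst X = (process π σ q).inst Y := by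
  induction σ generalizing q with
  | o => simp [process, GTy.inst, Expo.val, h]
  | arrow σ τ ihσ ihτ => simp [process, GTy.inst, Expo.val, h, ihσ, ihτ]

/-- The two instances differ at most in the outermost exponent, and that is the part being replaced.
-/
theorem inst_withExpo_congr {σ : Ty} {Θ : GTy σ} {a b : ℕ} {A : ETy} {e : Expo}
    (hX : Θ.inst X = ETy.bang^[a] A) (hY : Θ.inst Y = ETy.bang^[b] A) (he : e.val X = e.val Y) :
    (Θ.withExpo e).inst X = (Θ.withExpo e).inst Y := by
  have h : ETy.bang^[b] (Θ.inst X) = ETy.bang^[a] (Θ.inst Y) := by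
    rw [hX, hY, ← ETy.bang_iterate_add, ← ETy.bang_iterate_add, add_comm]
  cases Θ with
  | base e => simp [GTy.withExpo, GTy.inst, he]
  | arrow e Θ Δ =>
    simp only [GTy.inst, ← ETy.bang_iterate_add] at h
    obtain ⟨-, h1, h2⟩ := ETy.bang_iterate_lolli h
    simp [GTy.withExpo, GTy.inst, he, h1, h2]

theorem bang_iterate_transfer {a b c d : ℕ} {A C : ETy} (h : ETy.bang^[a] A = ETy.bang^[b] C)
    (hab : a + d = c + b) : ETy.bang^[c] A = ETy.bang^[d] C := by
  apply ETy.bang_iterate_injective b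
  rw [← ETy.bang_iterate_add, ← ETy.bang_iterate_add, add_comm b c, ← hab, add_comm a d,
    ETy.bang_iterate_add, h, ← ETy.bang_iterate_add, add_comm]

/-- Equal depths before and after the node fix the difference between opened and closed boxes,
though not the two numbers themselves. At a variable both are zero. -/
theorem depthIn_eq {σ : Ty} {M : Tm Γ σ} {ρ : Path} {w vX vY e : ℕ} {pX pY : Path → ℕ}
    (hX : w = vX + pX ρ) (hY : w = vY + pY ρ) (aX : pX ρ ≠ 0 → M.isApp = true)
    (aY : pY ρ ≠ 0 → M.isApp = true) (eX : M.isVar = false → depthIn X M ρ w pX = e)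
    (eY : M.isVar = false → depthIn Y M ρ w pY = e) :
    depthIn X M ρ w pX = depthIn Y M ρ w pY ∧
      (opened X M ρ).length + pY ρ = (opened Y M ρ).length + pX ρ := by
  have key : depthIn X M ρ w pX = depthIn Y M ρ w pY := by
    cases hM : M.isVar
    · rw [eX hM, eY hM]
    · have h1 : pX ρ = 0 := by
        by_contra h
        have := aX h
        rw [Tm.isApp_of_isVar hM] at this
        cases this
      have h2 : pY ρ = 0 := by
        by_contra h
        have := aY h
        rw [Tm.isApp_of_isVar hM] at this
        cases this
      simp [depthIn, opened_of_isVar _ _ hM, h1, h2]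
  refine ⟨key, ?_⟩
  unfold depthIn at key
  omega

/-- Type equations at a node depend on opened and closed boxes only through their difference, which
equal depths determine. Types in the base need not agree inside a subterm, only after the boxes open
at the occurrence have been added; hence the exponents `oX` and `oY`. -/
theorem transfer (htyp : ∀ π q, X (.typ π q) = Y (.typ π q)) (hres : ∀ π, X (.res π) = Y (.res π))
    {σ : Ty} (M : Tm Γ σ) (π : Path) {w : ℕ} {pX pY : Path → ℕ} {oX oY : Fin n → Path → ℕ}
    {f : Path → Mark} (cX : Coherent M π w pX oX) (cY : Coherent M π w pY oY)
    (fX : Follows X M π w pX f) (fY : Follows Y M π w pY f)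
    (hr : RowsHold X pX (synth M π).1.cons) :
    (synth M π).1.ty.inst X = (synth M π).1.ty.inst Y ∧
    (∀ i, ∀ q ∈ (synth M π).1.base i,
      ETy.bang^[oX i q.1] (q.2.inst X) = ETy.bang^[oY i q.1] (q.2.inst Y)) ∧
    RowsHold Y pY (synth M π).1.cons := by
  induction M generalizing π w pX pY f with
  | @var m Γ i =>
    refine ⟨inst_process_congr htyp _ _ _, fun j q hq => ?_, rowsHold_nil⟩
    simp only [synth] at hq
    split at hq
    · rename_i h
      subst h
      rw [List.mem_singleton] at hq
      subst hq
      have h1 : oX j π = w := cX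
      have h2 : oY j π = w := cY
      simp only [h1, h2]
      rw [inst_process_congr htyp]
    · simp at hq
  | @lam m Γ σ τ M ih =>
    obtain ⟨aX, vX, hX, cX'⟩ := cX
    obtain ⟨aY, vY, hY, cY'⟩ := cY
    obtain ⟨eX, fX⟩ := fX
    obtain ⟨eY, fY⟩ := fY
    obtain ⟨r1, r2, r3, r4⟩ := (rowsHold_lam X pX M π aX).1 hr
    obtain ⟨hd, hl⟩ := depthIn_eq hX hY (fun h => (aX h).1) (fun h => (aY h).1) eX eY
    have cX'' := cX'.opened X hX
    have cY'' := cY'.opened Y hY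
    rw [hd] at cX'' fX
    obtain ⟨t1, t2, t3⟩ := ih (π ++ [.body]) cX'' cY'' fX fY r1
    have hx : ∀ q ∈ (synth M (π ++ [.body])).1.base 0,
        ETy.bang^[passing (opened X M (π ++ [.body])) q.1] (q.2.inst X) =
          ETy.bang^[passing (opened Y M (π ++ [.body])) q.1] (q.2.inst Y) := by
      intro q hq
      have h := t2 0 q hq
      have h1 : ∀ Z, outIn Z M (π ++ [.body]) (extend (fun _ => w) oX) 0 q.1 =
        w + passing (opened Z M (π ++ [.body])) q.1 := fun _ => rfl
      have h2 : ∀ Z, outIn Z M (π ++ [.body]) (extend (fun _ => w) oY) 0 q.1 =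
        w + passing (opened Z M (π ++ [.body])) q.1 := fun _ => rfl
      rw [h1, h2, ETy.bang_iterate_add, ETy.bang_iterate_add] at h
      -- Both assignments have `w` boxes open at the binder, so these modalities cancel.
      exact ETy.bang_iterate_injective w h
    have hdom : (synth (.lam M) π).1.ty.dom.inst X = (synth (.lam M) π).1.ty.dom.inst Y := by
      match h : (synth M (π ++ [.body])).1.base 0 with
      | q :: rest =>
        rw [synth_lam_dom_cons X M π h, synth_lam_dom_cons Y M π h]
        exact hx q (by rw [h]; simp)
      | [] =>
        rw [synth_lam_dom_nil M π h]
        exact inst_process_congr htyp _ _ _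
    have hcod : (synth (.lam M) π).1.ty.cod.inst X = (synth (.lam M) π).1.ty.cod.inst Y := by
      -- For a vacuous abstraction over an application, the outermost exponent is a `res` variable,
      -- on which `X` and `Y` agree. Otherwise no box is closed at the body, and equally many are
      -- opened.
      by_cases h : M.toLam.occs 0 = [] ∧ M.isApp = true
      · rw [synth_lam_cod_app M π h.1 h.2]
        have h' := inst_boxed_ty Y M (π ++ [.body])
        rw [← t1] at h'
        exact inst_withExpo_congr (inst_boxed_ty X M _) h' (by simp [Expo.val, hres])
      · have p1 : pX (π ++ [.body]) = 0 := by
          by_contra h0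
          exact h (aX h0).symm
        have p2 : pY (π ++ [.body]) = 0 := by
          by_contra h0
          exact h (aY h0).symm
        have hl' : (opened X M (π ++ [.body])).length = (opened Y M (π ++ [.body])).length := by omega
        rw [synth_lam_cod M π h, inst_boxed_ty, inst_boxed_ty, t1, hl']
    refine ⟨?_, fun i q hq => ?_, (rowsHold_lam Y pY M π aY).2 ⟨t3, ?_, fun q hq => ?_, fun h => ?_⟩⟩
    · rw [synth_lam_inst, synth_lam_inst, hdom, hcod]
    · have hq : q ∈ (boxed M (π ++ [.body])).base i.succ := synth_lam_base M π i ▸ hq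
      rw [boxed_base] at hq
      obtain ⟨q, hq', rfl⟩ := List.mem_map.1 hq
      have h := t2 i.succ q hq'
      have h1 : ∀ Z, outIn Z M (π ++ [.body]) (extend (fun _ => w) oX) i.succ q.1 =
        oX i q.1 + passing (opened Z M (π ++ [.body])) q.1 := fun _ => rfl
      have h2 : ∀ Z, outIn Z M (π ++ [.body]) (extend (fun _ => w) oY) i.succ q.1 =
        oY i q.1 + passing (opened Z M (π ++ [.body])) q.1 := fun _ => rfl
      rw [h1, h2, ETy.bang_iterate_add, ETy.bang_iterate_add, ← inst_boxTy_opened,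
        ← inst_boxTy_opened] at h
      exact h
    · rw [t1, hcod] at r2
      exact bang_iterate_transfer r2 hl
    · rw [← hx q hq, r3 q hq, hdom]
    · rw [← hdom]; exact r4 h
  | @app m Γ σ τ M N ihM ihN =>
    obtain ⟨⟨aX, vX, hX, cX⟩, aX', vX', hX', cX'⟩ := cX
    obtain ⟨⟨aY, vY, hY, cY⟩, aY', vY', hY', cY'⟩ := cY
    obtain ⟨⟨eX, fX⟩, eX', fX'⟩ := fX
    obtain ⟨⟨eY, fY⟩, eY', fY'⟩ := fY
    obtain ⟨r1, r2, r3, r4⟩ := (rowsHold_app X pX M N π).1 hr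
    rw [ite_eq_of_imp aX] at r3
    rw [ite_eq_of_imp aX'] at r4
    obtain ⟨hd, hl⟩ := depthIn_eq hX' hY' aX' aY' eX' eY'
    -- No boxes are opened at a function part, so equal depths give equal numbers of closed boxes.
    have hp : pX (π ++ [.fn]) = pY (π ++ [.fn]) := by
      by_contra hne
      have hM : M.isVar = false := by
        by_contra hM
        have hM := Tm.isApp_of_isVar (Bool.not_eq_false _ ▸ hM)
        have h1 : ¬ pX (π ++ [.fn]) ≠ 0 := fun h => by rw [aX h] at hM; cases hM
        have h2 : ¬ pY (π ++ [.fn]) ≠ 0 := fun h => by rw [aY h] at hM; cases hM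
        omega
      have h1 := eX hM
      have h2 := eY hM
      omega
    have cX'' := cX'.opened X hX'
    have cY'' := cY'.opened Y hY'
    rw [hd] at cX'' fX'
    have h1 : w - pX (π ++ [.fn]) = vX := by omega
    have h2 : w - pY (π ++ [.fn]) = vX := by omega
    have h3 : vY = vX := by omega
    rw [h1] at fX
    rw [h2] at fY
    rw [h3] at cY
    obtain ⟨s1, s2, s3⟩ := ihM (π ++ [.fn]) cX cY fX fY r1
    obtain ⟨t1, t2, t3⟩ := ihN (π ++ [.arg]) cX'' cY'' fX' fY' r2
    obtain ⟨hexp, hdom, hcod⟩ : _ ∧ (synth M (π ++ [.fn])).1.ty.dom.inst X =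
        (synth M (π ++ [.fn])).1.ty.dom.inst Y ∧ (synth M (π ++ [.fn])).1.ty.cod.inst X =
        (synth M (π ++ [.fn])).1.ty.cod.inst Y := by
      rw [GTy.inst_arrow, GTy.inst_arrow] at s1
      exact ETy.bang_iterate_lolli s1
    refine ⟨?_, fun i q hq => ?_, (rowsHold_app Y pY M N π).2 ⟨s3, t3, ?_, ?_⟩⟩
    · rw [synth_app]; exact hcod
    · rw [synth_app] at hq
      rcases List.mem_append.1 hq with hq | hq
      · exact s2 i q hq
      · rw [boxed_base] at hq
        obtain ⟨q, hq', rfl⟩ := List.mem_map.1 hq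
        have h := t2 i q hq'
        simp only [outIn] at h
        rw [ETy.bang_iterate_add, ETy.bang_iterate_add, ← inst_boxTy_opened,
          ← inst_boxTy_opened] at h
        exact h
    · rw [ite_eq_of_imp aY, ← s1, r3, hp, hdom, hcod]
    · rw [ite_eq_of_imp aY']
      rw [t1, hdom] at r4
      exact bang_iterate_transfer r4 hl

end transfer

/-! ### Superimposed boxes -/

/-- The slice of the box of level `l` that is open at the root of `M`: boxes are closed at the
topmost nodes of smaller depth. -/
def levelSlice (l : ℕ) : {n : ℕ} → {Γ : Fin n → Ty} → {σ : Ty} → Tm Γ σ → Path →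
    (Path → Mark) → Slice
  | _, _Γ, _, .var _, _, _ => []
  | _, _, _, .lam M, π, f => if (f [.body]).d < l then
        (if M.isVar then [] else [⟨π ++ [.body], (M.fvo (π ++ [.body])).map Prod.snd⟩])
      else levelSlice l M (π ++ [.body]) (below .body f)
  | _, _, _, .app M N, π, f =>
      (if (f [.fn]).d < l then
        (if M.isVar then [] else [⟨π ++ [.fn], (M.fvo (π ++ [.fn])).map Prod.snd⟩])
      else levelSlice l M (π ++ [.fn]) (below .fn f)) ++
      (if (f [.arg]).d < l then
        (if N.isVar then [] else [⟨π ++ [.arg], (N.fvo (π ++ [.arg])).map Prod.snd⟩])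
      else levelSlice l N (π ++ [.arg]) (below .arg f))

section level
variable {n : ℕ} {Γ : Fin n → Ty}

/-- The slice of a box of level `l`, as seen from the parent of `M`. -/
def outerLevelSlice (l : ℕ) {σ : Ty} (M : Tm Γ σ) (ρ : Path) (f : Path → Mark) : Slice :=
  if (f []).d < l then (if M.isVar then [] else [⟨ρ, (M.fvo ρ).map Prod.snd⟩])
  else levelSlice l M ρ f

theorem levelSlice_lam (l : ℕ) {σ τ : Ty} (M : Tm (extend σ Γ) τ) (π : Path) (f : Path → Mark) :
    levelSlice l (.lam M) π f = outerLevelSlice l M (π ++ [.body]) (below .body f) := rfl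

theorem levelSlice_app (l : ℕ) {σ τ : Ty} (M : Tm Γ (.arrow σ τ)) (N : Tm Γ σ) (π : Path)
    (f : Path → Mark) : levelSlice l (.app M N) π f =
      outerLevelSlice l M (π ++ [.fn]) (below .fn f) ++
        outerLevelSlice l N (π ++ [.arg]) (below .arg f) := rfl

theorem Slice.under_nil (ρ : Path) : Slice.Under ρ [] := fun c hc => by cases hc

theorem fvo_under {σ : Ty} (M : Tm Γ σ) (ρ : Path) :
    Slice.Under ρ [⟨ρ, (M.fvo ρ).map Prod.snd⟩] := by
  intro c hc
  rw [List.mem_singleton] at hc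
  subst hc
  refine ⟨List.prefix_rfl, fun a ha => ?_⟩
  obtain ⟨i, b, -, rfl⟩ := (mem_fvo M ρ a).1 ha
  exact List.prefix_append _ _

theorem outerLevelSlice_under_of {l : ℕ} {σ : Ty} {M : Tm Γ σ} {ρ : Path} {f : Path → Mark}
    (h : (levelSlice l M ρ f).Under ρ) : (outerLevelSlice l M ρ f).Under ρ := by
  unfold outerLevelSlice
  split
  · split
    · exact Slice.under_nil _
    · exact fvo_under M ρ
  · exact h

theorem levelSlice_under (l : ℕ) {σ : Ty} (M : Tm Γ σ) (π : Path) (f : Path → Mark) :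
    (levelSlice l M π f).Under π ∧ ∀ c ∈ levelSlice l M π f, c.row ≠ π := by
  induction M generalizing π f with
  | var i => exact ⟨Slice.under_nil _, fun c hc => by cases hc⟩
  | lam M ih =>
    have h := outerLevelSlice_under_of (ih (π ++ [.body]) (below .body f)).1
    exact ⟨h.mono (List.prefix_append _ _), h.row_ne⟩
  | app M N ihM ihN =>
    have h := outerLevelSlice_under_of (ihM (π ++ [.fn]) (below .fn f)).1
    have h' := outerLevelSlice_under_of (ihN (π ++ [.arg]) (below .arg f)).1
    rw [levelSlice_app]
    refine ⟨fun c hc => ?_, fun c hc => ?_⟩ <;> rcases List.mem_append.1 hc with hc | hc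
    · exact h.mono (List.prefix_append _ _) c hc
    · exact h'.mono (List.prefix_append _ _) c hc
    · exact h.row_ne c hc
    · exact h'.row_ne c hc

theorem outerLevelSlice_under (l : ℕ) {σ : Ty} (M : Tm Γ σ) (π : Path) (f : Path → Mark) :
    (outerLevelSlice l M π f).Under π :=
  outerLevelSlice_under_of (levelSlice_under l M π f).1

theorem levelSlice_hasRow_self (l : ℕ) {σ : Ty} (M : Tm Γ σ) (π : Path) (f : Path → Mark) :
    (levelSlice l M π f).hasRow (some π) = false := by
  rw [Slice.hasRow, List.any_eq_false]
  intro c hc h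
  have h : π = c.row := by simpa using h
  exact (levelSlice_under l M π f).2 c hc h.symm

theorem not_fn_prefix (π q : Path) : ¬ π ++ [Dir.fn] <+: π ++ [Dir.arg] ++ q :=
  fun ⟨r, hr⟩ => not_prefix_fn_arg π r q hr

theorem not_arg_prefix (π q : Path) : ¬ π ++ [Dir.arg] <+: π ++ [Dir.fn] ++ q :=
  fun ⟨r, hr⟩ => not_prefix_fn_arg π q r hr.symm

/-- Occurrences of variables bound outside of a box are not left out of it. -/
theorem outerLevelSlice_hasOcc {l : ℕ} {σ : Ty} (M : Tm Γ σ) (ρ : Path) {f : Path → Mark}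
    (hWF : WF M.toLam f) {i : Fin n} {a : Path} (ha : a ∈ M.toLam.occs i) (hl : l ≤ (f a).d) :
    (outerLevelSlice l M ρ f).hasOcc (ρ ++ a) = false := by
  have hd : ¬ (f []).d < l := not_lt.2 (hl.trans (hWF.d_occ_le ha))
  rw [outerLevelSlice, if_neg hd]
  induction M generalizing ρ f a with
  | var j => rfl
  | lam M ih =>
    obtain ⟨a, ha', rfl⟩ := List.mem_map.1 ha
    obtain ⟨-, -, -, hW⟩ := hWF
    have hd' : ¬ (below .body f []).d < l := not_lt.2 (hl.trans (hW.d_occ_le ha'))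
    have h := ih (ρ ++ [.body]) hW (i := i.succ) ha' hl hd'
    rw [levelSlice_lam, outerLevelSlice, if_neg hd']
    simpa using h
  | app M N ihM ihN =>
    obtain ⟨-, -, -, hW, hW'⟩ := hWF
    rw [levelSlice_app, Slice.hasOcc_append]
    rcases List.mem_append.1 ha with ha | ha <;> obtain ⟨a, ha', rfl⟩ := List.mem_map.1 ha
    · have hd' : ¬ (below .fn f []).d < l := not_lt.2 (hl.trans (hW.d_occ_le ha'))
      have h := ihM (ρ ++ [.fn]) hW ha' hl hd'
      have h' := (outerLevelSlice_under l N (ρ ++ [.arg]) (below .arg f)).hasOcc_eq_false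
        (not_arg_prefix ρ a)
      have e : ρ ++ Dir.fn :: a = ρ ++ [.fn] ++ a := by simp
      rw [e, h', outerLevelSlice, if_neg hd', h]
      rfl
    · have hd' : ¬ (below .arg f []).d < l := not_lt.2 (hl.trans (hW'.d_occ_le ha'))
      have h := ihN (ρ ++ [.arg]) hW' ha' hl hd'
      have h' := (outerLevelSlice_under l M (ρ ++ [.fn]) (below .fn f)).hasOcc_eq_false
        (not_fn_prefix ρ a)
      have e : ρ ++ Dir.arg :: a = ρ ++ [.arg] ++ a := by simp
      rw [e, h', outerLevelSlice, if_neg hd', h]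
      rfl

theorem Tm.isApp_of_toLam {σ : Ty} {M : Tm Γ σ} (h : M.toLam.IsApp) : M.isApp = true := by
  cases M with
  | var i => cases h
  | lam M => cases h
  | app M N => rfl

/-- By the edge condition, a node at which boxes are closed is a leaf or an application; leaves
yield no critical point, and applications yield one in the algorithm as well. -/
theorem mem_outerLevelSlice_of {l b : ℕ} {σ : Ty} {M : Tm Γ σ} {ρ : Path} {f : Path → Mark}
    {C : ETy} (hE : Edge b M.toLam (f []) C) (hWF : WF M.toLam f) (hl : l ≤ b)
    (ih : l ≤ (f []).e → levelSlice l M ρ f ∈ (synth M ρ).2 ++ [[]]) :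
    outerLevelSlice l M ρ f ∈ outerSlices M ρ ++ [[]] := by
  unfold outerLevelSlice
  split
  · rename_i hd
    split
    · simp
    · rename_i hM
      have hM' : M.isApp = true := by
        rcases hE.2.2 (hd.trans_le hl) with h | h
        · exact absurd (Tm.toLam_isVar.1 h) hM
        · exact Tm.isApp_of_toLam h.1
      simp [outerSlices, newSlice, hM']
  · rename_i hd
    have := ih ((not_lt.1 hd).trans hWF.d_le_e)
    simp only [outerSlices, List.mem_append] at this ⊢
    tauto

/-- A stacked box is among the boxes for which the algorithm has a variable. Its slice survives an
abstraction inside the box because bound occurrences have the depth of their binder, hence are never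
left out. -/
theorem mem_levelSlice {l : ℕ} {σ : Ty} (M : Tm Γ σ) (π : Path) {f : Path → Mark}
    (hWF : WF M.toLam f) (hl : l ≤ (f []).e) : levelSlice l M π f ∈ (synth M π).2 ++ [[]] := by
  induction M generalizing π f with
  | var i => simp [levelSlice]
  | lam M ih =>
    obtain ⟨-, -, ⟨C, B, -, hE, hx, -⟩, hW⟩ := hWF
    have h := mem_outerLevelSlice_of (f := below .body f) hE hW hl (ih (π ++ [.body]) hW)
    rw [levelSlice_lam]
    rcases List.mem_append.1 h with h | h
    · refine List.mem_append_left _ ((mem_synth_lam M π).2 ⟨h, fun a ha => ?_⟩)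
      exact outerLevelSlice_hasOcc M (π ++ [.body]) hW ha (hl.trans (hx a ha).1.ge)
    · exact List.mem_append_right _ h
  | app M N ihM ihN =>
    obtain ⟨-, -, ⟨C, hE, hE'⟩, hW, hW'⟩ := hWF
    have h := mem_outerLevelSlice_of (f := below .fn f) hE hW hl (ihM (π ++ [.fn]) hW)
    have h' := mem_outerLevelSlice_of (f := below .arg f) hE' hW' hl (ihN (π ++ [.arg]) hW')
    rw [levelSlice_app, synth_app_slices]
    exact mem_prodUnion.2 ⟨_, h, _, h', rfl⟩

/-! ### Regions -/

theorem mem_outer_region_of {l : ℕ} {σ : Ty} {M : Tm Γ σ} {ρ : Path} {f : Path → Mark} {q : Path}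
    (ih : q ∈ region l M.toLam f ↔ q ∈ M.toLam.nodes ∧
      ∀ h ∈ (levelSlice l M ρ f).addrs, ¬ h <+: ρ ++ q) :
    (q ∈ if (f []).d < l then ∅ else region l M.toLam f) ↔ q ∈ M.toLam.nodes ∧
      ∀ h ∈ (outerLevelSlice l M ρ f).addrs, ¬ h <+: ρ ++ q := by
  unfold outerLevelSlice
  split
  · split
    · rename_i hM
      obtain ⟨i, hi⟩ := Tm.toLam_isVar.2 hM
      simp [hi, Lam.nodes]
    · simp [Slice.addrs]
  · exact ih

theorem forall_addrs_append (s t : Slice) (p : Path → Prop) :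
    (∀ h ∈ Slice.addrs (s ++ t), p h) ↔ (∀ h ∈ s.addrs, p h) ∧ ∀ h ∈ t.addrs, p h := by
  simp only [Slice.addrs, List.map_append, List.mem_append, or_imp, forall_and]

theorem Slice.Under.not_prefix {ρ a : Path} {sl : Slice} (hs : sl.Under ρ) (ha : ¬ ρ <+: a) :
    ∀ h ∈ sl.addrs, ¬ h <+: a := by
  intro h hh hp
  obtain ⟨c, hc, rfl⟩ := List.mem_map.1 hh
  exact ha ((hs c hc).1.trans hp)

/-- Leaving out the subterms at the critical points removes the same nodes as stopping at the slots;
a slot at a leaf needs no hole, since a leaf is no internal node. -/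
theorem mem_region {l : ℕ} {σ : Ty} (M : Tm Γ σ) (π : Path) (f : Path → Mark) (q : Path) :
    q ∈ region l M.toLam f ↔ q ∈ M.toLam.nodes ∧
      ∀ h ∈ (levelSlice l M π f).addrs, ¬ h <+: π ++ q := by
  have short : ∀ (π : Path) (δ : Dir), ¬ π ++ [δ] <+: π ++ [] := by
    intro π δ h
    have := h.length_le
    simp at this
  induction M generalizing π f q with
  | var i => simp [region, Tm.toLam, Lam.nodes]
  | lam M ih =>
    rw [levelSlice_lam]
    have hu := outerLevelSlice_under l M (π ++ [.body]) (below .body f)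
    match q with
    | [] =>
      simp only [region, Tm.toLam, Lam.nodes, Finset.mem_insert_self, true_and, true_iff]
      exact hu.not_prefix (short _ _)
    | .body :: q =>
      have h := mem_outer_region_of (ih (π ++ [.body]) (below .body f) q)
      have e : π ++ Dir.body :: q = π ++ [.body] ++ q := by simp
      rw [e]
      simp only [Tm.toLam, region, Lam.nodes, Finset.mem_insert, reduceCtorEq, false_or,
        Finset.mem_image, List.cons.injEq, true_and, exists_eq_right]
      exact h
    | .fn :: q => simp [Tm.toLam, region, Lam.nodes]
    | .arg :: q => simp [Tm.toLam, region, Lam.nodes]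
  | app M N ihM ihN =>
    rw [levelSlice_app, forall_addrs_append]
    have hu := outerLevelSlice_under l M (π ++ [.fn]) (below .fn f)
    have hu' := outerLevelSlice_under l N (π ++ [.arg]) (below .arg f)
    match q with
    | [] =>
      simp only [region, Tm.toLam, Lam.nodes, Finset.mem_insert_self, true_and, true_iff]
      exact ⟨hu.not_prefix (short _ _), hu'.not_prefix (short _ _)⟩
    | .fn :: q =>
      have h := mem_outer_region_of (ihM (π ++ [.fn]) (below .fn f) q)
      have e : π ++ Dir.fn :: q = π ++ [.fn] ++ q := by simp
      rw [e, and_iff_left (hu'.not_prefix (not_arg_prefix π q))]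
      simp only [Tm.toLam, region, Lam.nodes, Finset.mem_insert, reduceCtorEq, false_or,
        Finset.mem_image, List.cons.injEq, true_and, exists_eq_right, Finset.mem_union,
        false_and, and_false, exists_false, or_false]
      exact h
    | .arg :: q =>
      have h := mem_outer_region_of (ihN (π ++ [.arg]) (below .arg f) q)
      have e : π ++ Dir.arg :: q = π ++ [.arg] ++ q := by simp
      rw [e, and_iff_right (hu.not_prefix (not_fn_prefix π q))]
      simp only [Tm.toLam, region, Lam.nodes, Finset.mem_insert, reduceCtorEq, false_or,
        Finset.mem_image, List.cons.injEq, true_and, exists_eq_right, Finset.mem_union,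
        false_and, and_false, exists_false]
      exact h
    | .body :: q => simp [Tm.toLam, region, Lam.nodes]

theorem box_region {l m : ℕ} {σ : Ty} (M₀ : Lam m) (M : Tm Γ σ) (π : Path) (f : Path → Mark)
    (h : ∀ q, π ++ q ∈ M₀.nodes ↔ q ∈ M.toLam.nodes) :
    Box.region M₀ ⟨π, (levelSlice l M π f).addrs⟩ = (region l M.toLam f).image (π ++ ·) := by
  ext a
  simp only [Box.region, Finset.mem_filter, Finset.mem_image]
  constructor
  · rintro ⟨h1, ⟨q, rfl⟩, h2⟩
    exact ⟨q, (mem_region M π f q).2 ⟨(h q).1 h1, h2⟩, rfl⟩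
  · rintro ⟨q, hq, rfl⟩
    obtain ⟨h1, h2⟩ := (mem_region M π f q).1 hq
    exact ⟨(h q).2 h1, List.prefix_append _ _, h2⟩

end level

/-! ### The superimposed solution -/

section superimpose
variable {n : ℕ} {Γ : Fin n → Ty}

/-- The slices of the boxes rooted at the root of `M`. -/
def rootSlices {σ : Ty} (M : Tm Γ σ) (π : Path) (f : Path → Mark) : List Slice :=
  (List.range' ((f []).d + 1) ((f []).e - (f []).d)).map fun l => levelSlice l M π f

end superimpose

/-- The slices of the boxes rooted at the node `q` of `M`. -/
def slicesAt : {n : ℕ} → {Γ : Fin n → Ty} → {σ : Ty} → Tm Γ σ → Path → (Path → Mark) → Path →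
    List Slice
  | _, _Γ, _, .var i, π, f, _ => rootSlices (Γ := _Γ) (.var i) π f
  | _, _, _, .lam M, π, f, q =>
      match q with
      | .body :: q => slicesAt M (π ++ [.body]) (below .body f) q
      | _ => rootSlices (.lam M) π f
  | _, _, _, .app M N, π, f, q =>
      match q with
      | .fn :: q => slicesAt M (π ++ [.fn]) (below .fn f) q
      | .arg :: q => slicesAt N (π ++ [.arg]) (below .arg f) q
      | _ => rootSlices (.app M N) π f

/-- The assignment `X`, with the numbers of boxes prescribed by the decoration `f`. -/
def superimpose {n : ℕ} {Γ : Fin n → Ty} {σ : Ty} (X : Var → ℕ) (M : Tm Γ σ) (f : Path → Mark) :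
    Var → ℕ
  | .box β => ((slicesAt M [] f β.root).map Slice.addrs).count β.holes
  | v => X v

/-! ### Counting slices with multiplicity -/

theorem sum_map_ite_eq_count {α : Type} [DecidableEq α] (L : List α) (a : α) (c : ℕ) :
    (L.map fun x => if x = a then c else 0).sum = L.count a * c := by
  induction L with
  | nil => simp
  | cons x L ih =>
    rw [List.map_cons, List.sum_cons, ih, List.count_cons, add_mul, add_comm]
    by_cases h : x = a <;> simp [h]

-- The list `W` is recovered, up to order, from the multiplicities of its elements under an
-- injective labelling `g` of the candidates. Here `g` is the list of hole addresses that names a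
-- box variable.
open Classical in
theorem flatMap_replicate_perm {α β : Type} [BEq β] [LawfulBEq β] (g : α → β) (L W : List α)
    (hL : (L.map g).Nodup) (hW : ∀ x ∈ W, x ∈ L) :
    (L.flatMap fun x => List.replicate ((W.map g).count (g x)) x).Perm W := by
  have inj : ∀ x ∈ L, ∀ y ∈ L, g x = g y → x = y := fun x hx y hy h =>
    List.inj_on_of_nodup_map hL hx hy h
  rw [List.perm_iff_count]
  intro a
  rw [List.count_flatMap]
  by_cases ha : a ∈ L
  · have h1 : (L.map (List.count a ∘ fun x => List.replicate ((W.map g).count (g x)) x)) =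
        L.map fun x => if x = a then W.count a else 0 := by
      refine List.map_congr_left fun x hx => ?_
      simp only [Function.comp, List.count_replicate]
      by_cases hxa : x = a
      · subst hxa
        simp only [beq_self_eq_true, if_true]
        rw [List.count, List.countP_map, List.count]
        refine List.countP_congr fun y hy => ?_
        simp only [Function.comp, beq_iff_eq]
        exact ⟨fun h => inj y (hW y hy) x hx h, fun h => by rw [h]⟩
      · simp [hxa]
    rw [h1, sum_map_ite_eq_count, List.count_eq_one_of_mem hL.of_map ha, one_mul]
  · have h1 : W.count a = 0 := List.count_eq_zero.2 fun h => ha (hW a h)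
    rw [h1]
    refine List.sum_eq_zero fun x hx => ?_
    obtain ⟨y, hy, rfl⟩ := List.mem_map.1 hx
    simp only [Function.comp]
    refine List.count_eq_zero.2 fun h => ha ?_
    rw [(List.mem_replicate.1 h).2]; exact hy

section superimpose
variable {n : ℕ} {Γ : Fin n → Ty}

theorem slicesAt_nil {σ : Ty} (M : Tm Γ σ) (π : Path) (f : Path → Mark) :
    slicesAt M π f [] = rootSlices M π f := by
  cases M <;> rfl

/-- `Y` counts the boxes in the subterm `M` at `π` as prescribed by `f`. -/
def Counts (Y : Var → ℕ) {σ : Ty} (M : Tm Γ σ) (π : Path) (f : Path → Mark) : Prop :=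
  ∀ q h, Y (.box ⟨π ++ q, h⟩) = ((slicesAt M π f q).map Slice.addrs).count h

variable {Y : Var → ℕ}

theorem Counts.body {σ τ : Ty} {M : Tm (extend σ Γ) τ} {π : Path} {f : Path → Mark}
    (h : Counts Y (.lam M) π f) : Counts Y M (π ++ [.body]) (below .body f) := by
  intro q hs
  rw [List.append_assoc]
  exact h _ _

theorem Counts.fn {σ τ : Ty} {M : Tm Γ (.arrow σ τ)} {N : Tm Γ σ} {π : Path} {f : Path → Mark}
    (h : Counts Y (.app M N) π f) : Counts Y M (π ++ [.fn]) (below .fn f) := by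
  intro q hs
  rw [List.append_assoc]
  exact h _ _

theorem Counts.arg {σ τ : Ty} {M : Tm Γ (.arrow σ τ)} {N : Tm Γ σ} {π : Path} {f : Path → Mark}
    (h : Counts Y (.app M N) π f) : Counts Y N (π ++ [.arg]) (below .arg f) := by
  intro q hs
  rw [List.append_assoc]
  exact h _ _

/-- A box variable is named by its root and holes. Distinct slices have distinct holes and are
nonempty, so the variables `c` and `b` at a root are all different, and every stacked box is counted
by exactly one of them. -/
theorem opened_perm {σ : Ty} {M : Tm Γ σ} {π : Path} {f : Path → Mark} (hY : Counts Y M π f)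
    (hWF : WF M.toLam f) : (opened Y M π).Perm (rootSlices M π f) := by
  cases hM : M.isVar
  · have h1 : opened Y M π = ((synth M π).2 ++ [[]]).flatMap fun sl : Slice =>
        List.replicate (((rootSlices M π f).map Slice.addrs).count sl.addrs) sl := by
      have h2 : ∀ h, Y (.box ⟨π, h⟩) = ((rootSlices M π f).map Slice.addrs).count h := by
        intro h
        have := hY [] h
        rwa [List.append_nil, slicesAt_nil] at this
      rw [opened, openedWith, if_neg (by simp [hM])]
      simp only [h2, List.flatMap_append, List.flatMap_cons, List.flatMap_nil, List.append_nil]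
      rfl
    rw [h1]
    refine flatMap_replicate_perm Slice.addrs _ _ ?_ fun sl hsl => ?_
    · rw [List.map_append, List.nodup_append]
      refine ⟨nodup_addrs M π, by simp, ?_⟩
      intro x hx y hy hxy
      obtain ⟨sl, hsl, rfl⟩ := List.mem_map.1 hx
      simp only [List.map_cons, List.map_nil, List.mem_singleton] at hy
      rw [hy] at hxy
      exact (synth_slices_under M π sl hsl).2.1 (by simpa [Slice.addrs] using hxy)
    · obtain ⟨l, hl, rfl⟩ := List.mem_map.1 hsl
      rw [List.mem_range'_1] at hl
      exact mem_levelSlice M π hWF (by omega)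
  · rw [opened_of_isVar Y π hM]
    obtain ⟨i, hi⟩ := Tm.toLam_isVar.2 hM
    rw [hi] at hWF
    have : (f []).d = (f []).e := hWF
    simp [rootSlices, this]

theorem opened_length {σ : Ty} {M : Tm Γ σ} {π : Path} {f : Path → Mark} (hY : Counts Y M π f)
    (hWF : WF M.toLam f) : (opened Y M π).length = (f []).e - (f []).d := by
  rw [(opened_perm hY hWF).length_eq]
  simp [rootSlices]

/-! #### Numbers of boxes closed at a node -/

/-- The number of the boxes of levels `1, …, w` that are closed at the node `a`. -/
def levelClosing (w : ℕ) (s : ℕ → Slice) (a : Path) : ℕ :=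
  (List.range' 1 w).countP fun l => (s l).hasRow (some a)

/-- Boxes of levels above the outer depth have been closed at the node itself, so below it only the
levels up to that depth can still be closed. -/
theorem levelClosing_outer {σ : Ty} (M : Tm Γ σ) (ρ : Path) (f : Path → Mark) {w : ℕ}
    (hw : (f []).d ≤ w) {q : Path} (hq : q ≠ []) :
    levelClosing w (fun l => outerLevelSlice l M ρ f) (ρ ++ q) =
      levelClosing (f []).d (fun l => levelSlice l M ρ f) (ρ ++ q) := by
  have h : List.range' 1 w = List.range' 1 (f []).d ++ List.range' (1 + (f []).d) (w - (f []).d) := by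
    have := List.range'_append_1 (s := 1) (m := (f []).d) (n := w - (f []).d)
    rw [this]
    congr 1
    omega
  unfold levelClosing
  rw [h, List.countP_append]
  have h1 : (List.range' (1 + (f []).d) (w - (f []).d)).countP
      (fun l => (outerLevelSlice l M ρ f).hasRow (some (ρ ++ q))) = 0 := by
    rw [List.countP_eq_zero]
    intro l hl
    rw [List.mem_range'_1] at hl
    rw [outerLevelSlice, if_pos (by omega)]
    split <;> simp [Slice.hasRow, hq]
  rw [h1, add_zero]
  refine List.countP_congr fun l hl => ?_
  rw [List.mem_range'_1] at hl
  have h2 : outerLevelSlice l M ρ f = levelSlice l M ρ f := if_neg (by omega)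
  simp only [h2]

theorem levelClosing_self {σ : Ty} (M : Tm Γ σ) (ρ : Path) (f : Path → Mark) {w : ℕ}
    (hw : (f []).d ≤ w) (hM : M.isVar = false) :
    levelClosing w (fun l => outerLevelSlice l M ρ f) ρ = w - (f []).d := by
  have h : List.range' 1 w = List.range' 1 (f []).d ++ List.range' (1 + (f []).d) (w - (f []).d) := by
    have := List.range'_append_1 (s := 1) (m := (f []).d) (n := w - (f []).d)
    rw [this]
    congr 1
    omega
  unfold levelClosing
  rw [h, List.countP_append]
  have h1 : (List.range' (1 + (f []).d) (w - (f []).d)).countP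
      (fun l => (outerLevelSlice l M ρ f).hasRow (some ρ)) = w - (f []).d := by
    conv_rhs => rw [← List.length_range' (s := 1 + (f []).d) (n := w - (f []).d) (step := 1)]
    rw [List.countP_eq_length]
    intro l hl
    rw [List.mem_range'_1] at hl
    rw [outerLevelSlice, if_pos (by omega), if_neg (by simp [hM])]
    simp [Slice.hasRow]
  have h2 : (List.range' 1 (f []).d).countP
      (fun l => (outerLevelSlice l M ρ f).hasRow (some ρ)) = 0 := by
    rw [List.countP_eq_zero]
    intro l hl
    rw [List.mem_range'_1] at hl
    rw [outerLevelSlice, if_neg (by omega), levelSlice_hasRow_self]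
    simp
  rw [h1, h2, zero_add]

/-- The boxes rooted here have exactly the levels from `d + 1` to `e`. The pending boxes always form
an initial segment of the levels, which is the stack discipline. -/
theorem levelClosing_rootSlices {σ : Ty} (M : Tm Γ σ) (ρ : Path) (f : Path → Mark)
    (h : (f []).d ≤ (f []).e) (a : Path) :
    levelClosing (f []).d (fun l => levelSlice l M ρ f) a + closing (rootSlices M ρ f) a =
      levelClosing (f []).e (fun l => levelSlice l M ρ f) a := by
  have h1 : List.range' 1 (f []).e =
      List.range' 1 (f []).d ++ List.range' ((f []).d + 1) ((f []).e - (f []).d) := by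
    have := List.range'_append_1 (s := 1) (m := (f []).d) (n := (f []).e - (f []).d)
    rw [add_comm _ 1, this]
    congr 1
    omega
  unfold levelClosing closing rootSlices
  rw [h1, List.countP_append, List.countP_map]
  rfl

/-- A box rooted at the function part would make its type a modality instead of an arrow.
Accordingly the algorithm does not box function parts. -/
theorem WF.fn_d_eq_e {k b : ℕ} {M : Lam k} {f : Path → Mark} {A C : ETy}
    (hE : Edge b M (f []) (.lolli A C)) (hWF : WF M f) : (f []).d = (f []).e := by
  obtain ⟨h1, h2, h3⟩ := hE
  rcases h1.lt_or_eq with h | h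
  · rcases h3 h with ⟨i, rfl⟩ | h
    · exact hWF
    · exact h.2
  · have := hWF.d_le_e
    by_contra hne
    obtain ⟨m, hm⟩ : ∃ m, (f []).e - (f []).d = m + 1 := ⟨(f []).e - (f []).d - 1, by omega⟩
    rw [Mark.out, hm, ← h, Nat.sub_self, Function.iterate_succ_apply'] at h2
    cases h2

theorem closing_perm {W W' : List Slice} (h : W.Perm W') (l : Path) :
    closing W l = closing W' l := h.countP_eq _

theorem follows_of_isVar {σ : Ty} {M : Tm Γ σ} (hM : M.isVar = true) {π : Path} {w : ℕ}
    {pend : Path → ℕ} {f : Path → Mark} : Follows Y M π w pend f := by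
  cases M with
  | var i => trivial
  | lam M => cases hM
  | app M N => cases hM

/-- From the `w` open boxes, `w - d` are closed at the child and `e - d` are opened, which leaves
`e`. The invariant on pending boxes is restored by adding the levels of the opened ones. -/
theorem follows_child {σ : Ty} {N : Tm Γ σ} {ρ : Path} {g : Path → Mark} {w : ℕ}
    {pend : Path → ℕ} (hW : WF N.toLam g) (hC : Counts Y N ρ g) (hd : (g []).d ≤ w)
    (hp : ∀ q, pend (ρ ++ q) = levelClosing w (fun l => outerLevelSlice l N ρ g) (ρ ++ q))
    (ih : ∀ pend', (∀ q, q ≠ [] → pend' (ρ ++ q) =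
      levelClosing (g []).e (fun l => levelSlice l N ρ g) (ρ ++ q)) →
      Follows Y N ρ (g []).e pend' g) :
    (N.isVar = false → depthIn Y N ρ w pend = (g []).e) ∧
      Follows Y N ρ (depthIn Y N ρ w pend) (pendIn Y N ρ pend) g := by
  cases hN : N.isVar
  · have h0 := hp []
    rw [List.append_nil, levelClosing_self N ρ g hd hN] at h0
    have hde := hW.d_le_e
    have h1 : depthIn Y N ρ w pend = (g []).e := by
      rw [depthIn, h0, opened_length hC hW]
      omega
    refine ⟨fun _ => h1, ?_⟩
    rw [h1]
    refine ih _ fun q hq => ?_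
    rw [pendIn, hp q, levelClosing_outer N ρ g hd hq, closing_perm (opened_perm hC hW),
      levelClosing_rootSlices N ρ g hde]
  · exact ⟨fun h => (by cases h), follows_of_isVar hN⟩

theorem levelClosing_congr {w : ℕ} {s t : ℕ → Slice} {a : Path}
    (h : ∀ l, (s l).hasRow (some a) = (t l).hasRow (some a)) :
    levelClosing w s a = levelClosing w t a := by
  unfold levelClosing
  simp only [h]

/-- The invariant is that, inside a node of inner depth `e`, the open boxes are those of levels `1,
…, e` and each closes where its level slice says. -/
theorem follows_counts {σ : Ty} (M : Tm Γ σ) (π : Path) {f : Path → Mark} {pend : Path → ℕ}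
    (hWF : WF M.toLam f) (hY : Counts Y M π f)
    (hp : ∀ q, q ≠ [] → pend (π ++ q) =
      levelClosing (f []).e (fun l => levelSlice l M π f) (π ++ q)) :
    Follows Y M π (f []).e pend f := by
  induction M generalizing π f pend with
  | var i => trivial
  | lam M ih =>
    obtain ⟨-, -, ⟨C, B, -, hE, -, -⟩, hW⟩ := hWF
    refine follows_child (g := below .body f) hW hY.body hE.1 (fun q => ?_)
      fun pend' hp' => ih (π ++ [.body]) hW hY.body hp'
    have := hp (.body :: q) (by simp)
    rw [List.append_assoc]
    exact this
  | app M N ihM ihN =>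
    obtain ⟨-, -, ⟨C, hE, hE'⟩, hW, hW'⟩ := hWF
    have p1 : ∀ q, pend (π ++ [.fn] ++ q) = levelClosing (f []).e
        (fun l => outerLevelSlice l M (π ++ [.fn]) (below .fn f)) (π ++ [.fn] ++ q) := by
      intro q
      have := hp (.fn :: q) (by simp)
      have e : π ++ Dir.fn :: q = π ++ [.fn] ++ q := by simp
      rw [e] at this
      refine this.trans (levelClosing_congr fun l => ?_)
      rw [levelSlice_app, Slice.hasRow_append,
        (outerLevelSlice_under l N (π ++ [Dir.arg]) (below .arg f)).hasRow_eq_false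
          (not_arg_prefix π q), Bool.or_false]
    have p2 : ∀ q, pend (π ++ [.arg] ++ q) = levelClosing (f []).e
        (fun l => outerLevelSlice l N (π ++ [.arg]) (below .arg f)) (π ++ [.arg] ++ q) := by
      intro q
      have := hp (.arg :: q) (by simp)
      have e : π ++ Dir.arg :: q = π ++ [.arg] ++ q := by simp
      rw [e] at this
      refine this.trans (levelClosing_congr fun l => ?_)
      rw [levelSlice_app, Slice.hasRow_append,
        (outerLevelSlice_under l M (π ++ [Dir.fn]) (below .fn f)).hasRow_eq_false
          (not_fn_prefix π q), Bool.false_or]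
    refine ⟨?_, follows_child (g := below .arg f) hW' hY.arg hE'.1 p2
      fun pend' hp' => ihN (π ++ [.arg]) hW' hY.arg hp'⟩
    have hde : (f [.fn]).d = (f [.fn]).e := WF.fn_d_eq_e (f := below .fn f) hE hW
    cases hM : M.isVar
    · have h0 := p1 []
      rw [List.append_nil, levelClosing_self M _ (below .fn f) hE.1 hM] at h0
      have hd : (f [.fn]).d ≤ (f []).e := hE.1
      have h1 : (f []).e - pend (π ++ [.fn]) = (f [.fn]).e := by
        rw [h0, below_apply]
        omega
      refine ⟨fun _ => h1, ?_⟩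
      rw [h1]
      refine ihM (π ++ [.fn]) hW hY.fn fun q hq => ?_
      rw [p1 q, levelClosing_outer M _ (below .fn f) hE.1 hq, below_apply, hde]
    · exact ⟨fun h => (by cases h), follows_of_isVar hM⟩

/-! #### The boxes of the superimposed solution -/

/-- The instances of the boxes in the list `L`, drawn on `M₀`. -/
def drawn {m : ℕ} (Y : Var → ℕ) (M₀ : Lam m) (L : List Box) : Multiset (Finset Path) :=
  (L.map fun β => Multiset.replicate (Y (.box β)) (β.region M₀)).sum

theorem drawn_append {m : ℕ} (M₀ : Lam m) (L L' : List Box) :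
    drawn Y M₀ (L ++ L') = drawn Y M₀ L + drawn Y M₀ L' := by
  simp [drawn]

theorem drawn_root {m : ℕ} {σ : Ty} (M₀ : Lam m) (M : Tm Γ σ) (ρ : Path) :
    drawn Y M₀ (if M.isVar then [] else ((synth M ρ).2.map fun sl => ⟨ρ, sl.addrs⟩) ++ [⟨ρ, []⟩]) =
      (((opened Y M ρ).map fun sl => Box.region M₀ ⟨ρ, sl.addrs⟩ : List (Finset Path)) :
        Multiset (Finset Path)) := by
  unfold opened openedWith
  split
  · rfl
  · rw [drawn_append, List.map_append, ← Multiset.coe_add]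
    congr 1
    · generalize (synth M ρ).2 = L
      induction L with
      | nil => rfl
      | cons sl L ih =>
        rw [List.flatMap_cons, List.map_append, ← Multiset.coe_add, ← ih]
        simp [drawn, List.map_replicate, Multiset.coe_replicate]
    · simp [drawn, List.map_replicate, Multiset.coe_replicate, Slice.addrs]

/-- The boxes opened at the root by `Y` are a permutation of the stacked ones, and a level slice
cuts out the region of its level. -/
theorem drawn_boxed {m : ℕ} {σ : Ty} {M₀ : Lam m} {M : Tm Γ σ} {π : Path} {f : Path → Mark}
    (hM₀ : ∀ q, π ++ q ∈ M₀.nodes ↔ q ∈ M.toLam.nodes) (hWF : WF M.toLam f) (hY : Counts Y M π f)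
    (ih : drawn Y M₀ (synth M π).1.boxes =
      (innerBoxes 0 M.toLam f).map fun R => R.image (π ++ ·)) :
    drawn Y M₀ (boxed M π).boxes = (boxesAt 0 M.toLam f).map fun R => R.image (π ++ ·) := by
  have h1 : (boxed M π).boxes = (synth M π).1.boxes ++ if M.isVar then [] else
      ((synth M π).2.map fun sl => ⟨π, sl.addrs⟩) ++ [⟨π, []⟩] := boxing_boxes _ _ _ _
  have h2 : ((((opened Y M π).map fun sl => Box.region M₀ ⟨π, sl.addrs⟩ : List (Finset Path)) :
        Multiset (Finset Path))) =
      (rootBoxes (f []).d M.toLam f).map fun R => R.image (π ++ ·) := by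
    rw [Multiset.coe_eq_coe.2 ((opened_perm hY hWF).map _), rootSlices, List.map_map, rootBoxes,
      Multiset.map_map]
    have : (Finset.Ioc (f []).d (f []).e).val =
      (List.range' ((f []).d + 1) ((f []).e - (f []).d) : List ℕ) := rfl
    rw [this, Multiset.map_coe]
    congr 1
    refine List.map_congr_left fun l _ => ?_
    exact box_region M₀ M π f hM₀
  rw [h1, drawn_append, drawn_root, ih, h2, boxesAt, if_neg (by omega), Multiset.map_add, add_comm]

theorem drawn_synth {m : ℕ} {σ : Ty} (M₀ : Lam m) (M : Tm Γ σ) (π : Path) {f : Path → Mark}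
    (hM₀ : ∀ q, π ++ q ∈ M₀.nodes ↔ q ∈ M.toLam.nodes) (hWF : WF M.toLam f)
    (hY : Counts Y M π f) : drawn Y M₀ (synth M π).1.boxes =
      (innerBoxes 0 M.toLam f).map fun R => R.image (π ++ ·) := by
  induction M generalizing π f with
  | var i => rfl
  | lam M ih =>
    obtain ⟨-, -, -, hW⟩ := hWF
    have h0 : ∀ q, π ++ [.body] ++ q ∈ M₀.nodes ↔ q ∈ M.toLam.nodes := by
      intro q
      rw [List.append_assoc]
      refine (hM₀ _).trans ?_
      simp [Tm.toLam, Lam.nodes]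
    rw [synth_lam_boxes, drawn_boxed h0 hW hY.body (ih _ h0 hW hY.body), Tm.toLam,
      innerBoxes_lam, Multiset.map_map]
    refine Multiset.map_congr rfl fun R _ => ?_
    simp [Finset.image_image, Function.comp_def]
  | app M N ihM ihN =>
    obtain ⟨-, -, ⟨C, hE, hE'⟩, hW, hW'⟩ := hWF
    have h0 : ∀ q, π ++ [.fn] ++ q ∈ M₀.nodes ↔ q ∈ M.toLam.nodes := by
      intro q
      rw [List.append_assoc]
      refine (hM₀ _).trans ?_
      simp [Tm.toLam, Lam.nodes]
    have h0' : ∀ q, π ++ [.arg] ++ q ∈ M₀.nodes ↔ q ∈ N.toLam.nodes := by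
      intro q
      rw [List.append_assoc]
      refine (hM₀ _).trans ?_
      simp [Tm.toLam, Lam.nodes]
    have hde : (f [.fn]).d = (f [.fn]).e := WF.fn_d_eq_e (f := below .fn f) hE hW
    -- The function part carries no boxes of its own, in agreement with the algorithm, which draws
    -- none there.
    have h1 : boxesAt 0 M.toLam (below .fn f) = innerBoxes 0 M.toLam (below .fn f) := by
      rw [boxesAt, if_neg (by omega), rootBoxes]
      simp [hde]
    rw [synth_app]
    simp only [drawn_append]
    rw [drawn_boxed h0' hW' hY.arg (ihN _ h0' hW' hY.arg), ihM _ h0 hW hY.fn, Tm.toLam,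
      innerBoxes_app, h1, Multiset.map_add, Multiset.map_map, Multiset.map_map]
    congr 1 <;> refine Multiset.map_congr rfl fun R _ => ?_ <;>
      simp [Finset.image_image, Function.comp_def]

end superimpose

/-! ### Superimposing of derivations -/

section main
variable {n : ℕ} {Γ : Fin n → Ty} {σ : Ty}

/-- At the top level nothing remains pending except the boxes opened around the whole term. -/
theorem isSolution_iff (X : Var → ℕ) (M : Tm Γ σ) : IsSolution X (typeSynthesis M).A ↔
    RowsHold X (closing (opened X M [])) (synth M []).1.cons ∧
      ∀ i, RowsHold X (fun _ => 0) (contract (((boxed M []).base i).map Prod.snd)) := by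
  have h1 : IsSolution X (typeSynthesis M).A ↔ RowsHold X (fun _ => 0) ((boxed M []).cons ++
      (List.finRange n).flatMap fun i => contract (((boxed M []).base i).map Prod.snd)) := by
    unfold IsSolution RowsHold
    simp only [Constraint.holdsWith_zero]
    rfl
  rw [h1, rowsHold_append, rowsHold_boxed]
  simp only [zero_add]
  refine and_congr_right fun _ => ?_
  simp only [RowsHold, List.mem_flatMap, List.mem_finRange, true_and, forall_exists_index]
  exact ⟨fun h i r hr => h r i hr, fun h r i hr => h i r hr⟩

theorem instB_eq_of_mem {X : Var → ℕ} {M : Tm Γ σ} {i : Fin n}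
    (h : RowsHold X (fun _ => 0) (contract (((boxed M []).base i).map Prod.snd)))
    {q : Path × GTy (Γ i)} (hq : q ∈ (boxed M []).base i) :
    (typeSynthesis M).instB X i = some (q.2.inst X) := by
  have h1 : (typeSynthesis M).instB X i =
    (((boxed M []).base i).map Prod.snd).head?.map (GTy.inst X) := rfl
  rw [rowsHold_contract] at h
  have hq' : q.2 ∈ ((boxed M []).base i).map Prod.snd := List.mem_map_of_mem hq
  rw [h1]
  match h2 : ((boxed M []).base i).map Prod.snd with
  | [] => rw [h2] at hq'; cases hq'
  | Θ :: Θs => exact congrArg some (h.1 Θ (by simp [h2]) _ hq')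

theorem mem_boxed_base {M : Tm Γ σ} {π : Path} {i : Fin n} {q : Path × GTy (Γ i)}
    (hq : q ∈ (synth M π).1.base i) :
    (q.1, boxTy M π (synth M π).2 q.1 q.2) ∈ (boxed M π).base i := by
  rw [boxed_base]
  exact List.mem_map.2 ⟨q, hq, rfl⟩

theorem exists_mem_boxed_base {M : Tm Γ σ} {π a : Path} {i : Fin n} (ha : a ∈ M.toLam.occs i) :
    ∃ q, q ∈ (boxed M π).base i := by
  refine List.exists_mem_of_ne_nil _ fun h => ?_
  rw [boxed_base_eq_nil] at h
  rw [h] at ha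
  cases ha

theorem counts_superimpose (X : Var → ℕ) (M : Tm Γ σ) (f : Path → Mark) :
    Counts (superimpose X M f) M [] f := fun _ _ => rfl

/-- Every solution can be replaced by one whose boxes form a derivation. -/
theorem exists_superimposed (M : Tm Γ σ) {X : Var → ℕ} (hX : IsSolution X (typeSynthesis M).A) :
    ∃ Y, IsSolution Y (typeSynthesis M).A ∧
      (∃ P, IsDerivation M ((typeSynthesis M).instB Y) P ((typeSynthesis M).Θ.inst Y) ∧
        P.boxes = instantiatedBoxes M Y) ∧
      (typeSynthesis M).Θ.inst X = (typeSynthesis M).Θ.inst Y ∧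
      (typeSynthesis M).instB X = (typeSynthesis M).instB Y := by
  obtain ⟨rX, kX⟩ := (isSolution_iff X M).1 hX
  -- The default type `.o` is given only to variables without occurrence, where it plays no role.
  let tx : Fin n → ETy := fun i => ((typeSynthesis M).instB X i).getD .o
  have cX := coherent_opened X M []
  have vX : VarsOk X M [] (fun _ a => passing (opened X M []) a) (fun _ => 0) tx := by
    intro i q hq
    refine ⟨Nat.zero_le _, ?_⟩
    have h := instB_eq_of_mem (kX i) (mem_boxed_base hq)
    simp only [tx, h, Option.getD_some]
    exact inst_boxTy_opened X M [] q.1 q.2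
  -- The top level stands outside of all boxes, so `b` and the levels of the free variables are `0`.
  obtain ⟨hWF, fX⟩ := wf_decoration (b := 0) M [] cX rX vX fun _ _ => le_rfl
  have hocc : ∀ i, ∀ a ∈ M.toLam.occs i, (decoration X M [] 0 (opened X M []).length
      (closing (opened X M [])) (fun _ => 0) tx a).A = tx i := fun i a ha =>
    congrArg Mark.A (decoration_occ X M [] _ _ _ _ _ ha)
  have hroot : (decoration X M [] 0 (opened X M []).length (closing (opened X M []))
        (fun _ => 0) tx []).d = 0 ∧
      (decoration X M [] 0 (opened X M []).length (closing (opened X M []))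
        (fun _ => 0) tx []).e = (opened X M []).length ∧
      ETy.bang^[(opened X M []).length] (decoration X M [] 0 (opened X M []).length
        (closing (opened X M [])) (fun _ => 0) tx []).A = (boxed M []).ty.inst X := by
    cases hM : M.isVar
    · rw [decoration_root X M [] _ _ _ _ _ hM, inst_boxed_ty]
      exact ⟨Nat.zero_min _, rfl, rfl⟩
    · rw [inst_boxed_ty, opened_of_isVar X [] hM]
      cases M with
      | lam M => cases hM
      | app M N => cases hM
      | var i =>
        refine ⟨rfl, rfl, ?_⟩
        have := (vX i ([], process [] (Γ i) []) (by simp [synth])).2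
        rw [opened_of_isVar X [] hM] at this
        exact this
  -- From here on only well-formedness, the depths followed by `X`, and the types at the root and at
  -- the free occurrences are used.
  generalize decoration X M [] 0 (opened X M []).length (closing (opened X M []))
    (fun _ => 0) tx = f at hWF fX hocc hroot
  obtain ⟨hd, he, hA⟩ := hroot
  let Y := superimpose X M f
  have hC : Counts Y M [] f := counts_superimpose X M f
  have hlen : (opened Y M []).length = (opened X M []).length := by
    rw [opened_length hC hWF, hd, he, Nat.sub_zero]
  have cY := coherent_opened Y M []
  rw [hlen] at cY
  have fY : Follows Y M [] (f []).e (closing (opened Y M [])) f := by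
    refine follows_counts M [] hWF hC fun q _ => ?_
    rw [closing_perm (opened_perm hC hWF), ← levelClosing_rootSlices M [] f (by omega), hd]
    simp [levelClosing]
  rw [he] at fY
  -- The superimposed assignment changes box variables only, so it agrees with `X` on the other
  -- variables by definition.
  obtain ⟨t1, t2, t3⟩ := transfer (X := X) (Y := Y) (fun _ _ => rfl) (fun _ => rfl) M [] cX cY fX fY rX
  have hbase : ∀ i, ∀ q ∈ (boxed M []).base i, q.2.inst X = q.2.inst Y := by
    intro i q hq
    rw [boxed_base] at hq
    obtain ⟨q, hq', rfl⟩ := List.mem_map.1 hq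
    simp only [inst_boxTy_opened]
    exact t2 i q hq'
  have hΘ : (typeSynthesis M).Θ.inst X = (typeSynthesis M).Θ.inst Y := by
    change (boxed M []).ty.inst X = (boxed M []).ty.inst Y
    rw [inst_boxed_ty, inst_boxed_ty, hlen, t1]
  have hB : (typeSynthesis M).instB X = (typeSynthesis M).instB Y := by
    funext i
    change (((boxed M []).base i).map Prod.snd).head?.map (GTy.inst X) =
      (((boxed M []).base i).map Prod.snd).head?.map (GTy.inst Y)
    match h : (boxed M []).base i with
    | [] => rfl
    | q :: qs => exact congrArg some (hbase i q (by rw [h]; simp))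
  have kY : ∀ i, RowsHold Y (fun _ => 0) (contract (((boxed M []).base i).map Prod.snd)) := by
    intro i
    have := kX i
    rw [rowsHold_contract] at this ⊢
    simp only [List.mem_map, forall_exists_index, and_imp, forall_apply_eq_imp_iff₂] at this ⊢
    refine ⟨fun q hq q' hq' => ?_, fun h2 q hq => ?_⟩
    · rw [← hbase i q hq, ← hbase i q' hq']
      exact this.1 q hq q' hq'
    · rw [← hbase i q hq]
      exact this.2 h2 q hq
  have hS : IsSolution Y (typeSynthesis M).A := (isSolution_iff Y M).2 ⟨t3, kY⟩
  obtain ⟨P, hP1, hP2, hP3, hP4, hP5⟩ := exists_derivation M.toLam f hWF hd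
    ((typeSynthesis M).instB Y) (fun i a ha => by
      obtain ⟨q, hq⟩ := exists_mem_boxed_base (π := []) ha
      have h := instB_eq_of_mem (kX i) hq
      rw [hocc i a ha, ← hB, h]
      simp [tx, h]) (fun i hi => by
      have hlen : ((boxed M []).base i).length = (M.toLam.occs i).length := by
        have := congrArg List.length (boxed_base_addr M [] i)
        simpa using this
      obtain ⟨a, ha⟩ := List.exists_mem_of_length_pos (l := M.toLam.occs i) (by omega)
      obtain ⟨q, hq⟩ := exists_mem_boxed_base (π := []) ha
      have h1 := (rowsHold_contract _).1 (kY i)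
      obtain ⟨B, hB⟩ := h1.2 (by rw [List.length_map, hlen]; exact hi) q.2 (List.mem_map_of_mem hq)
      exact ⟨B, by rw [instB_eq_of_mem (kY i) hq, hB]⟩)
  refine ⟨Y, hS, ⟨P, ⟨hP1, hP2, hP3, ?_, GTy.erase_inst _ _, fun i C hC => ?_⟩, ?_⟩, hΘ, hB⟩
  · rw [he, hA] at hP4
    rw [← hΘ]
    exact hP4
  · obtain ⟨Θ, -, rfl⟩ := Option.map_eq_some_iff.1 hC
    exact GTy.erase_inst _ _
  · have h0 : ∀ q, [] ++ q ∈ M.toLam.nodes ↔ q ∈ M.toLam.nodes := fun _ => Iff.rfl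
    have h1 := drawn_boxed h0 hWF hC (drawn_synth M.toLam M [] h0 hWF hC)
    rw [hP5]
    refine Eq.trans ?_ h1.symm
    simp

theorem region_mem_instantiatedBoxes {M : Tm Γ σ} {X : Var → ℕ} {β : Box}
    (h : Instantiates M X β) : β.region M.toLam ∈ instantiatedBoxes M X := by
  obtain ⟨h1, h2⟩ := h
  unfold instantiatedBoxes
  generalize (typeSynthesis M).boxes = L at h1
  induction L with
  | nil => cases h1
  | cons γ L ih =>
    rw [List.map_cons, List.sum_cons, Multiset.mem_add]
    rcases List.mem_cons.1 h1 with rfl | h1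
    · exact Or.inl (Multiset.mem_replicate.2 ⟨by omega, rfl⟩)
    · exact Or.inr (ih h1)

end main

end EAL

theorem mainTheorem6 {n : ℕ} {Γ : Fin n → EAL.Ty} {σ : EAL.Ty} (M : EAL.Tm Γ σ)
    (X₁ : EAL.Var → ℕ) (hX₁ : EAL.IsSolution X₁ (EAL.typeSynthesis M).A)
    (β₁ β₂ : EAL.Box) (hβ₁ : EAL.Instantiates M X₁ β₁) (hβ₂ : EAL.Instantiates M X₁ β₂)
    (hincompatible : ¬ EAL.Compatible M β₁ β₂) :
    ∃ X₂ : EAL.Var → ℕ, X₂ ≠ X₁ ∧ EAL.IsSolution X₂ (EAL.typeSynthesis M).A ∧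
      (∃ P : EAL.EA n,
        EAL.IsDerivation M ((EAL.typeSynthesis M).instB X₂) P ((EAL.typeSynthesis M).Θ.inst X₂) ∧
        P.boxes = EAL.instantiatedBoxes M X₂) ∧
      (EAL.typeSynthesis M).Θ.inst X₁ = (EAL.typeSynthesis M).Θ.inst X₂ ∧
      (EAL.typeSynthesis M).instB X₁ = (EAL.typeSynthesis M).instB X₂ := by
  obtain ⟨X₂, h1, ⟨P, h2, h3⟩, h4, h5⟩ := EAL.exists_superimposed M hX₁
  refine ⟨X₂, ?_, h1, ⟨P, h2, h3⟩, h4, h5⟩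
  -- If the two solutions were equal, the derivation just found would contain both boxes and witness
  -- their compatibility.
  rintro rfl
  refine hincompatible ⟨_, P, _, h2, ?_, ?_⟩
  · rw [h3]; exact EAL.region_mem_instantiatedBoxes hβ₁
  · rw [h3]; exact EAL.region_mem_instantiatedBoxes hβ₂
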